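/- Let $\mathbb K$ be $\mathbb R$ or $\mathbb C$, let $l,m\ge 0$ be integers, and let $\mathfrak g$ be a semisimple Lie algebra over $\mathbb K$ of dimension $m$, with a basis $b_1,\dots,b_m$ and structure constants $c_{ij}^k$ given by $[b_i,b_j]=\sum_k c_{ij}^k b_k$. On $\mathbb K^{2l}\times\mathbb K^m$, with coordinates $(x_1,\dots,x_l,y_1,\dots,y_l,z_1,\dots,z_m)$, consider the Poisson structure $$\Pi=\Pi_S+\Pi_{\mathfrak g}=\sum_{i=1}^l\frac{\partial}{\partial x_i}\wedge\frac{\partial}{\partial y_i}+\frac12\sum_{i,j,k}c_{ij}^k z_k\frac{\partial}{\partial z_i}\wedge\frac{\partial}{\partial z_j},$$ the product of the standard symplectic structure on $\mathbb K^{2l}$ and the Lie–Poisson structure of $\mathfrak g$ on $\mathbb K^m$. Let $\mathrm H^1(\mathbb K^{2l}\times\mathbb K^m,\Pi)$ denote the first Poisson cohomology space in the formal category (coefficients in the formal power series in the coordinates) or in the local analytic category (coefficients in the germs at the origin of $\mathbb K$-analytic functions), that is, the space of vector fields $X$ with $[X,\Pi]=0$ (Schouten bracket) modulo the space of Hamiltonian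 vector fields $X_h=-[h,\Pi]$, where $X$ and $h$ have coefficients of the chosen kind. Then, in each of the two categories, $$\mathrm H^1(\mathbb K^{2l}\times\mathbb K^m,\Pi)=\{0\}:$$ every formal Poisson vector field is the Hamiltonian vector field of a formal function, and every germ at the origin of an analytic Poisson vector field is the Hamiltonian vector field of the germ of an analytic function. -/

import Mathlib

open Filter Topology

noncomputable section

namespace LocalPoisson

/-! Coordinates on `K^{2l} × K^m` : `inl i` is `x_i`, `inr (inl i)` is `y_i`, `inr (inr k)` is
`z_k`. A vector field is the family of its components `X i`, standing for `∑ i, X i ∂/∂u_i`; a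
bivector field is its skew-symmetric matrix `P i j = {u_i, u_j}`, standing for
`(1/2) ∑ i j, P i j ∂/∂u_i ∧ ∂/∂u_j`. -/

/-- The index set of the coordinates `(x_1, …, x_l, y_1, …, y_l, z_1, …, z_m)`. -/
abbrev Coord (l m : ℕ) : Type := Fin l ⊕ (Fin l ⊕ Fin m)

section Formulas

variable {ι A : Type*} [Fintype ι] [CommRing A]

/-- The Schouten bracket `[X, P]` of a vector field and a bivector field, that is, the Lie
derivative of `P` along `X`, written in coordinates; `D k` is the partial derivative along the
`k`-th coordinate. -/
def lieBivector (D : ι → A → A) (P : ι → ι → A) (X : ι → A) (i j : ι) : A :=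
  ∑ k, (X k * D k (P i j) - P k j * D k (X i) - P i k * D k (X j))

/-- The Hamiltonian vector field `X_h = -[h, P]`, whose `i`-th component is
`{h, u_i} = ∑ j, (∂h/∂u_j) {u_j, u_i}`. -/
def hamiltonianField (D : ι → A → A) (P : ι → ι → A) (h : A) (i : ι) : A :=
  ∑ j, D j h * P j i

end Formulas

section Structure

variable {K g A : Type*} [CommRing K] [LieRing g] [LieAlgebra K g] [CommRing A] [Algebra K A]
  {l m : ℕ}

/-- The product Poisson structure
`∑ i, ∂/∂x_i ∧ ∂/∂y_i + (1/2) ∑ i j k, c_{ij}^k z_k ∂/∂z_i ∧ ∂/∂z_j`, where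
`⁅b i, b j⁆ = ∑ k, c_{ij}^k b k`, and `u` is the family of the coordinate functions. -/
def productPoisson (b : Module.Basis (Fin m) K g) (u : Coord l m → A) :
    Coord l m → Coord l m → A
  | .inl i, .inr (.inl j) => if i = j then 1 else 0
  | .inr (.inl i), .inl j => if i = j then -1 else 0
  | .inr (.inr i), .inr (.inr j) => ∑ k, algebraMap K A (b.repr ⁅b i, b j⁆ k) * u (.inr (.inr k))
  | _, _ => 0

end Structure

/-! ### Formal power series -/

section Formal

variable {K g : Type*} [Field K] [LieRing g] [LieAlgebra K g] {m : ℕ}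

/-- The formal partial derivatives. -/
abbrev formalD (K : Type*) [Field K] {ι : Type*} (k : ι) (f : MvPowerSeries ι K) :
    MvPowerSeries ι K :=
  MvPowerSeries.pderiv K k f

/-- The product Poisson structure, with coefficients seen as formal power series. -/
abbrev formalPoisson (l : ℕ) (b : Module.Basis (Fin m) K g) :
    Coord l m → Coord l m → MvPowerSeries (Coord l m) K :=
  productPoisson b (fun i => MvPowerSeries.X i)

/-- Formal Poisson vector fields: `[X, Π] = 0`. -/
def formalPoissonFields (l : ℕ) (b : Module.Basis (Fin m) K g) :
    Submodule K (Coord l m → MvPowerSeries (Coord l m) K) where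
  carrier := {X | ∀ i j, lieBivector (formalD K) (formalPoisson l b) X i j = 0}
  zero_mem' := by intro i j; simp [lieBivector]
  add_mem' := by
    intro X Y hX hY i j
    rw [← add_zero (0 : MvPowerSeries (Coord l m) K)]
    nth_rewrite 1 [← hX i j]
    rw [← hY i j]
    simp only [lieBivector, ← Finset.sum_add_distrib]
    refine Finset.sum_congr rfl fun k _ => ?_
    simp only [Pi.add_apply, map_add]
    ring
  smul_mem' := by
    intro c X hX i j
    rw [← smul_zero c, ← hX i j]
    simp only [lieBivector, Finset.smul_sum]
    refine Finset.sum_congr rfl fun k _ => ?_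
    simp only [formalD, Pi.smul_apply, Derivation.map_smul, smul_sub, smul_mul_assoc, mul_smul_comm]

/-- Formal Hamiltonian vector fields. -/
def formalHamiltonianFields (l : ℕ) (b : Module.Basis (Fin m) K g) :
    Submodule K (Coord l m → MvPowerSeries (Coord l m) K) where
  carrier := {X | ∃ h, X = hamiltonianField (formalD K) (formalPoisson l b) h}
  zero_mem' := ⟨0, by funext i; simp [hamiltonianField]⟩
  add_mem' := by
    rintro _ _ ⟨h, rfl⟩ ⟨h', rfl⟩
    refine ⟨h + h', ?_⟩
    funext i
    simp [hamiltonianField, add_mul, Finset.sum_add_distrib]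
  smul_mem' := by
    rintro c _ ⟨h, rfl⟩
    refine ⟨c • h, ?_⟩
    funext i
    simp [hamiltonianField, Finset.smul_sum]

/-- The first formal Poisson cohomology space: Poisson vector fields modulo Hamiltonian ones. -/
abbrev FormalH1 (l : ℕ) (b : Module.Basis (Fin m) K g) : Type _ :=
  formalPoissonFields l b ⧸ (formalHamiltonianFields l b).submoduleOf (formalPoissonFields l b)

end Formal

/-! ### Germs at the origin of analytic functions

A germ is represented by a function that is analytic at `0`; equations between germs hold in a
neighbourhood of `0`. -/

section Analytic

variable {K g : Type*} [RCLike K] [LieRing g] [LieAlgebra K g] {m : ℕ}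

/-- The partial derivatives of a function on `K^ι`. -/
def analyticD (K : Type*) [RCLike K] {ι : Type*} [Fintype ι] [DecidableEq ι] (k : ι)
    (f : (ι → K) → K) : (ι → K) → K :=
  fun p => fderiv K f p (Pi.single k 1)

/-- The product Poisson structure, with coefficients seen as functions. -/
abbrev analyticPoisson (l : ℕ) (b : Module.Basis (Fin m) K g) :
    Coord l m → Coord l m → (Coord l m → K) → K :=
  productPoisson b (fun i p => p i)

lemma analyticD_add {ι : Type*} [Fintype ι] [DecidableEq ι] {f f' : (ι → K) → K}
    (hf : AnalyticAt K f 0) (hf' : AnalyticAt K f' 0) :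
    ∀ᶠ p in 𝓝 0, ∀ k, analyticD K k (f + f') p = analyticD K k f p + analyticD K k f' p := by
  filter_upwards [hf.eventually_analyticAt, hf'.eventually_analyticAt] with p hp hp' k
  simp [analyticD, fderiv_add hp.differentiableAt hp'.differentiableAt]

lemma analyticD_smul {ι : Type*} [Fintype ι] [DecidableEq ι] (c : K) (f : (ι → K) → K)
    (k : ι) (p : ι → K) : analyticD K k (c • f) p = c * analyticD K k f p := by
  simp [analyticD, fderiv_const_smul_field]

/-- Analytic Poisson vector fields near the origin: `[X, Π] = 0` in a neighbourhood of `0`. -/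
def analyticPoissonFields (l : ℕ) (b : Module.Basis (Fin m) K g) :
    Submodule K (Coord l m → (Coord l m → K) → K) where
  carrier := {X | (∀ i, AnalyticAt K (X i) 0) ∧
    ∀ i j, lieBivector (analyticD K) (analyticPoisson l b) X i j =ᶠ[𝓝 0] 0}
  zero_mem' := by
    refine ⟨fun i => analyticAt_const, fun i j => Eventually.of_forall fun p => ?_⟩
    simp [lieBivector, analyticD]
  add_mem' := by
    rintro X Y ⟨hXa, hX⟩ ⟨hYa, hY⟩
    refine ⟨fun i => (hXa i).add (hYa i), fun i j => ?_⟩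
    filter_upwards [hX i j, hY i j, analyticD_add (hXa i) (hYa i), analyticD_add (hXa j) (hYa j)]
      with p h1 h2 h3 h4
    have h0 : (0 : K) = lieBivector (analyticD K) (analyticPoisson l b) X i j p
        + lieBivector (analyticD K) (analyticPoisson l b) Y i j p := by simp [h1, h2]
    rw [Pi.zero_apply, h0]
    simp only [lieBivector, Finset.sum_apply, ← Finset.sum_add_distrib]
    refine Finset.sum_congr rfl fun k _ => ?_
    simp only [Pi.sub_apply, Pi.mul_apply, Pi.add_apply, h3, h4]
    ring
  smul_mem' := by
    rintro c X ⟨hXa, hX⟩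
    refine ⟨fun i => by simpa using (hXa i).const_smul (c := c), fun i j => ?_⟩
    filter_upwards [hX i j] with p h1
    have h0 : (0 : K) = c * lieBivector (analyticD K) (analyticPoisson l b) X i j p := by
      simp [h1]
    rw [Pi.zero_apply, h0]
    simp only [lieBivector, Finset.sum_apply, Finset.mul_sum]
    refine Finset.sum_congr rfl fun k _ => ?_
    simp only [Pi.sub_apply, Pi.mul_apply, Pi.smul_apply, analyticD_smul, smul_eq_mul]
    ring

/-- Vector fields whose germ at the origin is the Hamiltonian field of an analytic germ. -/
def analyticHamiltonianFields (l : ℕ) (b : Module.Basis (Fin m) K g) :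
    Submodule K (Coord l m → (Coord l m → K) → K) where
  carrier := {X | ∃ h : (Coord l m → K) → K, AnalyticAt K h 0 ∧
    ∀ i, X i =ᶠ[𝓝 0] hamiltonianField (analyticD K) (analyticPoisson l b) h i}
  zero_mem' := by
    refine ⟨0, analyticAt_const, fun i => Eventually.of_forall fun p => ?_⟩
    simp [hamiltonianField, analyticD]
  add_mem' := by
    rintro X Y ⟨h, ha, hX⟩ ⟨h', ha', hY⟩
    refine ⟨h + h', ha.add ha', fun i => ?_⟩
    filter_upwards [hX i, hY i, analyticD_add ha ha'] with p h1 h2 h3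
    simp only [Pi.add_apply, h1, h2, hamiltonianField, Finset.sum_apply, Pi.mul_apply, h3,
      add_mul, Finset.sum_add_distrib]
  smul_mem' := by
    rintro c X ⟨h, ha, hX⟩
    refine ⟨c • h, ha.const_smul, fun i => ?_⟩
    filter_upwards [hX i] with p h1
    simp only [Pi.smul_apply, h1, hamiltonianField, Finset.sum_apply, Pi.mul_apply,
      analyticD_smul, smul_eq_mul, Finset.mul_sum, mul_assoc]

/-- The first analytic Poisson cohomology space at the origin: germs of analytic Poisson vector
fields modulo germs of Hamiltonian ones (fields with germ zero are killed, since the zero field is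
Hamiltonian). -/
abbrev AnalyticH1 (l : ℕ) (b : Module.Basis (Fin m) K g) : Type _ :=
  analyticPoissonFields l b ⧸
    (analyticHamiltonianFields l b).submoduleOf (analyticPoissonFields l b)

end Analytic

end LocalPoisson

end

/-! Split a Poisson field X along the symplectic and the Lie–Poisson directions. The xy-components
of [X, Π] = 0 say that the one-form dual to the symplectic part of X is closed in x, y, with z as
parameter. A Poincaré lemma in part of the variables (`exists_potential`) therefore gives h₀ such
that X - X_{h₀} has z-components only (`exists_symplectic_primitive`). For such a field the mixed
equations say that the components do not depend on x, y, and the zz-equations say that they form a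
1-cocycle of g with values in functions on the dual of g. The coadjoint action preserves degrees, so
each homogeneous part is a cocycle in a finite-dimensional module, and Whitehead's first lemma gives
a primitive (`exists_primitive_of_tangent`). This settles the formal case.

In the analytic case the primitives must grow at most geometrically with the degree n
(`exists_homogeneous_primitive`). Polynomials of degree n carry the Fischer product, for which
multiplication by a coordinate is adjoint to differentiation. In a basis of g whose adjoint matrices
are stable under conjugate transposition, the Casimir operator becomes self-adjoint and nonnegative,
and `one_le_gapConst_mul_eigenvalue` bounds its nonzero eigenvalues below independently of n. The
primitive orthogonal to the invariants is then bounded in Fischer norm (`exists_primitive_norm_le`),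
and the comparison with coefficient sums costs only a factor geometric in n.

Such a basis (`exists_basis_conjTranspose_ad`) comes from a Kempf–Ness argument: minimize the norm
of the structure constants over bases with a fixed discriminant of the Killing form. The minimum
exists because this set of structure constants is closed (`isClosed_orbit`), a consequence of the
rigidity of g (`eventually_exists_basis`), hence of the vanishing of H²(g, g). Criticality of the
minimum makes conjugate transposes of adjoint matrices derivations, and these are inner.

Finally `Represents` identifies analytic germs with power series of geometric growth, compatibly
with all the operations in the two formulas for fields, so that the formal result with its growth
estimate yields the analytic one. -/

namespace LocalPoisson

/-! ### Killing-dual families, the Casimir element, and H²(g, g) = 0 -/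

section DualPair

variable {K g ι : Type*} [Field K] [LieRing g] [LieAlgebra K g] [Fintype ι]

/-- Two families of vectors that are dual to each other with respect to the Killing form. -/
structure IsKillingDual (K : Type*) {g ι : Type*} [Field K] [LieRing g] [LieAlgebra K g]
    [Fintype ι] (e e' : ι → g) : Prop where
  left : ∀ x, ∑ i, killingForm K g (e' i) x • e i = x
  right : ∀ x, ∑ i, killingForm K g (e i) x • e' i = x

variable {e e' : ι → g}

/-- This is the invariance of the Casimir tensor `∑ e' i ⊗ e i`, tested on an arbitrary bilinear
map. Expanding each bracket in the dual family gives coefficients that agree up to sign by the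
invariance of the Killing form. All later computations with Casimir operators rest on it. -/
lemma IsKillingDual.sum_invariant (he : IsKillingDual K e e') {M : Type*} [AddCommGroup M]
    [Module K M] (β : g →ₗ[K] g →ₗ[K] M) (x : g) :
    ∑ i, β ⁅x, e' i⁆ (e i) = - ∑ i, β (e' i) ⁅x, e i⁆ := by
  have h1 : ∀ i, β ⁅x, e' i⁆ (e i) =
      ∑ j, killingForm K g (e j) ⁅x, e' i⁆ • β (e' j) (e i) := fun i => by
    conv_lhs => rw [← he.right ⁅x, e' i⁆]
    simp
  have h2 : ∀ i, β (e' i) ⁅x, e i⁆ =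
      ∑ j, killingForm K g (e' j) ⁅x, e i⁆ • β (e' i) (e j) := fun i => by
    conv_lhs => rw [← he.left ⁅x, e i⁆]
    simp
  simp only [h1, h2]
  rw [Finset.sum_comm, ← Finset.sum_neg_distrib]
  refine Finset.sum_congr rfl fun i _ => ?_
  rw [← Finset.sum_neg_distrib]
  refine Finset.sum_congr rfl fun j _ => ?_
  rw [← neg_smul]
  congr 1
  rw [← LieModule.traceForm_apply_lie_apply, LieModule.traceForm_comm, ← lie_skew, map_neg]

lemma IsKillingDual.trace_eq [FiniteDimensional K g] (he : IsKillingDual K e e')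
    (T : g →ₗ[K] g) : LinearMap.trace K g T = ∑ i, killingForm K g (e i) (T (e' i)) := by
  have : T = ∑ i, (killingForm K g (e i)).smulRight (T (e' i)) := by
    ext x
    conv_lhs => rw [← he.right x]
    simp
  conv_lhs => rw [this]
  simp [LinearMap.trace_smulRight]

/-- The Casimir element of the Killing form acts on the adjoint representation as the identity. -/
lemma IsKillingDual.casimir_ad [FiniteDimensional K g] [LieAlgebra.IsKilling K g]
    (he : IsKillingDual K e e') (x : g) : ∑ i, ⁅e' i, ⁅e i, x⁆⁆ = x := by
  have hnd := (LieAlgebra.IsKilling.killingForm_nondegenerate K g).1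
  rw [← sub_eq_zero]
  refine hnd _ fun y => ?_
  -- The Killing form is itself the trace of `ad x ∘ ad y`; written through the dual pair, this
  -- trace is the pairing of the left-hand side with `y`, after moving brackets by invariance.
  rw [map_sub, LinearMap.sub_apply, sub_eq_zero, killingForm_apply_apply K g x y, he.trace_eq]
  simp only [map_sum, LinearMap.sum_apply]
  refine Finset.sum_congr rfl fun i _ => ?_
  simp only [LinearMap.comp_apply, LieAlgebra.ad_apply]
  rw [LieModule.traceForm_comm, ← LieModule.traceForm_apply_lie_apply, LieModule.traceForm_comm,
    LieModule.traceForm_apply_lie_apply, ← lie_skew y]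

/-- Second cohomology with adjoint coefficients vanishes. -/
lemma IsKillingDual.exists_primitive_two_cocycle [FiniteDimensional K g] [LieAlgebra.IsKilling K g]
    (he : IsKillingDual K e e') (c : g →ₗ[K] g →ₗ[K] g) (hc : ∀ x y, c x y = - c y x)
    (hd : ∀ x y z, ⁅x, c y z⁆ - ⁅y, c x z⁆ + ⁅z, c x y⁆ - c ⁅x, y⁆ z + c ⁅x, z⁆ y - c ⁅y, z⁆ x = 0) :
    ∃ b : g →ₗ[K] g, ∀ x y, c x y = ⁅x, b y⁆ - ⁅y, b x⁆ - b ⁅x, y⁆ := by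
  -- Casimir homotopy: contract the first slot of `c` with the Casimir tensor. Its coboundary is the
  -- Casimir operator applied to the values of `c`, which is the identity by `casimir_ad`.
  refine ⟨∑ i, (LieAlgebra.ad K g (e' i)) ∘ₗ (c (e i)), fun x y => ?_⟩
  have key : ∀ x y, ∑ i, ⁅⁅x, e' i⁆, c (e i) y⁆ = - ∑ i, ⁅e' i, c ⁅x, e i⁆ y⁆ := fun x y => by
    have := he.sum_invariant (LinearMap.compl₂ (LieModule.toEnd K g g : g →ₗ[K] g →ₗ[K] g)
      (c.flip y)) x
    simpa using this
  have hs : ∀ x y, ∑ i, ⁅x, ⁅e' i, c (e i) y⁆⁆ = ∑ i, (⁅e' i, ⁅x, c (e i) y⁆⁆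
      - ⁅e' i, c ⁅x, e i⁆ y⁆) := fun x y => by
    rw [Finset.sum_sub_distrib, sub_eq_add_neg, ← key x y, ← Finset.sum_add_distrib]
    refine Finset.sum_congr rfl fun i _ => ?_
    rw [leibniz_lie x (e' i), add_comm]
  simp only [LinearMap.sum_apply, LinearMap.comp_apply, LieAlgebra.ad_apply, lie_sum, hs]
  rw [← he.casimir_ad (c x y), ← Finset.sum_sub_distrib, ← Finset.sum_sub_distrib]
  refine Finset.sum_congr rfl fun i _ => ?_
  rw [← lie_sub, ← lie_sub, ← lie_sub, ← lie_sub]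
  congr 1
  -- Under the outer bracket with `e' i`, what remains is the cocycle identity at `(e i, x, y)`.
  have h := hd (e i) x y
  rw [hc ⁅x, y⁆ (e i), ← lie_skew (e i) x, ← lie_skew (e i) y] at h
  simp only [map_neg, LinearMap.neg_apply] at h
  rw [← sub_eq_zero, ← h]
  abel

end DualPair

/-! ### A uniform spectral gap for the Casimir operator and Whitehead's first lemma with bounds -/

section Gap

variable {K g ι V : Type*} [RCLike K] [LieRing g] [LieAlgebra K g] [Fintype ι]
  [NormedAddCommGroup V] [InnerProductSpace K V]

/-- A bound for the inverse of the nonzero eigenvalues of the Casimir operator in unitary-type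
representations. -/
noncomputable def gapConst (K : Type*) {g ι : Type*} [RCLike K] [LieRing g] [LieAlgebra K g]
    [Fintype ι] (e e' : ι → g) : ℝ :=
  ∑ j, (∑ i, 2 * (∑ k, ‖killingForm K g (e' k) (e' i)‖) *
    (∑ k, ‖killingForm K g (e' k) ⁅e i, e j⁆‖)) ^ 2

variable {e e' : ι → g}

/-- On the `lam`-eigenspace the identity `∑ ‖ρ (e i) v‖² = lam ‖v‖²` makes each `ρ x` of size
`O(√lam)`. The eigenspace is stable under `ρ`, so a commutator has size `O(lam)`. By `casimir_ad`
each `e j` is a sum of brackets, hence `ρ (e j) v` is also `O(lam)`, and the same identity gives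
`lam ≤ const * lam²`. The constant involves only g and the dual pair, not the representation. -/
lemma one_le_gapConst_mul_eigenvalue [FiniteDimensional K g] [LieAlgebra.IsKilling K g]
    (he : IsKillingDual K e e') (ρ : g →ₗ[K] V →ₗ[K] V)
    (hρ : ∀ x y v, ρ ⁅x, y⁆ v = ρ x (ρ y v) - ρ y (ρ x v))
    (hadj : ∀ i v w, inner K (ρ (e i) v) w = inner K v (ρ (e' i) w))
    {lam : ℝ} (hlam : lam ≠ 0) {v : V} (hv : v ≠ 0)
    (hev : ∑ i, ρ (e' i) (ρ (e i) v) = (lam : K) • v) :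
    1 ≤ gapConst K e e' * lam := by
  have hcomm : ∀ x w, ∑ i, ρ (e' i) (ρ (e i) (ρ x w)) = ρ x (∑ i, ρ (e' i) (ρ (e i) w)) := by
    intro x w
    have hinv := he.sum_invariant (LinearMap.compl₂ (ρ : g →ₗ[K] V →ₗ[K] V) (ρ.flip w)) x
    simp only [LinearMap.compl₂_apply, LinearMap.flip_apply] at hinv
    rw [map_sum, ← sub_eq_zero, ← Finset.sum_sub_distrib]
    rw [← Finset.sum_neg_distrib, ← sub_eq_zero, ← Finset.sum_sub_distrib] at hinv
    rw [← neg_eq_zero, ← hinv, ← Finset.sum_neg_distrib]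
    refine Finset.sum_congr rfl fun i _ => ?_
    simp only [hρ, map_sub]
    abel
  have hsq : ∀ w, ∑ i, ρ (e' i) (ρ (e i) w) = (lam : K) • w →
      ∑ i, ‖ρ (e i) w‖ ^ 2 = lam * ‖w‖ ^ 2 := by
    intro w hw
    have h1 : (∑ i, inner K (ρ (e i) w) (ρ (e i) w)) = (lam : K) * inner K w w := by
      simp only [hadj]
      rw [← inner_sum, hw, inner_smul_right]
    simp only [inner_self_eq_norm_sq_to_K] at h1
    exact_mod_cast h1
  have hvpos : 0 < ‖v‖ ^ 2 := by positivity
  have hlam0 : 0 < lam := by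
    refine lt_of_le_of_ne ?_ hlam.symm
    have := hsq v hev
    by_contra hneg
    have h3 : lam * ‖v‖ ^ 2 < 0 := mul_neg_of_neg_of_pos (not_le.mp hneg) hvpos
    have h4 : 0 ≤ ∑ i, ‖ρ (e i) v‖ ^ 2 := Finset.sum_nonneg fun i _ => by positivity
    linarith
  set s := Real.sqrt lam with hs
  have hss : s * s = lam := Real.mul_self_sqrt hlam0.le
  have hs0 : 0 ≤ s := Real.sqrt_nonneg _
  have hE : ∀ i w, ∑ i, ρ (e' i) (ρ (e i) w) = (lam : K) • w → ‖ρ (e i) w‖ ≤ s * ‖w‖ := by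
    intro i w hw
    have h1 : ‖ρ (e i) w‖ ^ 2 ≤ (s * ‖w‖) ^ 2 := by
      rw [mul_pow, pow_two s, hss, ← hsq w hw]
      exact Finset.single_le_sum (f := fun i => ‖ρ (e i) w‖ ^ 2)
        (fun i _ => by positivity) (Finset.mem_univ i)
    exact le_of_sq_le_sq h1 (by positivity)
  -- The bound is stated for all eigenvectors `w`, because it is applied to `ρ x v` and `ρ y v` as
  -- well as to `v`.
  have hX : ∀ x w, ∑ i, ρ (e' i) (ρ (e i) w) = (lam : K) • w →
      ‖ρ x w‖ ≤ (∑ k, ‖killingForm K g (e' k) x‖) * (s * ‖w‖) := by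
    intro x w hw
    conv_lhs => rw [← he.left x]
    simp only [map_sum, map_smul, LinearMap.sum_apply, LinearMap.smul_apply, Finset.sum_mul]
    refine (norm_sum_le _ _).trans (Finset.sum_le_sum fun k _ => ?_)
    rw [norm_smul]
    exact mul_le_mul_of_nonneg_left (hE k w hw) (norm_nonneg _)
  have hpres : ∀ x w, ∑ i, ρ (e' i) (ρ (e i) w) = (lam : K) • w →
      ∑ i, ρ (e' i) (ρ (e i) (ρ x w)) = (lam : K) • ρ x w := by
    intro x w hw
    rw [hcomm, hw, map_smul]
  have hbr : ∀ x y, ‖ρ ⁅x, y⁆ v‖ ≤ 2 * (∑ k, ‖killingForm K g (e' k) x‖) *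
      (∑ k, ‖killingForm K g (e' k) y‖) * (lam * ‖v‖) := by
    intro x y
    rw [hρ]
    refine (norm_sub_le _ _).trans ?_
    have h1 := hX x _ (hpres y v hev)
    have h2 := hX y _ (hpres x v hev)
    have h3 := hX x v hev
    have h4 := hX y v hev
    set a := ∑ k, ‖killingForm K g (e' k) x‖
    set b := ∑ k, ‖killingForm K g (e' k) y‖
    have ha : 0 ≤ a := Finset.sum_nonneg fun i _ => norm_nonneg _
    have hb : 0 ≤ b := Finset.sum_nonneg fun i _ => norm_nonneg _
    have h5 : ‖ρ x (ρ y v)‖ ≤ a * (s * (b * (s * ‖v‖))) := h1.trans (by gcongr)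
    have h6 : ‖ρ y (ρ x v)‖ ≤ b * (s * (a * (s * ‖v‖))) := h2.trans (by gcongr)
    rw [← hss]
    nlinarith
  set A : ι → ℝ := fun j => ∑ i, 2 * (∑ k, ‖killingForm K g (e' k) (e' i)‖) *
    (∑ k, ‖killingForm K g (e' k) ⁅e i, e j⁆‖) with hA
  have hAj : ∀ j, ‖ρ (e j) v‖ ≤ A j * (lam * ‖v‖) := by
    intro j
    conv_lhs => rw [← he.casimir_ad (e j)]
    simp only [map_sum, LinearMap.sum_apply, hA, Finset.sum_mul]
    exact (norm_sum_le _ _).trans (Finset.sum_le_sum fun i _ => hbr _ _)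
  have hfin : lam * ‖v‖ ^ 2 ≤ gapConst K e e' * (lam * ‖v‖) ^ 2 := by
    rw [← hsq v hev, gapConst, Finset.sum_mul]
    refine Finset.sum_le_sum fun j _ => ?_
    rw [← mul_pow]
    exact pow_le_pow_left₀ (norm_nonneg _) (hAj j) 2
  have : 0 < lam * ‖v‖ ^ 2 := by positivity
  by_contra hcon
  push Not at hcon
  nlinarith

lemma gapConst_nonneg : 0 ≤ gapConst K e e' :=
  Finset.sum_nonneg fun _ _ => by positivity

/-- First cohomology of a Killing Lie algebra with coefficients in a representation in which the
two members of a dual pair act as adjoint operators: cocycles have primitives of controlled norm. -/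
theorem exists_primitive_norm_le [FiniteDimensional K g] [LieAlgebra.IsKilling K g]
    [FiniteDimensional K V]
    (he : IsKillingDual K e e') (ρ : g →ₗ[K] V →ₗ[K] V)
    (hρ : ∀ x y v, ρ ⁅x, y⁆ v = ρ x (ρ y v) - ρ y (ρ x v))
    (hadj : ∀ i v w, inner K (ρ (e i) v) w = inner K v (ρ (e' i) w))
    (f : g →ₗ[K] V) (hf : ∀ x y, f ⁅x, y⁆ = ρ x (f y) - ρ y (f x)) :
    ∃ h, (∀ x, ρ x h = f x) ∧ ‖h‖ ^ 2 ≤ gapConst K e e' * ∑ i, ‖f (e i)‖ ^ 2 := by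
  have hadj' : ∀ i v w, inner K (ρ (e' i) v) w = inner K v (ρ (e i) w) := by
    intro i v w
    rw [← inner_conj_symm, ← hadj, inner_conj_symm]
  set Ω : V →ₗ[K] V := ∑ i, ρ (e' i) ∘ₗ ρ (e i) with hΩ
  have hΩa : ∀ v, Ω v = ∑ i, ρ (e' i) (ρ (e i) v) := fun v => by simp [hΩ]
  have hsymm : Ω.IsSymmetric := by
    intro v w
    simp only [hΩa, sum_inner, inner_sum, hadj', hadj]
  -- Since `⟨v, Ω v⟩ = ∑ ‖ρ (e i) v‖²`, the kernel of the Casimir operator consists of the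
  -- invariants.
  have hker : ∀ v, Ω v = 0 → ∀ x, ρ x v = 0 := by
    intro v hv x
    have h0 : ∑ i, ‖ρ (e i) v‖ ^ 2 = 0 := by
      have h1 : ∑ i, inner K (ρ (e i) v) (ρ (e i) v) = (0 : K) := by
        simp only [hadj]
        rw [← inner_sum, ← hΩa, hv, inner_zero_right]
      simp only [inner_self_eq_norm_sq_to_K] at h1
      exact_mod_cast h1
    have h1 : ∀ i, ρ (e i) v = 0 := by
      intro i
      have := (Finset.sum_eq_zero_iff_of_nonneg (fun i _ => by positivity)).mp h0 i
        (Finset.mem_univ i)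
      simpa using this
    rw [← he.left x]
    simp [h1]
  -- the Casimir operator inverts the differential
  set u : V := ∑ i, ρ (e' i) (f (e i)) with hu
  have hcomm : ∀ x w, Ω (ρ x w) = ρ x (Ω w) := by
    intro x w
    have hinv := he.sum_invariant (LinearMap.compl₂ (ρ : g →ₗ[K] V →ₗ[K] V) (ρ.flip w)) x
    simp only [LinearMap.compl₂_apply, LinearMap.flip_apply] at hinv
    rw [hΩa, hΩa, map_sum, ← sub_eq_zero, ← Finset.sum_sub_distrib]
    rw [← Finset.sum_neg_distrib, ← sub_eq_zero, ← Finset.sum_sub_distrib] at hinv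
    rw [← neg_eq_zero, ← hinv, ← Finset.sum_neg_distrib]
    refine Finset.sum_congr rfl fun i _ => ?_
    simp only [hρ, map_sub]
    abel
  have hxu : ∀ x, ρ x u = Ω (f x) := by
    intro x
    have hinv := he.sum_invariant (LinearMap.compl₂ (ρ : g →ₗ[K] V →ₗ[K] V) f) x
    simp only [LinearMap.compl₂_apply] at hinv
    rw [hΩa, hu, map_sum, ← sub_eq_zero, ← Finset.sum_sub_distrib]
    rw [← Finset.sum_neg_distrib, ← sub_eq_zero, ← Finset.sum_sub_distrib] at hinv
    rw [← hinv]
    refine Finset.sum_congr rfl fun i _ => ?_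
    simp only [hρ, hf, map_sub]
    abel
  have hrange : (LinearMap.ker Ω)ᗮ = LinearMap.range Ω := by
    rw [← hsymm.orthogonal_range, Submodule.orthogonal_orthogonal]
  -- `u` is orthogonal to the invariants: moving `ρ (e' i)` across the inner product makes it `ρ (e
  -- i)` acting on an invariant vector.
  have hu' : u ∈ LinearMap.range Ω := by
    rw [← hrange, Submodule.mem_orthogonal]
    intro k hk
    rw [hu, inner_sum]
    refine Finset.sum_eq_zero fun i _ => ?_
    rw [← hadj, hker k (LinearMap.mem_ker.mp hk), inner_zero_left]
  obtain ⟨h0, hh0⟩ := hu'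
  -- Only the preimage orthogonal to the invariants can be bounded, so the invariant component is
  -- discarded.
  obtain ⟨k, hk, h, hh, hkh⟩ := (LinearMap.ker Ω).exists_add_mem_mem_orthogonal h0
  have hΩh : Ω h = u := by
    rw [← hh0, hkh, map_add, LinearMap.mem_ker.mp hk, zero_add]
  have hd : ∀ x, Ω (f x - ρ x h) = 0 := by
    intro x
    rw [map_sub, hcomm, hΩh, hxu, sub_self]
  -- The difference of `f` and the coboundary of `h` takes invariant values, so the cocycle identity
  -- kills it on brackets; by `casimir_ad` every element of g is a sum of brackets.
  have hsol : ∀ x, ρ x h = f x := by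
    have hbr : ∀ x y : g, f ⁅x, y⁆ - ρ ⁅x, y⁆ h = 0 := by
      intro x y
      have h1 := hker _ (hd x) y
      have h2 := hker _ (hd y) x
      rw [map_sub] at h1 h2
      rw [hf, hρ, sub_eq_zero.mp h1, sub_eq_zero.mp h2, sub_self]
    intro x
    rw [← he.casimir_ad x]
    simp only [map_sum, LinearMap.sum_apply]
    exact Finset.sum_congr rfl fun i _ => (sub_eq_zero.mp (hbr _ _)).symm
  refine ⟨h, hsol, ?_⟩
  have hn : Module.finrank K V = Module.finrank K V := rfl
  set B := hsymm.eigenvectorBasis hn with hB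
  have hcoef : ∀ k, ‖inner K (B k) h‖ ^ 2 ≤
      gapConst K e e' * (hsymm.eigenvalues hn k * ‖inner K (B k) h‖ ^ 2) := by
    intro k
    have hev : Ω (B k) = (hsymm.eigenvalues hn k : K) • B k :=
      hsymm.apply_eigenvectorBasis hn k
    by_cases h0 : hsymm.eigenvalues hn k = 0
    · have : inner K (B k) h = 0 := by
        refine (Submodule.mem_orthogonal _ _).mp hh _ ?_
        rw [LinearMap.mem_ker, hev, h0]
        simp
      simp [this]
    · have h1 := one_le_gapConst_mul_eigenvalue he ρ hρ hadj h0 (B.orthonormal.ne_zero k)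
        (by rw [← hΩa]; exact hev)
      rw [← mul_assoc]
      exact le_mul_of_one_le_left (by positivity) h1
  have h1 : ‖h‖ ^ 2 = ∑ k, ‖inner K (B k) h‖ ^ 2 := (B.sum_sq_norm_inner_right h).symm
  -- Both sides equal `⟨h, Ω h⟩`, the right one in an eigenbasis; the gap then bounds `‖h‖²`
  -- coordinate by coordinate.
  have h2 : ∑ i, ‖f (e i)‖ ^ 2 = ∑ k, hsymm.eigenvalues hn k * ‖inner K (B k) h‖ ^ 2 := by
    have h3 : ∑ i, inner K (f (e i)) (f (e i)) = inner K h (Ω h) := by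
      rw [hΩa, inner_sum]
      simp only [← hsol, hadj]
    have h4 : inner K h (Ω h) =
        ((∑ k, hsymm.eigenvalues hn k * ‖inner K (B k) h‖ ^ 2 : ℝ) : K) := by
      rw [← B.sum_inner_mul_inner]
      push_cast
      refine Finset.sum_congr rfl fun k _ => ?_
      have h5 : inner K (B k) (Ω h) = (hsymm.eigenvalues hn k : K) * inner K (B k) h := by
        rw [← hsymm, hsymm.apply_eigenvectorBasis hn k, inner_smul_left, RCLike.conj_ofReal]
      rw [h5, ← inner_conj_symm h (B k), mul_left_comm, RCLike.conj_mul]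
    rw [h4] at h3
    simp only [inner_self_eq_norm_sq_to_K] at h3
    exact_mod_cast h3
  rw [h1, h2, Finset.mul_sum]
  exact Finset.sum_le_sum fun k _ => hcoef k

end Gap

end LocalPoisson

universe u

namespace LocalPoisson

/-! ### Structure constants, change of basis and its linearization -/

section StructureConstants

variable {K g : Type*} [Field K] [LieRing g] [LieAlgebra K g] {m : ℕ}

/-- Families of structure constants, as families of matrices. -/
abbrev SC (K : Type*) (m : ℕ) : Type _ := Fin m → Matrix (Fin m) (Fin m) K

/-- The structure constants in a basis, as the family of matrices of the adjoint action. -/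
noncomputable def sc (b : Module.Basis (Fin m) K g) : SC K m :=
  fun i => LinearMap.toMatrix b b (LieAlgebra.ad K g (b i))

lemma sc_apply (b : Module.Basis (Fin m) K g) (i j k : Fin m) :
    sc b i k j = b.repr ⁅b i, b j⁆ k := by
  simp [sc, LinearMap.toMatrix_apply]

lemma toMatrix_ad (b : Module.Basis (Fin m) K g) (x : g) :
    LinearMap.toMatrix b b (LieAlgebra.ad K g x) = ∑ p, b.repr x p • sc b p := by
  conv_lhs => rw [← b.sum_repr x]
  simp only [sc]
  rw [map_sum, map_sum]
  simp only [map_smul]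

/-- The equations satisfied by the structure constants of a Lie algebra. -/
def IsLieSC (w : SC K m) : Prop :=
  (∀ i j k, w i k j = - w j k i) ∧ ∀ i j, w i * w j - w j * w i = ∑ p, w i p j • w p

lemma isLieSC_sc (b : Module.Basis (Fin m) K g) : IsLieSC (sc b) := by
  refine ⟨fun i j k => ?_, fun i j => ?_⟩
  · rw [sc_apply, sc_apply, ← lie_skew, map_neg, Finsupp.neg_apply]
  · simp only [sc_apply]
    have : LieAlgebra.ad K g ⁅b i, b j⁆ = LieAlgebra.ad K g (b i) ∘ₗ LieAlgebra.ad K g (b j)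
        - LieAlgebra.ad K g (b j) ∘ₗ LieAlgebra.ad K g (b i) := by
      ext x
      simp
    rw [← toMatrix_ad, this, map_sub, LinearMap.toMatrix_comp b b b, LinearMap.toMatrix_comp b b b]
    simp only [sc]

/-- Solutions of the structure equations come from a Lie algebra. -/
lemma IsLieSC.exists_basis {K : Type u} [Field K] {m : ℕ} [CharZero K] {w : SC K m} (hw : IsLieSC w) :
    ∃ (L : Type u) (_ : LieRing L) (_ : LieAlgebra K L) (b : Module.Basis (Fin m) K L),
      sc b = w := by
  let br : (Fin m → K) →ₗ[K] (Fin m → K) →ₗ[K] (Fin m → K) :=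
    (Pi.basisFun K (Fin m)).constr K (fun i => Matrix.toLin' (w i))
  have hbr : ∀ x, br x = Matrix.toLin' (∑ p, x p • w p) := by
    intro x
    simp [br, Module.Basis.constr_apply_fintype]
  have hsk : ∀ x y, br x y = - br y x := by
    intro x y
    ext k
    simp only [hbr, Matrix.toLin'_apply, Matrix.mulVec, dotProduct, Matrix.sum_apply,
      Matrix.smul_apply, smul_eq_mul, Pi.neg_apply, Finset.sum_mul]
    rw [Finset.sum_comm, ← Finset.sum_neg_distrib]
    refine Finset.sum_congr rfl fun i _ => ?_
    rw [← Finset.sum_neg_distrib]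
    refine Finset.sum_congr rfl fun j _ => ?_
    rw [hw.1 j i k]
    ring
  have hself : ∀ x, br x x = 0 := fun x => by
    have := hsk x x
    exact self_eq_neg.mp this
  have hjac : ∀ x y, br (br x y) = br x ∘ₗ br y - br y ∘ₗ br x := by
    intro x y
    simp only [hbr, ← Matrix.toLin'_mul, ← map_sub]
    congr 1
    have h1 : ∀ x y : Fin m → K, (∑ p, x p • w p) * (∑ p, y p • w p)
        = ∑ i, ∑ j, (x i * y j) • (w i * w j) := by
      intro x y
      simp only [Finset.sum_mul, Finset.mul_sum, smul_mul_assoc, mul_smul_comm]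
      rw [Finset.sum_comm]
      refine Finset.sum_congr rfl fun i _ => ?_
      rw [Finset.smul_sum]
      refine Finset.sum_congr rfl fun j _ => ?_
      rw [smul_smul, mul_comm]
    rw [h1, h1, Finset.sum_comm (f := fun i j => (y i * x j) • (w i * w j)),
      ← Finset.sum_sub_distrib]
    have h2 : ∀ p, Matrix.toLin' (∑ p, x p • w p) y p = ∑ i, ∑ j, (x i * y j) * w i p j := by
      intro p
      simp only [Matrix.toLin'_apply, Matrix.mulVec, dotProduct, Matrix.sum_apply,
        Matrix.smul_apply, smul_eq_mul, Finset.sum_mul]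
      rw [Finset.sum_comm]
      refine Finset.sum_congr rfl fun i _ => Finset.sum_congr rfl fun j _ => ?_
      ring
    simp only [h2, Finset.sum_smul]
    rw [Finset.sum_comm]
    refine Finset.sum_congr rfl fun i _ => ?_
    rw [Finset.sum_comm, ← Finset.sum_sub_distrib]
    refine Finset.sum_congr rfl fun j _ => ?_
    rw [mul_comm (y j), ← smul_sub, hw.2, Finset.smul_sum]
    simp only [smul_smul]
  let _ : LieRing (Fin m → K) :=
    { bracket := fun x y => br x y
      add_lie := fun x y z => by simp
      lie_add := fun x y z => by simp
      lie_self := fun x => hself x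
      leibniz_lie := fun x y z => by
        have := LinearMap.congr_fun (hjac x y) z
        simp only [LinearMap.sub_apply, LinearMap.comp_apply] at this
        change br x (br y z) = br (br x y) z + br y (br x z)
        rw [this]
        abel }
  let _ : LieAlgebra K (Fin m → K) :=
    { lie_smul := fun t x y => map_smul (br x) t y }
  refine ⟨Fin m → K, inferInstance, inferInstance, Pi.basisFun K (Fin m), ?_⟩
  funext i
  ext k j
  rw [sc_apply]
  change (Pi.basisFun K (Fin m)).repr (br _ _) k = _
  rw [hbr]
  simp [Pi.basisFun_apply]

/-- The basis obtained from `b` by an invertible matrix. -/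
lemma exists_basis_of_det_ne_zero (b : Module.Basis (Fin m) K g) {A : Matrix (Fin m) (Fin m) K}
    (hA : A.det ≠ 0) : ∃ b₁ : Module.Basis (Fin m) K g, (∀ i, b₁ i = ∑ p, A p i • b p) ∧
      ∀ i, A * sc b₁ i = ∑ p, A p i • (sc b p * A) := by
  have hu : IsUnit A.det := isUnit_iff_ne_zero.mpr hA
  let e : g ≃ₗ[K] g := LinearEquiv.ofIsUnitDet (f := Matrix.toLin b b A) (v := b) (v' := b)
    (by rw [LinearMap.toMatrix_toLin]; exact hu)
  have hb : ∀ i, (b.map e) i = ∑ p, A p i • b p := by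
    intro i
    simp [e, LinearEquiv.ofIsUnitDet, Matrix.toLin_self]
  refine ⟨b.map e, hb, fun i => ?_⟩
  have hAe : A = b.toMatrix (b.map e) := by
    ext p j
    rw [Module.Basis.toMatrix_apply, hb]
    simp [Finsupp.single_apply]
  have h1 : b.toMatrix (b.map e) * sc (b.map e) i =
      LinearMap.toMatrix b b (LieAlgebra.ad K g ((b.map e) i)) * b.toMatrix (b.map e) := by
    rw [sc, basis_toMatrix_mul_linearMap_toMatrix, linearMap_toMatrix_mul_basis_toMatrix]
  rw [← hAe] at h1
  rw [h1, toMatrix_ad, Finset.sum_mul]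
  refine Finset.sum_congr rfl fun p _ => ?_
  rw [smul_mul_assoc, hb]
  simp [Finsupp.single_apply]

/-- Realize `w` by a Lie algebra with basis; `v` is then its family of structure constants in the
basis changed by `A⁻¹`. -/
lemma isLieSC_of_transform [CharZero K] {v w A : _} (hw : IsLieSC (K := K) (m := m) w)
    (hA : Matrix.det A ≠ 0) (hv : ∀ i, ∑ p, A p i • (v p * A) = A * w i) :
    IsLieSC (K := K) (m := m) v := by
  obtain ⟨L, _, _, b, rfl⟩ := hw.exists_basis
  have hu : IsUnit A.det := isUnit_iff_ne_zero.mpr hA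
  have hAB : A * A⁻¹ = 1 := Matrix.mul_nonsing_inv A hu
  obtain ⟨b₁, -, hb₁⟩ := exists_basis_of_det_ne_zero b (A := A⁻¹)
    (Matrix.isUnit_nonsing_inv_det A hu).ne_zero
  suffices sc b₁ = v from this ▸ isLieSC_sc b₁
  funext i
  calc sc b₁ i = A * (A⁻¹ * sc b₁ i) := by rw [← mul_assoc, hAB, one_mul]
    _ = ∑ p, A⁻¹ p i • (∑ q, A q p • v q) := by
      rw [hb₁, Finset.mul_sum]
      refine Finset.sum_congr rfl fun p _ => ?_
      rw [mul_smul_comm, ← mul_assoc, ← hv, Finset.sum_mul]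
      congr 1
      refine Finset.sum_congr rfl fun q _ => ?_
      rw [smul_mul_assoc, mul_assoc, hAB, mul_one]
    _ = ∑ q, (A * A⁻¹) q i • v q := by
      simp only [Finset.smul_sum, smul_smul, Matrix.mul_apply, Finset.sum_smul]
      rw [Finset.sum_comm]
      refine Finset.sum_congr rfl fun q _ => Finset.sum_congr rfl fun p _ => ?_
      rw [mul_comm]
    _ = v i := by
      rw [hAB]
      simp [Matrix.one_apply]

/-- The derivative at the identity of the change of basis. -/
def infChange (S : Matrix (Fin m) (Fin m) K) (w : SC K m) :
    SC K m :=
  fun i => ∑ p, S p i • w p + w i * S - S * w i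

/-- A solution of the linearized structure equations is a 2-cocycle with adjoint coefficients, and
`infChange S` is the coboundary of the endomorphism with matrix `S`. So this is H²(g, g) = 0: every
infinitesimal deformation is tangent to the orbit under changes of basis. -/
lemma exists_infChange_eq [LieAlgebra.IsKilling K g]
    {ι : Type*} [Fintype ι] {e e' : ι → g} (he : IsKillingDual K e e')
    (b : Module.Basis (Fin m) K g) {u : SC K m}
    (ha : ∀ i j k, u i k j = - u j k i)
    (hj : ∀ i j, u i * sc b j + sc b i * u j - u j * sc b i - sc b j * u i
      - ∑ p, (u i p j • sc b p + sc b i p j • u p) = 0) :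
    ∃ S, infChange S (sc b) = u := by
  have : FiniteDimensional K g := b.finiteDimensional_of_finite
  let c : g →ₗ[K] g →ₗ[K] g := b.constr K (fun i => Matrix.toLin b b (u i))
  have hcb : ∀ i, c (b i) = Matrix.toLin b b (u i) := fun i => by simp [c]
  have hcm : ∀ x, LinearMap.toMatrix b b (c x) = ∑ p, b.repr x p • u p := by
    intro x
    conv_lhs => rw [← b.sum_repr x]
    simp only [map_sum, map_smul, hcb, LinearMap.toMatrix_toLin]
  have hcc : ∀ i j, c (b i) (b j) = ∑ k, u i k j • b k := by
    intro i j
    rw [hcb, Matrix.toLin_self]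
  have hflip : c = - c.flip := by
    refine b.ext fun i => b.ext fun j => ?_
    simp only [LinearMap.neg_apply, LinearMap.flip_apply, hcc, ← Finset.sum_neg_distrib]
    refine Finset.sum_congr rfl fun k _ => ?_
    rw [ha i j k, neg_smul]
  have hsk : ∀ x y, c x y = - c y x := fun x y => by
    conv_lhs => rw [hflip]
    rfl
  -- The cocycle identity with its third argument abstracted, as an equality of endomorphisms; it is
  -- then extended from basis vectors linearly, one slot at a time.
  have hF0 : ∀ i j, LieAlgebra.ad K g (b i) ∘ₗ c (b j) - LieAlgebra.ad K g (b j) ∘ₗ c (b i)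
      - LieAlgebra.ad K g (c (b i) (b j)) - c ⁅b i, b j⁆ - c (b j) ∘ₗ LieAlgebra.ad K g (b i)
      + c (b i) ∘ₗ LieAlgebra.ad K g (b j) = 0 := by
    intro i j
    apply (LinearMap.toMatrix b b).injective
    simp only [map_add, map_sub, map_zero, LinearMap.toMatrix_comp b b b, toMatrix_ad, hcm,
      ← sc_apply]
    have h1 : ∀ i, ∑ p, b.repr (b i) p • sc b p = sc b i := fun i => by
      simp [Finsupp.single_apply]
    have h2 : ∀ i, ∑ p, b.repr (b i) p • u p = u i := fun i => by
      simp [Finsupp.single_apply]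
    have h3 : ∀ p, b.repr (c (b i) (b j)) p = u i p j := fun p => by
      rw [hcc]
      simp [Finsupp.single_apply]
    simp only [h1, h2, h3]
    rw [← hj i j, Finset.sum_add_distrib]
    abel
  have hF1 : ∀ i y, LieAlgebra.ad K g (b i) ∘ₗ c y - LieAlgebra.ad K g y ∘ₗ c (b i)
      - LieAlgebra.ad K g (c (b i) y) - c ⁅b i, y⁆ - c y ∘ₗ LieAlgebra.ad K g (b i)
      + c (b i) ∘ₗ LieAlgebra.ad K g y = 0 := by
    intro i y
    induction b.mem_span y using Submodule.span_induction with
    | mem y hy => obtain ⟨j, rfl⟩ := hy; exact hF0 i j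
    | zero => simp
    | add y y' _ _ h1 h2 =>
      simp only [map_add, lie_add, LinearMap.comp_add, LinearMap.add_comp]
      linear_combination (norm := module) h1 + h2
    | smul t y _ h1 =>
      simp only [map_smul, lie_smul, LinearMap.comp_smul, LinearMap.smul_comp]
      linear_combination (norm := module) t • h1
  have hF2 : ∀ x y, LieAlgebra.ad K g x ∘ₗ c y - LieAlgebra.ad K g y ∘ₗ c x
      - LieAlgebra.ad K g (c x y) - c ⁅x, y⁆ - c y ∘ₗ LieAlgebra.ad K g x
      + c x ∘ₗ LieAlgebra.ad K g y = 0 := by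
    intro x y
    induction b.mem_span x using Submodule.span_induction with
    | mem x hx => obtain ⟨j, rfl⟩ := hx; exact hF1 j y
    | zero => simp
    | add x x' _ _ h1 h2 =>
      simp only [map_add, add_lie, LinearMap.comp_add, LinearMap.add_comp, LinearMap.add_apply]
      linear_combination (norm := module) h1 + h2
    | smul t x _ h1 =>
      simp only [map_smul, smul_lie, LinearMap.comp_smul, LinearMap.smul_comp,
        LinearMap.smul_apply]
      linear_combination (norm := module) t • h1
  obtain ⟨β, hβ⟩ := he.exists_primitive_two_cocycle c hsk (fun x y z => by
    have h := LinearMap.congr_fun (hF2 x y) z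
    simp only [LinearMap.sub_apply, LinearMap.add_apply, LinearMap.comp_apply,
      LieAlgebra.ad_apply, LinearMap.zero_apply] at h
    rw [hsk ⁅x, z⁆ y, hsk ⁅y, z⁆ x, ← lie_skew z]
    linear_combination (norm := module) h)
  refine ⟨LinearMap.toMatrix b b β, ?_⟩
  funext i
  have h1 : c (b i) = LieAlgebra.ad K g (β (b i)) + LieAlgebra.ad K g (b i) ∘ₗ β
      - β ∘ₗ LieAlgebra.ad K g (b i) := by
    ext y
    simp only [LinearMap.sub_apply, LinearMap.add_apply, LinearMap.comp_apply,
      LieAlgebra.ad_apply]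
    rw [hβ, ← lie_skew y]
    abel
  have h2 := congrArg (LinearMap.toMatrix b b) h1
  rw [hcb, LinearMap.toMatrix_toLin] at h2
  rw [h2]
  simp only [infChange, map_add, map_sub, LinearMap.toMatrix_comp b b b, toMatrix_ad,
    LinearMap.toMatrix_apply]
  simp [Finsupp.single_apply]

end StructureConstants

/-! ### Rigidity: nearby Lie structures are isomorphic -/

section Rigidity

open scoped Matrix.Norms.Operator

variable {K g : Type*} [RCLike K] [LieRing g] [LieAlgebra K g] {m : ℕ}

/-- The defect of the structure equations. -/
def lieDefect (w : SC K m) :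
    (Fin m → Fin m → Fin m → K) × (Fin m → SC K m) :=
  (fun i j k => w i k j + w j k i, fun i j => w i * w j - w j * w i - ∑ p, w i p j • w p)

lemma isLieSC_iff (w : SC K m) : IsLieSC w ↔ lieDefect w = 0 := by
  simp only [IsLieSC, lieDefect, Prod.mk_eq_zero, funext_iff, Pi.zero_apply, sub_eq_zero,
    eq_neg_iff_add_eq_zero]

/-- The linearization of the structure equations at `w`. -/
def infDefect (w : SC K m) :
    (SC K m) →ₗ[K]
      (Fin m → Fin m → Fin m → K) × (Fin m → SC K m) where
  toFun u := (fun i j k => u i k j + u j k i, fun i j =>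
    u i * w j + w i * u j - u j * w i - w j * u i - ∑ p, (u i p j • w p + w i p j • u p))
  map_add' u v := by
    ext1
    · funext i j k
      simp only [Pi.add_apply, Matrix.add_apply, Prod.mk_add_mk]
      ring
    · funext i j
      simp only [Pi.add_apply, Matrix.add_apply, Prod.mk_add_mk, add_mul, mul_add,
        Finset.sum_add_distrib, add_smul, smul_add]
      abel
  map_smul' t u := by
    ext1
    · funext i j k
      simp only [Pi.smul_apply, Matrix.smul_apply, Prod.smul_mk, smul_add, RingHom.id_apply]
    · funext i j
      simp only [Pi.smul_apply, Matrix.smul_apply, Prod.smul_mk, smul_sub, smul_add, smul_eq_mul,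
        smul_mul_assoc, mul_smul_comm, Finset.smul_sum, RingHom.id_apply, mul_smul]
      congr 1
      exact Finset.sum_congr rfl fun p _ => by rw [smul_comm (w i p j) t]

lemma hasFDerivAt_lieDefect (w : SC K m) :
    HasFDerivAt lieDefect (LinearMap.toContinuousLinearMap (infDefect w)) w := by
  have hp : ∀ i, HasFDerivAt (fun v : SC K m => v i)
      (ContinuousLinearMap.proj (R := K) (φ := fun _ => Matrix (Fin m) (Fin m) K) i) w :=
    fun i => (ContinuousLinearMap.proj (R := K) (φ := fun _ =>
      Matrix (Fin m) (Fin m) K) i).hasFDerivAt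
  have he : ∀ i j k, HasFDerivAt (fun v : SC K m => v i j k)
      ((LinearMap.toContinuousLinearMap (Matrix.entryLinearMap K K j k)).comp
        (ContinuousLinearMap.proj (R := K) (φ := fun _ => Matrix (Fin m) (Fin m) K) i)) w :=
    fun i j k => (LinearMap.toContinuousLinearMap
      (Matrix.entryLinearMap K K j k)).hasFDerivAt.comp w (hp i)
  refine HasFDerivAt.congr_fderiv (HasFDerivAt.prodMk
    (hasFDerivAt_pi.mpr fun i => hasFDerivAt_pi.mpr fun j => hasFDerivAt_pi.mpr fun k =>
      (he i k j).add (he j k i))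
    (hasFDerivAt_pi.mpr fun i => hasFDerivAt_pi.mpr fun j =>
      (((hp i).mul' (hp j)).sub ((hp j).mul' (hp i))).sub
        (HasFDerivAt.fun_sum fun p _ => (he i p j).smul (hp p)))) ?_
  ext1 u
  ext1
  · rfl
  · funext i j
    simp only [ContinuousLinearMap.prod_apply, ContinuousLinearMap.pi_apply,
      sub_apply, add_apply, sum_apply]
    change (w i * u j + u i * w j) - (w j * u i + u j * w i)
      - ∑ x, (w i x j • u x + u i x j • w x) = u i * w j + w i * u j - u j * w i - w j * u i
        - ∑ p, (u i p j • w p + w i p j • u p)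
    rw [Finset.sum_congr rfl fun p _ => add_comm (w i p j • u p) (u i p j • w p)]
    abel

/-- Take a complement `C` of the kernel of the linearized equations. On the slice `sc b + C` the
defect has injective derivative, so `sc b` is an isolated solution there. By H²(g, g) = 0 the
directions of the orbit fill the kernel, so every `w` near `sc b` is a change of basis, by a matrix
near 1, of a point of the slice. If `w` satisfies the structure equations, so does that point, which
is then `sc b` itself. -/
theorem eventually_exists_basis [LieAlgebra.IsKilling K g]
    {ι : Type*} [Fintype ι] {e e' : ι → g} (he : IsKillingDual K e e')
    (b : Module.Basis (Fin m) K g) :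
    ∀ᶠ w in 𝓝 (sc b), IsLieSC w → ∃ b₁ : Module.Basis (Fin m) K g, sc b₁ = w := by
  obtain ⟨C, hC⟩ := (LinearMap.ker (infDefect (sc b))).exists_isCompl
  let n := Module.finrank K C
  let j₀ : (Fin n → K) →ₗ[K] SC K m := C.subtype ∘ₗ (Module.finBasis K C).equivFun.symm.toLinearMap
  have hj₀ : LinearMap.range j₀ = C := by
    rw [LinearMap.range_comp, LinearEquiv.range, Submodule.map_top, Submodule.range_subtype]
  have hinj : Function.Injective j₀ :=
    C.injective_subtype.comp (Module.finBasis K C).equivFun.symm.injective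
  let j : (Fin n → K) →L[K] SC K m := LinearMap.toContinuousLinearMap j₀
  have hjC : ∀ c, j c ∈ C := fun c => hj₀ ▸ LinearMap.mem_range_self j₀ c
  have h0 : lieDefect (sc b) = 0 := (isLieSC_iff _).mp (isLieSC_sc b)
  -- the only solution of the structure equations near `sc b` in `sc b + C` is `sc b`
  have hgood : ∀ᶠ c : Fin n → K in 𝓝 0, IsLieSC (sc b + j c) → c = 0 := by
    have hd : HasFDerivAt (fun c : Fin n → K => lieDefect (sc b + j c))
        ((LinearMap.toContinuousLinearMap (infDefect (sc b))).comp j) 0 := by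
      have h1 : HasFDerivAt (fun c : Fin n → K => sc b + j c)
          j 0 := j.hasFDerivAt.const_add _
      refine HasFDerivAt.comp (g := lieDefect) 0 ?_ h1
      have h2 : sc b + j 0 = sc b := by simp
      rw [h2]
      exact hasFDerivAt_lieDefect (sc b)
    have hker : ((LinearMap.toContinuousLinearMap (infDefect (sc b))).comp
        j).ker = ⊥ := by
      rw [LinearMap.ker_eq_bot']
      intro c hc
      have : j c ∈
          LinearMap.ker (infDefect (sc b)) ⊓ C := ⟨hc, hjC c⟩
      rw [hC.inf_eq_bot, Submodule.mem_bot] at this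
      exact hinj (this.trans (map_zero j₀).symm)
    obtain ⟨k, -, hk⟩ := LinearMap.exists_antilipschitzWith _ hker
    have h2 := hd.eventually_ne (c := 0) ⟨k, hk⟩
    rw [eventually_nhdsWithin_iff] at h2
    filter_upwards [h2] with c hc hl
    by_contra hne
    exact hc hne ((isLieSC_iff _).mp hl)
  -- The first component vanishes exactly when `w` is the transform by `A` of the point `sc b + j c`
  -- of the slice, with the inverse of `A` cleared. Repeating `w` as second component lets local
  -- surjectivity prescribe it.
  let Ψ : Matrix (Fin m) (Fin m) K × (Fin n → K) × (SC K m) →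
      (SC K m) × (SC K m) :=
    fun x => (fun i => ∑ p, x.1 p i • ((sc b + j x.2.1) p * x.1) - x.1 * x.2.2 i, x.2.2)
  let a : Matrix (Fin m) (Fin m) K × (Fin n → K) × (SC K m) := (1, 0, sc b)
  have hΨa : Ψ a = (0, sc b) := by
    ext1
    · funext i
      simp [Ψ, a, Matrix.one_apply]
    · rfl
  obtain ⟨Ψ', hΨ', hval⟩ : ∃ Ψ' : Matrix (Fin m) (Fin m) K × (Fin n → K) ×
      (SC K m) →L[K]
      (SC K m) × (SC K m),
      HasStrictFDerivAt Ψ Ψ' a ∧ ∀ S c u, Ψ' (S, c, u) =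
        (infChange S (sc b) + j c - u, u) := by
    let fA : Matrix (Fin m) (Fin m) K × (Fin n → K) × SC K m →L[K] Matrix (Fin m) (Fin m) K :=
      ContinuousLinearMap.fst K _ _
    let fc : Matrix (Fin m) (Fin m) K × (Fin n → K) × SC K m →L[K] SC K m :=
      j.comp ((ContinuousLinearMap.fst K _ _).comp (ContinuousLinearMap.snd K _ _))
    let fw : Matrix (Fin m) (Fin m) K × (Fin n → K) × SC K m →L[K] SC K m :=
      (ContinuousLinearMap.snd K _ _).comp (ContinuousLinearMap.snd K _ _)
    let fe : ∀ p i, Matrix (Fin m) (Fin m) K × (Fin n → K) × SC K m →L[K] K := fun p i =>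
      (LinearMap.toContinuousLinearMap (Matrix.entryLinearMap K K p i)).comp fA
    let pr : Fin m → SC K m →L[K] Matrix (Fin m) (Fin m) K := fun i =>
      ContinuousLinearMap.proj (R := K) (φ := fun _ => Matrix (Fin m) (Fin m) K) i
    have hA : HasStrictFDerivAt (fun x => fA x) fA a := fA.hasStrictFDerivAt
    have he : ∀ p i, HasStrictFDerivAt (fun x => fe p i x) (fe p i) a := fun p i =>
      (fe p i).hasStrictFDerivAt
    have hc : ∀ p, HasStrictFDerivAt (fun x => sc b p + ((pr p).comp fc) x) ((pr p).comp fc) a :=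
      fun p => ((pr p).comp fc).hasStrictFDerivAt.const_add _
    have hw : ∀ i, HasStrictFDerivAt (fun x => ((pr i).comp fw) x) ((pr i).comp fw) a :=
      fun i => ((pr i).comp fw).hasStrictFDerivAt
    refine ⟨_, HasStrictFDerivAt.prodMk (hasStrictFDerivAt_pi.mpr fun i =>
      (HasStrictFDerivAt.fun_sum fun p _ => (he p i).smul ((hc p).mul' hA)).sub
        (hA.mul' (hw i))) fw.hasStrictFDerivAt, fun S c u => ?_⟩
    have hsum : ∀ (f : Fin m → (Matrix (Fin m) (Fin m) K × (Fin n → K) × SC K m →L[K]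
        Matrix (Fin m) (Fin m) K)) x, (∑ p, f p) x = ∑ p, f p x := fun f x => sum_apply _ _ _
    ext1
    · funext i
      refine (congrArg (fun y : Matrix (Fin m) (Fin m) K => y - _)
        (hsum _ _)).trans ?_
      change ∑ p, ((1 : Matrix (Fin m) (Fin m) K) p i •
          ((sc b p + ((j 0 p))) * S + (j c) p * 1)
          + S p i • ((sc b p + ((j 0 p))) * 1)) - (1 * u i + S * sc b i)
        = ∑ p, S p i • sc b p + sc b i * S - S * sc b i + j c i - u i
      simp [Matrix.one_apply, Finset.sum_add_distrib]
      abel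
    · rfl
  have hsurj : Ψ'.range = ⊤ := by
    rw [LinearMap.range_eq_top]
    rintro ⟨v, u⟩
    -- The kernel part of `v + u` is reached by the matrix variable, since it is a coboundary, and
    -- the other part by the slice variable.
    have hv : v + u ∈ LinearMap.ker (infDefect (sc b)) ⊔ C := by
      rw [hC.sup_eq_top]
      trivial
    obtain ⟨z, hz, c, hc, hzc⟩ := Submodule.mem_sup.mp hv
    have hz' := (LinearMap.mem_ker.mp hz)
    simp only [infDefect, LinearMap.coe_mk, AddHom.coe_mk, Prod.mk_eq_zero, funext_iff,
      Pi.zero_apply] at hz'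
    obtain ⟨S, hS⟩ := exists_infChange_eq he b (u := z)
      (fun i j k => eq_neg_iff_add_eq_zero.mpr (hz'.1 i j k)) hz'.2
    rw [← hj₀] at hc
    obtain ⟨c, rfl⟩ := hc
    refine ⟨(S, c, u), ?_⟩
    change Ψ' _ = _
    rw [hval, hS]
    ext1
    · change z + j₀ c - u = v
      rw [hzc, add_sub_cancel_right]
    · rfl
  have : @CompleteSpace (Matrix (Fin m) (Fin m) K × (Fin n → K) × SC K m)
      PseudoMetricSpace.toUniformSpace := by
    exact (inferInstance : CompleteSpace (Matrix (Fin m) (Fin m) K × (Fin n → K) × SC K m))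
  have : @CompleteSpace (SC K m × SC K m) PseudoMetricSpace.toUniformSpace := by
    exact (inferInstance : CompleteSpace (SC K m × SC K m))
  have hmap := hΨ'.map_nhds_eq_of_surj hsurj
  have hE : ∀ᶠ x in 𝓝 a, x.1.det ≠ 0 ∧ (IsLieSC (sc b + j x.2.1) → x.2.1 = 0) := by
    refine Filter.Eventually.and ?_ ?_
    · have : ContinuousAt (fun x : Matrix (Fin m) (Fin m) K × (Fin n → K) ×
        (SC K m) => x.1.det) a :=
        (Continuous.matrix_det continuous_fst).continuousAt
      exact this.eventually_ne (by simp [a])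
    · have : Tendsto (fun x : Matrix (Fin m) (Fin m) K × (Fin n → K) ×
        (SC K m) => x.2.1) (𝓝 a) (𝓝 0) :=
        (continuous_fst.comp continuous_snd).continuousAt
      exact this.eventually hgood
  -- `Ψ` is open at `a`, so all `(0, w)` with `w` near `sc b` are values at points with `A`
  -- invertible and the slice variable in the region of isolation.
  have himg : Ψ '' _ ∈ 𝓝 (Ψ a) := hmap ▸ Filter.image_mem_map hE
  rw [hΨa] at himg
  have hcont : Tendsto (fun w : SC K m =>
      ((0 : SC K m), w)) (𝓝 (sc b)) (𝓝 (0, sc b)) :=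
    (Continuous.prodMk continuous_const continuous_id).continuousAt
  filter_upwards [hcont himg] with w hw hlie
  obtain ⟨⟨A, c, w'⟩, ⟨hdet, hgc⟩, hx⟩ := hw
  have h2 : w' = w := congrArg Prod.snd hx
  subst h2
  have h1 : ∀ i, ∑ p, A p i • ((sc b + j c) p * A) = A * w' i := fun i =>
    sub_eq_zero.mp (congrFun (congrArg Prod.fst hx) i)
  have hc0 : c = 0 := hgc (isLieSC_of_transform hlie hdet h1)
  subst hc0
  obtain ⟨b₁, -, hb₁⟩ := exists_basis_of_det_ne_zero b hdet
  refine ⟨b₁, ?_⟩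
  funext i
  have hu : IsUnit A := (Matrix.isUnit_iff_isUnit_det A).mpr (isUnit_iff_ne_zero.mpr hdet)
  refine hu.mul_left_cancel ?_
  rw [hb₁, ← h1]
  simp

end Rigidity

/-! ### The discriminant of the Killing form -/

section Discriminant

variable {K g : Type*} [Field K] [LieRing g] [LieAlgebra K g] {m : ℕ}

/-- The discriminant of the Killing form, in terms of structure constants. -/
def disc (w : SC K m) : K := (Matrix.of fun i j => (w i * w j).trace).det

lemma killingForm_toMatrix [FiniteDimensional K g] (b : Module.Basis (Fin m) K g) :
    LinearMap.BilinForm.toMatrix b (killingForm K g) =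
      Matrix.of fun i j => (sc b i * sc b j).trace := by
  ext i j
  rw [LinearMap.BilinForm.toMatrix_apply, killingForm_apply_apply,
    LinearMap.trace_eq_matrix_trace K b, LinearMap.toMatrix_comp b b b]
  rfl

lemma disc_sc_ne_zero_iff [FiniteDimensional K g] (b : Module.Basis (Fin m) K g) :
    disc (sc b) ≠ 0 ↔ LieAlgebra.IsKilling K g := by
  rw [disc, ← killingForm_toMatrix, ← LinearMap.BilinForm.nondegenerate_iff_det_ne_zero b]
  constructor
  · intro h
    constructor
    rw [LieSubmodule.eq_bot_iff]
    intro x hx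
    rw [LieIdeal.mem_killingCompl] at hx
    exact h.2 x fun y => hx y trivial
  · intro h
    exact LieAlgebra.IsKilling.killingForm_nondegenerate K g

/-- The Gram matrix of the Killing form changes to `Aᵀ G A`. In particular changes of determinant 1
preserve the discriminant. -/
lemma disc_transform {w w₁ : SC K m} {A : Matrix (Fin m) (Fin m) K} (hA : A.det ≠ 0)
    (h : ∀ i, A * w₁ i = ∑ p, A p i • (w p * A)) : disc w₁ = A.det ^ 2 * disc w := by
  have hu : IsUnit A.det := isUnit_iff_ne_zero.mpr hA
  have hAB : A * A⁻¹ = 1 := Matrix.mul_nonsing_inv A hu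
  have hBA : A⁻¹ * A = 1 := Matrix.nonsing_inv_mul A hu
  have h1 : ∀ i, w₁ i = A⁻¹ * (∑ p, A p i • w p) * A := by
    intro i
    calc w₁ i = A⁻¹ * (A * w₁ i) := by rw [← mul_assoc, hBA, one_mul]
      _ = _ := by
        rw [h, mul_assoc, Finset.sum_mul]
        simp only [smul_mul_assoc]
  have h2 : (Matrix.of fun i j => (w₁ i * w₁ j).trace) =
      A.transpose * (Matrix.of fun i j => (w i * w j).trace) * A := by
    ext i j
    have h3 : w₁ i * w₁ j = A⁻¹ * ((∑ p, A p i • w p) * (∑ p, A p j • w p)) * A := by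
      rw [h1, h1]
      calc _ = A⁻¹ * (∑ p, A p i • w p) * (A * A⁻¹) * (∑ p, A p j • w p) * A := by
            simp only [mul_assoc]
        _ = _ := by rw [hAB]; simp only [mul_assoc, one_mul]
    rw [Matrix.of_apply, h3, Matrix.trace_mul_comm, ← mul_assoc, hAB, one_mul]
    simp only [Finset.sum_mul, Finset.mul_sum, Matrix.trace_sum, smul_mul_assoc, mul_smul_comm,
      Matrix.trace_smul, Matrix.mul_apply, Matrix.of_apply, Matrix.transpose_apply,
      smul_eq_mul]
    refine Finset.sum_congr rfl fun p _ => Finset.sum_congr rfl fun q _ => ?_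
    ring
  rw [disc, h2, Matrix.det_mul, Matrix.det_mul, Matrix.det_transpose, disc]
  ring

lemma exists_isKillingDual [FiniteDimensional K g] [LieAlgebra.IsKilling K g] :
    ∃ (n : ℕ) (e e' : Fin n → g), IsKillingDual K e e' := by
  let b := Module.finBasis K g
  have hnd : (killingForm K g).Nondegenerate := LieAlgebra.IsKilling.killingForm_nondegenerate K g
  refine ⟨_, b, LinearMap.BilinForm.dualBasis (killingForm K g) hnd b, fun x => ?_, fun x => ?_⟩
  · conv_rhs => rw [← b.sum_repr x]
    refine Finset.sum_congr rfl fun i _ => ?_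
    congr 1
    conv_lhs => rw [← b.sum_repr x]
    simp only [map_sum, map_smul, LinearMap.BilinForm.apply_dualBasis_left]
    simp
  · conv_rhs => rw [← (LinearMap.BilinForm.dualBasis (killingForm K g) hnd b).sum_repr x]
    refine Finset.sum_congr rfl fun i _ => ?_
    rw [LinearMap.BilinForm.dualBasis_repr_apply, LieModule.traceForm_comm]

lemma sc_map {L : Type*} [LieRing L] [LieAlgebra K L] (b : Module.Basis (Fin m) K L)
    (e : L ≃ₗ[K] g) (he : ∀ x y, e ⁅x, y⁆ = ⁅e x, e y⁆) : sc (b.map e) = sc b := by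
  funext i
  ext k j
  rw [sc_apply, sc_apply]
  simp [← he]

lemma exists_lie_map_of_sc_eq {L : Type*} [LieRing L] [LieAlgebra K L]
    (b : Module.Basis (Fin m) K L) (b' : Module.Basis (Fin m) K g) (h : sc b = sc b') :
    ∃ e : L ≃ₗ[K] g, ∀ x y, e ⁅x, y⁆ = ⁅e x, e y⁆ := by
  refine ⟨b.equiv b' (Equiv.refl _), fun x y => ?_⟩
  set e := b.equiv b' (Equiv.refl _) with he
  have heb : ∀ i, e (b i) = b' i := fun i => by simp [he]
  have h1 : ((LieModule.toEnd K L L : L →ₗ[K] L →ₗ[K] L).compr₂ e.toLinearMap) =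
      (LieModule.toEnd K g g : g →ₗ[K] g →ₗ[K] g).compl₁₂ e.toLinearMap e.toLinearMap := by
    refine b.ext fun i => b.ext fun j => ?_
    simp only [LinearMap.compr₂_apply, LinearMap.compl₁₂_apply, LinearEquiv.coe_coe, heb]
    change e ⁅b i, b j⁆ = ⁅b' i, b' j⁆
    rw [← b.sum_repr ⁅b i, b j⁆, ← b'.sum_repr ⁅b' i, b' j⁆]
    simp only [map_sum, map_smul, heb, ← sc_apply, h]
  exact LinearMap.congr_fun (LinearMap.congr_fun h1 x) y

end Discriminant

/-! ### Bases with structure constants of minimal norm -/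

section Minimal

variable {K g : Type*} [RCLike K] [LieRing g] [LieAlgebra K g] {m : ℕ}

/-- Structure constants as a vector of a Hermitian space. -/
def scVec : SC K m →ₗ[K] EuclideanSpace K (Fin m × Fin m × Fin m) where
  toFun w := WithLp.toLp 2 fun i => w i.1 i.2.1 i.2.2
  map_add' _ _ := rfl
  map_smul' _ _ := rfl

lemma inner_scVec (w w' : SC K m) :
    inner K (scVec w) (scVec w') = ∑ i, ((w i).conjTranspose * w' i).trace := by
  simp only [PiLp.inner_apply, Fintype.sum_prod_type, Matrix.trace, Matrix.diag, Matrix.mul_apply,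
    Matrix.conjTranspose_apply, scVec, RCLike.inner_apply]
  refine Finset.sum_congr rfl fun i _ => ?_
  rw [Finset.sum_comm]
  refine Finset.sum_congr rfl fun j _ => Finset.sum_congr rfl fun k _ => ?_
  rw [mul_comm]
  rfl

lemma isClosed_isLieSC : IsClosed {w : SC K m | IsLieSC w} := by
  simp only [isLieSC_iff]
  exact isClosed_eq (by unfold lieDefect; fun_prop) continuous_const

/-- A limit `w` still satisfies the structure equations, and its discriminant is the same nonzero
number, so it belongs to a Killing algebra. Rigidity at `w` shows that the approximating points come
from the algebra of `w`, which is therefore isomorphic to g. The fixed discriminant matters: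
unrestricted rescaling of the basis can contract the structure constants to 0. -/
lemma isClosed_orbit [LieAlgebra.IsKilling K g] (b : Module.Basis (Fin m) K g) :
    IsClosed {w : SC K m | ∃ b' : Module.Basis (Fin m) K g, sc b' = w ∧ disc w = disc (sc b)} := by
  have : FiniteDimensional K g := b.finiteDimensional_of_finite
  rw [← closure_subset_iff_isClosed]
  intro w hw
  have hlie : IsLieSC w := by
    refine closure_minimal ?_ isClosed_isLieSC hw
    rintro _ ⟨b', rfl, -⟩
    exact isLieSC_sc b'
  have hdisc : disc w = disc (sc b) := by
    have hcl : IsClosed {w : SC K m | disc w = disc (sc b)} := by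
      refine isClosed_eq ?_ continuous_const
      unfold disc
      fun_prop
    exact closure_minimal (fun v hv => hv.choose_spec.2) hcl hw
  obtain ⟨L, _, _, b₀, rfl⟩ := hlie.exists_basis
  have : FiniteDimensional K L := b₀.finiteDimensional_of_finite
  have : LieAlgebra.IsKilling K L := by
    rw [← disc_sc_ne_zero_iff b₀, hdisc, disc_sc_ne_zero_iff b]
    infer_instance
  obtain ⟨n, e, e', he⟩ := exists_isKillingDual (K := K) (g := L)
  obtain ⟨v, ⟨b', rfl, -⟩, hv⟩ := ((mem_closure_iff_frequently.mp hw).and_eventually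
    (eventually_exists_basis he b₀)).exists
  obtain ⟨b₁, hb₁⟩ := hv (isLieSC_sc b')
  obtain ⟨φ, hφ⟩ := exists_lie_map_of_sc_eq b₁ b' hb₁
  exact ⟨b₀.map φ, sc_map b₀ φ hφ, hdisc⟩

lemma exists_minimal_basis [LieAlgebra.IsKilling K g] (b : Module.Basis (Fin m) K g) :
    ∃ b₀ : Module.Basis (Fin m) K g, ∀ b₁ : Module.Basis (Fin m) K g,
      disc (sc b₁) = disc (sc b₀) → ‖scVec (sc b₀)‖ ≤ ‖scVec (sc b₁)‖ := by
  let ψ : EuclideanSpace K (Fin m × Fin m × Fin m) → SC K m :=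
    fun v i => Matrix.of fun k j => v (i, k, j)
  have hψ : Continuous ψ := by
    refine continuous_pi fun i => continuous_matrix fun k j => ?_
    simp only [ψ, Matrix.of_apply]
    fun_prop
  have hψv : ∀ w, ψ (scVec w) = w := fun w => rfl
  obtain ⟨v, ⟨b₀, hb₀, hd⟩, hv⟩ := ((isClosed_orbit b).preimage hψ).exists_infDist_eq_dist
    ⟨scVec (sc b), b, rfl, rfl⟩ 0
  refine ⟨b₀, fun b₁ h₁ => ?_⟩
  have h2 : scVec (sc b₀) = v := by
    rw [hb₀]
    rfl
  rw [h2, ← dist_zero_left v, ← hv, ← dist_zero_left]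
  refine Metric.infDist_le_dist_of_mem ⟨b₁, rfl, ?_⟩
  rw [hψv, h₁, hb₀, hd]

/-- First-order condition at a minimum of the norm along a polynomial curve of degree 3, the shape
produced by `1 + t • S` with `S` of square zero. Moving in the direction that lowers the norm to
first order would contradict minimality. -/
lemma inner_eq_zero_of_minimal {E : Type*} [NormedAddCommGroup E] [InnerProductSpace K E]
    {w a r q : E} (h : ∀ t : K, ‖w‖ ≤ ‖w + t • a + t ^ 2 • r + t ^ 3 • q‖) :
    inner K w a = (0 : K) := by
  by_contra hne
  set z : K := inner K w a with hz
  have hzpos : 0 < ‖z‖ ^ 2 := by positivity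
  set B : ℝ := 2 * (‖w‖ * (‖z‖ ^ 2 * (‖r‖ + ‖z‖ * ‖q‖))) +
    (‖z‖ * ‖a‖ + ‖z‖ ^ 2 * (‖r‖ + ‖z‖ * ‖q‖)) ^ 2 with hB
  have key : ∀ s : ℝ, 0 ≤ s → s ≤ 1 → 2 * s * ‖z‖ ^ 2 ≤ s ^ 2 * B := by
    intro s hs0 hs1
    -- This phase makes `t * z` equal to `-s ‖z‖²`, which handles the real and complex cases
    -- together.
    set t : K := -(s : K) * (starRingEnd K) z with ht
    have htn : ‖t‖ = s * ‖z‖ := by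
      rw [ht, norm_mul, norm_neg, RCLike.norm_ofReal, abs_of_nonneg hs0, RCLike.norm_conj]
    set d : E := t ^ 2 • (r + t • q) with hd
    have hdn : ‖d‖ ≤ s ^ 2 * (‖z‖ ^ 2 * (‖r‖ + ‖z‖ * ‖q‖)) := by
      rw [hd, norm_smul, norm_pow, htn, mul_pow, mul_assoc]
      gcongr
      refine (norm_add_le _ _).trans ?_
      rw [norm_smul, htn]
      gcongr
      exact mul_le_of_le_one_left (norm_nonneg _) hs1
    have h1 : w + t • a + t ^ 2 • r + t ^ 3 • q = w + (t • a + d) := by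
      rw [hd, smul_add, smul_smul]
      ring_nf
      abel
    have h2 := h t
    rw [h1] at h2
    have h3 : ‖w‖ ^ 2 ≤ ‖w + (t • a + d)‖ ^ 2 := by gcongr
    rw [@norm_add_sq K, inner_add_right, inner_smul_right, ← hz, map_add] at h3
    have h4 : RCLike.re (t * z) = - s * ‖z‖ ^ 2 := by
      rw [ht, mul_assoc, RCLike.conj_mul]
      rw [← RCLike.ofReal_neg, ← RCLike.ofReal_pow, ← RCLike.ofReal_mul, RCLike.ofReal_re]
    have h5 : RCLike.re (inner K w d) ≤ ‖w‖ * ‖d‖ :=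
      (RCLike.re_le_norm _).trans (norm_inner_le_norm _ _)
    have h6 : ‖t • a + d‖ ≤ s * (‖z‖ * ‖a‖ + ‖z‖ ^ 2 * (‖r‖ + ‖z‖ * ‖q‖)) := by
      refine (norm_add_le _ _).trans ?_
      rw [norm_smul, htn, mul_add, mul_assoc]
      gcongr
      refine hdn.trans ?_
      gcongr
      nlinarith
    have h7 : ‖t • a + d‖ ^ 2 ≤ s ^ 2 * (‖z‖ * ‖a‖ + ‖z‖ ^ 2 * (‖r‖ + ‖z‖ * ‖q‖)) ^ 2 := by
      rw [← mul_pow]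
      gcongr
    have h8 : ‖w‖ * ‖d‖ ≤ ‖w‖ * (s ^ 2 * (‖z‖ ^ 2 * (‖r‖ + ‖z‖ * ‖q‖))) := by gcongr
    rw [h4] at h3
    rw [hB]
    nlinarith
  have hB0 : 0 ≤ B := by positivity
  -- For this `s`, `s * B ≤ ‖z‖²`, whereas the inequality `key` would force `2 ‖z‖² ≤ s * B`.
  have hs := key (‖z‖ ^ 2 / (B + ‖z‖ ^ 2)) (by positivity)
    (by rw [div_le_one (by positivity)]; linarith)
  set s := ‖z‖ ^ 2 / (B + ‖z‖ ^ 2) with hsdef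
  have hspos : 0 < s := by positivity
  have hsB : s * B ≤ ‖z‖ ^ 2 := by
    rw [hsdef, div_mul_eq_mul_div, div_le_iff₀ (by positivity)]
    nlinarith
  nlinarith

/-- The derivative of the norm of a minimal family of structure constants vanishes along rank one
square-zero matrices. -/
lemma inner_infChange_vecMulVec (b₀ : Module.Basis (Fin m) K g)
    (hmin : ∀ b₁ : Module.Basis (Fin m) K g,
      disc (sc b₁) = disc (sc b₀) → ‖scVec (sc b₀)‖ ≤ ‖scVec (sc b₁)‖)
    {u v : Fin m → K} (huv : dotProduct v u = 0) :
    inner K (scVec (sc b₀)) (scVec (infChange (Matrix.vecMulVec u v) (sc b₀))) = (0 : K) := by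
  set S := Matrix.vecMulVec u v with hS
  set w := sc b₀ with hw
  -- With square zero, `1 + t • S` has inverse `1 - t • S` and determinant 1. It therefore keeps the
  -- discriminant and moves the structure constants polynomially in `t`.
  have hSS : S * S = 0 := by
    rw [hS, Matrix.vecMulVec_mul_vecMulVec, huv, zero_smul]
    simp
  have hdet : ∀ t : K, (1 + t • S).det = 1 := by
    intro t
    have : t • S = Matrix.replicateCol Unit (t • u) * Matrix.replicateRow Unit v := by
      rw [hS, ← Matrix.vecMulVec_eq, Matrix.smul_vecMulVec]
    rw [this, Matrix.det_one_add_replicateCol_mul_replicateRow, dotProduct_smul, huv]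
    simp
  let T : SC K m := fun i => ∑ p, S p i • w p
  refine inner_eq_zero_of_minimal (r := scVec fun i => T i * S - S * T i - S * w i * S)
    (q := scVec fun i => - (S * T i * S)) fun t => ?_
  obtain ⟨b₁, -, hb₁⟩ := exists_basis_of_det_ne_zero b₀ (A := 1 + t • S)
    (by rw [hdet]; exact one_ne_zero)
  have hd : disc (sc b₁) = disc (sc b₀) := by
    rw [disc_transform (by rw [hdet]; exact one_ne_zero) hb₁, hdet]
    simp
  refine (hmin b₁ hd).trans_eq ?_
  rw [← map_smul, ← map_smul, ← map_smul, ← map_add, ← map_add, ← map_add]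
  congr 2
  funext i
  have h1 : (1 - t • S) * (1 + t • S) = 1 := by
    rw [sub_mul, mul_add, mul_add, smul_mul_smul_comm, hSS]
    simp
  have h2 : ∑ p, (1 + t • S) p i • (w p * (1 + t • S)) = (w i + t • T i) * (1 + t • S) := by
    simp only [Matrix.add_apply, Matrix.smul_apply, add_smul, Finset.sum_add_distrib, add_mul,
      Finset.smul_sum, Finset.sum_mul, T, smul_eq_mul, mul_smul, smul_mul_assoc]
    simp [Matrix.one_apply]
  calc sc b₁ i = (1 - t • S) * ((1 + t • S) * sc b₁ i) := by rw [← mul_assoc, h1, one_mul]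
    _ = (1 - t • S) * ((w i + t • T i) * (1 + t • S)) := by rw [hb₁, h2]
    _ = _ := by
      simp only [infChange, Pi.add_apply, Pi.smul_apply]
      change _ = w i + t • (T i + w i * S - S * w i) + _ + _
      simp only [sub_mul, add_mul, mul_add, one_mul, mul_one, smul_mul_assoc, mul_smul_comm,
        smul_add, smul_sub, smul_smul, smul_neg, ← mul_assoc]
      module

end Minimal

/-! ### Adjoint matrices stable under conjugate transposition -/

section Star

variable {K g : Type*} [RCLike K] [LieRing g] [LieAlgebra K g] {m : ℕ}

lemma inner_infChange_left (X : Matrix (Fin m) (Fin m) K) (w w' : SC K m) :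
    inner K (scVec (infChange X w)) (scVec w') =
      inner K (scVec w) (scVec (infChange X.conjTranspose w')) := by
  simp only [inner_scVec, infChange, Matrix.conjTranspose_sub, Matrix.conjTranspose_add,
    Matrix.conjTranspose_sum, Matrix.conjTranspose_smul, Matrix.conjTranspose_mul, sub_mul, add_mul,
    mul_sub, mul_add, Finset.sum_mul, Finset.mul_sum, Matrix.trace_sub, Matrix.trace_add,
    Matrix.trace_sum, smul_mul_assoc, mul_smul_comm, Matrix.trace_smul, Finset.sum_add_distrib,
    Finset.sum_sub_distrib, Matrix.conjTranspose_apply]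
  congr 1
  · congr 1
    · exact Finset.sum_comm
    · refine Finset.sum_congr rfl fun i _ => ?_
      rw [← mul_assoc, Matrix.trace_mul_comm, mul_assoc]
      rw [Matrix.trace_mul_comm, mul_assoc, Matrix.trace_mul_comm]
      simp only [mul_assoc]
  · exact Finset.sum_congr rfl fun i _ => by rw [mul_assoc]

/-- Change of basis is a right action, hence the reversed commutator. Its trace is zero, which is
what the minimality argument needs. -/
lemma infChange_commutator (X Y : Matrix (Fin m) (Fin m) K) (w : SC K m) :
    infChange X (infChange Y w) - infChange Y (infChange X w) = infChange (Y * X - X * Y) w := by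
  have h : ∀ (A B : Matrix (Fin m) (Fin m) K) i, ∑ p, A p i • ∑ q, B q p • w q
      = ∑ q, (B * A) q i • w q := by
    intro A B i
    simp only [Finset.smul_sum, smul_smul, Matrix.mul_apply, Finset.sum_smul]
    rw [Finset.sum_comm]
    simp only [mul_comm]
  funext i
  simp only [infChange, Pi.sub_apply, smul_add, smul_sub, Finset.sum_add_distrib,
    Finset.sum_sub_distrib, h, Matrix.sub_apply, sub_smul, add_mul, sub_mul, mul_add, mul_sub,
    Finset.sum_mul, Finset.mul_sum, smul_mul_assoc, mul_smul_comm, mul_assoc]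
  abel

/-- The infinitesimal stabilizer of the structure constants is the algebra of derivations. -/
lemma infChange_sc_eq_zero_iff (b : Module.Basis (Fin m) K g) (D : g →ₗ[K] g) :
    infChange (LinearMap.toMatrix b b D) (sc b) = 0 ↔ ∀ x y, D ⁅x, y⁆ = ⁅D x, y⁆ + ⁅x, D y⁆ := by
  have h1 : ∀ i, infChange (LinearMap.toMatrix b b D) (sc b) i =
      LinearMap.toMatrix b b (LieAlgebra.ad K g (D (b i)) + LieAlgebra.ad K g (b i) ∘ₗ D
        - D ∘ₗ LieAlgebra.ad K g (b i)) := by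
    intro i
    rw [map_sub, map_add, toMatrix_ad, LinearMap.toMatrix_comp b b b,
      LinearMap.toMatrix_comp b b b]
    simp only [infChange, LinearMap.toMatrix_apply]
    rfl
  constructor
  · intro h
    have h2 : ((LieModule.toEnd K g g : g →ₗ[K] g →ₗ[K] g).compr₂ D) =
        (LieModule.toEnd K g g : g →ₗ[K] g →ₗ[K] g) ∘ₗ D +
          (LieModule.toEnd K g g : g →ₗ[K] g →ₗ[K] g).compl₂ D := by
      refine b.ext fun i => ?_
      have h3 := congrFun h i
      rw [h1, Pi.zero_apply, LinearEquiv.map_eq_zero_iff, sub_eq_zero] at h3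
      exact h3.symm
    intro x y
    exact LinearMap.congr_fun (LinearMap.congr_fun h2 x) y
  · intro h
    funext i
    rw [h1, Pi.zero_apply, LinearEquiv.map_eq_zero_iff, sub_eq_zero]
    ext y
    exact (h (b i) y).symm

/-- A Killing Lie algebra has a basis in which the adjoint matrices are stable under conjugate
transposition. -/
theorem exists_basis_conjTranspose_ad [LieAlgebra.IsKilling K g] (b : Module.Basis (Fin m) K g) :
    ∃ b₀ : Module.Basis (Fin m) K g, ∀ x : g, ∃ x' : g,
      LinearMap.toMatrix b₀ b₀ (LieAlgebra.ad K g x') =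
        (LinearMap.toMatrix b₀ b₀ (LieAlgebra.ad K g x)).conjTranspose := by
  have : FiniteDimensional K g := b.finiteDimensional_of_finite
  obtain ⟨b₀, hmin⟩ := exists_minimal_basis b
  refine ⟨b₀, fun x => ?_⟩
  -- The moment map of the action at the minimal point. It vanishes on `vecMulVec u v` with `v ⬝ u =
  -- 0`; these matrices span the trace-free ones, so `M` factors through the trace.
  let M : Matrix (Fin m) (Fin m) K →ₗ[K] K :=
    { toFun := fun S => inner K (scVec (sc b₀)) (scVec (infChange S (sc b₀)))
      map_add' := fun S T => by
        rw [← inner_add_right, ← map_add]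
        congr 2
        funext i
        simp only [infChange, Matrix.add_apply, add_smul, Finset.sum_add_distrib, mul_add, add_mul,
          Pi.add_apply]
        abel
      map_smul' := fun t S => by
        rw [RingHom.id_apply, smul_eq_mul, ← inner_smul_right, ← map_smul]
        congr 2
        funext i
        simp only [infChange, Matrix.smul_apply, Pi.smul_apply, smul_sub, smul_add,
          Finset.smul_sum, smul_eq_mul, mul_smul, smul_mul_assoc, mul_smul_comm] }
  have hM0 : ∀ u v : Fin m → K, dotProduct v u = 0 → M (Matrix.vecMulVec u v) = 0 :=
    fun u v huv => inner_infChange_vecMulVec b₀ hmin huv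
  have hoff : ∀ i j, i ≠ j → M (Matrix.single i j 1) = 0 := by
    intro i j hij
    have := hM0 (Pi.single i 1) (Pi.single j 1) (by simp [hij])
    rwa [← Matrix.single_eq_single_vecMulVec_single] at this
  have hdiag : ∀ i j, M (Matrix.single i i 1) = M (Matrix.single j j 1) := by
    intro i j
    rcases eq_or_ne i j with rfl | hij
    · rfl
    -- This rank-one matrix is the difference of two diagonal units up to off-diagonal ones, on
    -- which `M` is already zero.
    have := hM0 (Pi.single i 1 - Pi.single j 1) (Pi.single i 1 + Pi.single j 1)
      (by simp [hij, hij.symm])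
    rw [Matrix.sub_vecMulVec, Matrix.vecMulVec_add, Matrix.vecMulVec_add] at this
    simp only [← Matrix.single_eq_single_vecMulVec_single, map_add, map_sub, hoff i j hij,
      hoff j i hij.symm, add_zero, zero_add] at this
    exact sub_eq_zero.mp this
  have htr : ∀ S : Matrix (Fin m) (Fin m) K, S.trace = 0 → M S = 0 := by
    intro S hS
    rcases isEmpty_or_nonempty (Fin m) with hm | ⟨⟨k⟩⟩
    · rw [Subsingleton.elim S 0, map_zero]
    rw [Matrix.matrix_eq_sum_single S, map_sum]
    simp only [map_sum]
    have h1 : ∀ i j, M (Matrix.single i j (S i j)) =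
        if i = j then S i i * M (Matrix.single k k 1) else 0 := by
      intro i j
      have : Matrix.single i j (S i j) = S i j • Matrix.single i j (1 : K) := by simp
      rw [this, map_smul]
      split_ifs with hij
      · subst hij
        rw [hdiag i k, smul_eq_mul]
      · rw [hoff i j hij, smul_zero]
    simp only [h1, Finset.sum_ite_eq, Finset.mem_univ, if_true, ← Finset.sum_mul]
    change S.trace * _ = 0
    rw [hS, zero_mul]
  set X := LinearMap.toMatrix b₀ b₀ (LieAlgebra.ad K g x) with hX
  have hX0 : infChange X (sc b₀) = 0 := by
    rw [hX, infChange_sc_eq_zero_iff]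
    intro y z
    exact leibniz_lie x y z
  -- Its squared norm is `⟨w, infChange X (infChange Xᴴ w)⟩` with `w = sc b₀`. As `X` kills `w`,
  -- this is `M` at a commutator of `X` and `Xᴴ`, which has trace zero. So `Xᴴ` is a derivation,
  -- hence inner.
  have hX1 : infChange X.conjTranspose (sc b₀) = 0 := by
    have h1 : inner K (scVec (infChange X.conjTranspose (sc b₀)))
        (scVec (infChange X.conjTranspose (sc b₀))) = (0 : K) := by
      rw [inner_infChange_left, Matrix.conjTranspose_conjTranspose]
      have h2 := infChange_commutator X X.conjTranspose (sc b₀)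
      have h3 : infChange X.conjTranspose (infChange X (sc b₀)) = 0 := by
        rw [hX0]
        funext i
        simp [infChange]
      rw [h3, sub_zero] at h2
      rw [h2]
      refine htr _ ?_
      rw [Matrix.trace_sub, Matrix.trace_mul_comm, sub_self]
    have h2 := inner_self_eq_zero.mp h1
    funext i
    ext k j
    exact congrFun (congrArg WithLp.ofLp h2) (i, k, j)
  let D : g →ₗ[K] g := Matrix.toLin b₀ b₀ X.conjTranspose
  have hD : LinearMap.toMatrix b₀ b₀ D = X.conjTranspose := LinearMap.toMatrix_toLin _ _ _
  rw [← hD, infChange_sc_eq_zero_iff] at hX1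
  let D' : LieDerivation K g g :=
    { D with
      leibniz' := fun y z => by
        change D ⁅y, z⁆ = ⁅y, D z⁆ - ⁅z, D y⁆
        rw [hX1, ← lie_skew z, sub_neg_eq_add, add_comm] }
  obtain ⟨x', hx'⟩ := LieDerivation.IsKilling.exists_eq_ad D'
  refine ⟨x', ?_⟩
  rw [← hD]
  congr 1
  ext y
  have := congrArg (fun T : LieDerivation K g g => T y) hx'
  have h : ⁅x', y⁆ = D' y := by simpa using this
  exact h

/-- A Killing Lie algebra has a basis and a dual pair of families whose adjoint matrices are
conjugate transpose to each other. -/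
theorem exists_basis_isKillingDual [LieAlgebra.IsKilling K g] (b : Module.Basis (Fin m) K g) :
    ∃ (b₀ : Module.Basis (Fin m) K g) (n : ℕ) (e e' : Fin n → g), IsKillingDual K e e' ∧
      ∀ i, LinearMap.toMatrix b₀ b₀ (LieAlgebra.ad K g (e' i)) =
        (LinearMap.toMatrix b₀ b₀ (LieAlgebra.ad K g (e i))).conjTranspose := by
  have : FiniteDimensional K g := b.finiteDimensional_of_finite
  obtain ⟨b₀, hb₀⟩ := exists_basis_conjTranspose_ad b
  let J : g →ₗ[K] EuclideanSpace K (Fin m × Fin m) :=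
    { toFun := fun x => WithLp.toLp 2
        fun i => LinearMap.toMatrix b₀ b₀ (LieAlgebra.ad K g x) i.1 i.2
      map_add' := fun x y => by
        simp only [map_add]
        rfl
      map_smul' := fun t x => by
        simp only [map_smul]
        rfl }
  have hJ : ∀ x y, inner K (J x) (J y) =
      ((LinearMap.toMatrix b₀ b₀ (LieAlgebra.ad K g x)).conjTranspose *
        LinearMap.toMatrix b₀ b₀ (LieAlgebra.ad K g y)).trace := by
    intro x y
    simp only [J, PiLp.inner_apply, Fintype.sum_prod_type, Matrix.trace, Matrix.diag,
      Matrix.mul_apply, Matrix.conjTranspose_apply, LinearMap.coe_mk, AddHom.coe_mk,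
      RCLike.inner_apply]
    rw [Finset.sum_comm]
    refine Finset.sum_congr rfl fun j _ => Finset.sum_congr rfl fun k _ => ?_
    rw [mul_comm]
    rfl
  have hinj : Function.Injective J := by
    rw [← LinearMap.ker_eq_bot, LinearMap.ker_eq_bot']
    intro x hx
    have h1 : LinearMap.toMatrix b₀ b₀ (LieAlgebra.ad K g x) = 0 := by
      ext i j
      exact congrFun (congrArg WithLp.ofLp hx) (i, j)
    rw [LinearEquiv.map_eq_zero_iff] at h1
    refine (LieAlgebra.IsKilling.killingForm_nondegenerate K g).1 x fun y => ?_
    rw [killingForm_apply_apply, h1]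
    simp
  let Φ := LinearEquiv.ofInjective J hinj
  let B := stdOrthonormalBasis K (LinearMap.range J)
  choose star hstar using hb₀
  let e : Fin _ → g := fun i => Φ.symm (B i)
  have hJe : ∀ i, J (e i) = B i := fun i => congrArg Subtype.val (Φ.apply_symm_apply (B i))
  -- The Killing form twisted by `star` is the Hilbert–Schmidt product of adjoint matrices, so an
  -- orthonormal basis together with its image under `star` is a Killing-dual pair.
  have hκ : ∀ x y, killingForm K g (star x) y = inner K (J x) (J y) := by
    intro x y
    rw [hJ, ← hstar, ← LinearMap.toMatrix_comp b₀ b₀ b₀, ← LinearMap.trace_eq_matrix_trace,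
      killingForm_apply_apply]
  have hleft : ∀ x, ∑ i, killingForm K g (star (e i)) x • e i = x := by
    intro x
    apply hinj
    simp only [hκ, map_sum, map_smul, hJe]
    have h1 := congrArg Subtype.val (B.sum_repr (Φ x))
    simp only [B.repr_apply_apply, Submodule.coe_sum, Submodule.coe_smul, Submodule.coe_inner]
      at h1
    exact h1
  have hδ : ∀ i k, killingForm K g (star (e i)) (e k) = if i = k then 1 else 0 := by
    intro i k
    rw [hκ, hJe, hJe, ← Submodule.coe_inner]
    exact orthonormal_iff_ite.mp B.orthonormal i k
  refine ⟨b₀, _, e, fun i => star (e i), ⟨hleft, fun x => ?_⟩, fun i => hstar _⟩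
  rw [← sub_eq_zero]
  refine (LieAlgebra.IsKilling.killingForm_nondegenerate K g).1 _ fun y => ?_
  rw [← hleft y, map_sum]
  refine Finset.sum_eq_zero fun k _ => ?_
  rw [map_smul, map_sub, LinearMap.sub_apply, map_sum, LinearMap.sum_apply]
  simp only [map_smul, LinearMap.smul_apply, hδ]
  simp [LieModule.traceForm_comm K g g x]

end Star

/-! ### The Fischer product and the coefficient norm on polynomials -/

section Fischer

open MvPolynomial

variable {K : Type*} [RCLike K] {m : ℕ}

/-- The product of the factorials of the exponents. -/
def expFactorial (α : Fin m →₀ ℕ) : ℕ := ∏ i, (α i).factorial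

lemma expFactorial_pos (α : Fin m →₀ ℕ) : 0 < expFactorial α :=
  Finset.prod_pos fun _ _ => Nat.factorial_pos _

lemma expFactorial_add_single (α : Fin m →₀ ℕ) (k : Fin m) :
    expFactorial (α + Finsupp.single k 1) = (α k + 1) * expFactorial α := by
  simp only [expFactorial]
  rw [← Finset.mul_prod_erase _ _ (Finset.mem_univ k),
    ← Finset.mul_prod_erase _ (fun i => (α i).factorial) (Finset.mem_univ k), ← mul_assoc]
  congr 1
  · simp [Nat.factorial_succ]
  · refine Finset.prod_congr rfl fun i hi => ?_
    simp [(Finset.ne_of_mem_erase hi).symm]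

/-- The Fischer product of polynomials. -/
noncomputable def fischer (p q : MvPolynomial (Fin m) K) : K :=
  ∑ α ∈ p.support, expFactorial α * ((starRingEnd K) (p.coeff α) * q.coeff α)

lemma fischer_eq_sum {s : Finset (Fin m →₀ ℕ)} (p q : MvPolynomial (Fin m) K)
    (hs : p.support ⊆ s) :
    fischer p q = ∑ α ∈ s, expFactorial α * ((starRingEnd K) (p.coeff α) * q.coeff α) := by
  refine Finset.sum_subset hs fun α _ hα => ?_
  rw [MvPolynomial.notMem_support_iff.mp hα]
  simp

lemma fischer_conj (p q : MvPolynomial (Fin m) K) :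
    (starRingEnd K) (fischer p q) = fischer q p := by
  rw [fischer_eq_sum p q (Finset.subset_union_left (s₂ := q.support)),
    fischer_eq_sum q p (Finset.subset_union_right (s₁ := p.support)), map_sum]
  refine Finset.sum_congr rfl fun α _ => ?_
  simp only [map_mul, RCLike.conj_conj, map_natCast]
  ring

lemma fischer_add_left (p p' q : MvPolynomial (Fin m) K) :
    fischer (p + p') q = fischer p q + fischer p' q := by
  rw [fischer_eq_sum (p + p') q MvPolynomial.support_add,
    fischer_eq_sum p q (Finset.subset_union_left (s₂ := p'.support)),
    fischer_eq_sum p' q (Finset.subset_union_right (s₁ := p.support)), ← Finset.sum_add_distrib]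
  refine Finset.sum_congr rfl fun α _ => ?_
  simp only [coeff_add, map_add]
  ring

lemma fischer_monomial (α : Fin m →₀ ℕ) (c : K) (q : MvPolynomial (Fin m) K) :
    fischer (monomial α c) q = expFactorial α * ((starRingEnd K) c * q.coeff α) := by
  rw [fischer_eq_sum (s := {α}) _ _ MvPolynomial.support_monomial_subset]
  simp

/-- The factorial weights are chosen for this: the factor `α k + 1` gained by the weight is the one
produced by differentiation. -/
lemma fischer_X_mul (k : Fin m) (p q : MvPolynomial (Fin m) K) :
    fischer (X k * p) q = fischer p (pderiv k q) := by
  induction p using MvPolynomial.induction_on' with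
  | monomial α c =>
    rw [X, monomial_mul, one_mul, fischer_monomial, fischer_monomial, coeff_pderiv, add_comm _ α,
      expFactorial_add_single]
    push_cast
    ring
  | add p p' h h' => rw [mul_add, fischer_add_left, fischer_add_left, h, h']

lemma fischer_pderiv (k : Fin m) (p q : MvPolynomial (Fin m) K) :
    fischer (pderiv k p) q = fischer p (X k * q) := by
  rw [← fischer_conj, ← fischer_X_mul, fischer_conj]

lemma fischer_C_mul_left (c : K) (p q : MvPolynomial (Fin m) K) :
    fischer (C c * p) q = (starRingEnd K) c * fischer p q := by
  rw [fischer_eq_sum (s := p.support) (C c * p) q, fischer, Finset.mul_sum]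
  · refine Finset.sum_congr rfl fun α _ => ?_
    simp only [coeff_C_mul, map_mul]
    ring
  · intro α
    simp only [mem_support_iff, coeff_C_mul, ne_eq]
    exact fun h h' => h (by rw [h', mul_zero])

lemma fischer_C_mul_right (c : K) (p q : MvPolynomial (Fin m) K) :
    fischer p (C c * q) = c * fischer p q := by
  rw [← fischer_conj, fischer_C_mul_left, map_mul, fischer_conj, RCLike.conj_conj]

/-- The linear vector field with a given matrix. -/
noncomputable def linearField (M : Matrix (Fin m) (Fin m) K) :
    Derivation K (MvPolynomial (Fin m) K) (MvPolynomial (Fin m) K) :=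
  mkDerivation K fun j => ∑ k, C (M k j) * X k

lemma linearField_apply (M : Matrix (Fin m) (Fin m) K) (p : MvPolynomial (Fin m) K) :
    linearField M p = ∑ j, ∑ k, C (M k j) * (X k * pderiv j p) := by
  have hs : ∀ (D : Fin m → Derivation K (MvPolynomial (Fin m) K) (MvPolynomial (Fin m) K)) q,
      (∑ j, D j) q = ∑ j, D j q := fun D q => by
    rw [← Derivation.coeFnAddMonoidHom_apply, map_sum, Finset.sum_apply]
    rfl
  have h : linearField M = ∑ j, (∑ k, C (M k j) * X k : MvPolynomial (Fin m) K) • pderiv j := by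
    refine derivation_ext fun i => ?_
    rw [linearField, mkDerivation_X, hs]
    simp [pderiv_X, Pi.single_apply]
  rw [h, hs]
  simp only [Derivation.smul_apply, smul_eq_mul, Finset.sum_mul, mul_assoc]

/-- Adjointness of `X k` and `pderiv k` turns each term `X k * pderiv j` into `X j * pderiv k`, that
is, transposes the matrix. Thus adjointness of matrices passes to all symmetric powers at once. -/
lemma fischer_linearField (M : Matrix (Fin m) (Fin m) K) (p q : MvPolynomial (Fin m) K) :
    fischer (linearField M p) q = fischer p (linearField M.conjTranspose q) := by
  have hl : ∀ (s : Finset (Fin m)) (f : Fin m → MvPolynomial (Fin m) K) q,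
      fischer (∑ i ∈ s, f i) q = ∑ i ∈ s, fischer (f i) q := by
    intro s f q
    induction s using Finset.cons_induction with
    | empty => simp [fischer]
    | cons a s ha ih => rw [Finset.sum_cons, Finset.sum_cons, fischer_add_left, ih]
  have hr : ∀ (s : Finset (Fin m)) (f : Fin m → MvPolynomial (Fin m) K) p,
      fischer p (∑ i ∈ s, f i) = ∑ i ∈ s, fischer p (f i) := by
    intro s f p
    rw [← fischer_conj, hl, map_sum]
    simp only [fischer_conj]
  simp only [linearField_apply, hl, hr, fischer_C_mul_left, fischer_C_mul_right, fischer_X_mul,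
    fischer_pderiv, Matrix.conjTranspose_apply]
  exact Finset.sum_comm

lemma linearField_isHomogeneous (M : Matrix (Fin m) (Fin m) K) {p : MvPolynomial (Fin m) K} {n : ℕ}
    (hp : p.IsHomogeneous n) : (linearField M p).IsHomogeneous n := by
  rw [linearField_apply]
  refine IsHomogeneous.sum _ _ _ fun j _ => IsHomogeneous.sum _ _ _ fun k _ => ?_
  refine IsHomogeneous.C_mul ?_ _
  rcases Nat.eq_zero_or_pos n with rfl | hn
  · rw [← totalDegree_zero_iff_isHomogeneous, totalDegree_eq_zero_iff_eq_C] at hp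
    rw [hp, pderiv_C, mul_zero]
    exact isHomogeneous_zero _ _ _
  · have := (isHomogeneous_X K k).mul (hp.pderiv (i := j))
    rwa [add_comm, Nat.sub_add_cancel hn] at this

/-- The sum of the norms of the coefficients. -/
noncomputable def coeffNorm {σ : Type*} (p : MvPolynomial σ K) : ℝ :=
  ∑ α ∈ p.support, ‖p.coeff α‖

section CoeffNorm

variable {σ : Type*}

lemma coeffNorm_nonneg (p : MvPolynomial σ K) : 0 ≤ coeffNorm p :=
  Finset.sum_nonneg fun _ _ => norm_nonneg _

lemma coeffNorm_eq_sum {s : Finset (σ →₀ ℕ)} (p : MvPolynomial σ K)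
    (hs : p.support ⊆ s) : coeffNorm p = ∑ α ∈ s, ‖p.coeff α‖ := by
  refine Finset.sum_subset hs fun α _ hα => ?_
  rw [MvPolynomial.notMem_support_iff.mp hα, norm_zero]

lemma norm_coeff_le_coeffNorm (p : MvPolynomial σ K) (α : σ →₀ ℕ) :
    ‖p.coeff α‖ ≤ coeffNorm p := by
  by_cases h : α ∈ p.support
  · exact Finset.single_le_sum (f := fun α => ‖p.coeff α‖) (fun _ _ => norm_nonneg _) h
  · rw [MvPolynomial.notMem_support_iff.mp h, norm_zero]
    exact coeffNorm_nonneg p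

lemma coeffNorm_add_le (p q : MvPolynomial σ K) :
    coeffNorm (p + q) ≤ coeffNorm p + coeffNorm q := by
  classical
  rw [coeffNorm_eq_sum (p + q) MvPolynomial.support_add,
    coeffNorm_eq_sum p (Finset.subset_union_left (s₂ := q.support)),
    coeffNorm_eq_sum q (Finset.subset_union_right (s₁ := p.support)), ← Finset.sum_add_distrib]
  exact Finset.sum_le_sum fun α _ => by rw [coeff_add]; exact norm_add_le _ _

lemma coeffNorm_zero : coeffNorm (0 : MvPolynomial σ K) = 0 := by simp [coeffNorm]

lemma coeffNorm_sum_le {ι : Type*} (s : Finset ι) (f : ι → MvPolynomial σ K) :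
    coeffNorm (∑ i ∈ s, f i) ≤ ∑ i ∈ s, coeffNorm (f i) := by
  induction s using Finset.cons_induction with
  | empty => simp [coeffNorm_zero]
  | cons a s ha ih =>
    rw [Finset.sum_cons, Finset.sum_cons]
    exact (coeffNorm_add_le _ _).trans (by gcongr)

lemma coeffNorm_monomial (α : σ →₀ ℕ) (c : K) : coeffNorm (monomial α c) = ‖c‖ := by
  classical
  rw [coeffNorm_eq_sum (s := {α}) _ MvPolynomial.support_monomial_subset, Finset.sum_singleton,
    coeff_monomial, if_pos rfl]

lemma coeffNorm_mul_le (p q : MvPolynomial σ K) :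
    coeffNorm (p * q) ≤ coeffNorm p * coeffNorm q := by
  have h : p * q = ∑ α ∈ p.support, ∑ β ∈ q.support, monomial (α + β) (p.coeff α * q.coeff β) := by
    conv_lhs => rw [p.as_sum, q.as_sum]
    rw [Finset.sum_mul_sum]
    simp only [monomial_mul]
  rw [h]
  refine (coeffNorm_sum_le _ _).trans ?_
  rw [coeffNorm, coeffNorm, Finset.sum_mul_sum]
  refine Finset.sum_le_sum fun α _ => (coeffNorm_sum_le _ _).trans ?_
  refine Finset.sum_le_sum fun β _ => ?_
  rw [coeffNorm_monomial, norm_mul]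

lemma coeffNorm_C_mul_le (c : K) (p : MvPolynomial σ K) :
    coeffNorm (C c * p) ≤ ‖c‖ * coeffNorm p :=
  (coeffNorm_mul_le _ _).trans (by rw [C_apply, coeffNorm_monomial])

lemma coeffNorm_smul_le (c : K) (p : MvPolynomial σ K) :
    coeffNorm (c • p) ≤ ‖c‖ * coeffNorm p := by
  rw [smul_eq_C_mul]
  exact coeffNorm_C_mul_le c p

lemma coeffNorm_one : coeffNorm (1 : MvPolynomial σ K) = 1 := by
  rw [← C_1, C_apply, coeffNorm_monomial, norm_one]

/-- Submultiplicativity of the norm. With linear forms for `φ` it says that a change of basis of g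
costs only a geometric factor. -/
lemma coeffNorm_aeval_le {τ : Type*} (φ : σ → MvPolynomial τ K) {T : ℝ} (hT : ∀ i, coeffNorm (φ i) ≤ T)
    (hT0 : 0 ≤ T) {n : ℕ} {p : MvPolynomial σ K} (hp : p.IsHomogeneous n) :
    coeffNorm (aeval φ p) ≤ T ^ n * coeffNorm p := by
  have hpow : ∀ (q : MvPolynomial τ K) k, coeffNorm (q ^ k) ≤ coeffNorm q ^ k := by
    intro q k
    induction k with
    | zero => rw [pow_zero, pow_zero, coeffNorm_one]
    | succ k ih =>
      rw [pow_succ, pow_succ]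
      exact (coeffNorm_mul_le _ _).trans
        (mul_le_mul_of_nonneg_right ih (coeffNorm_nonneg _))
  have hprod : ∀ (s : Finset σ) (f : σ → ℕ), coeffNorm (∏ i ∈ s, φ i ^ f i) ≤
      T ^ ∑ i ∈ s, f i := by
    intro s f
    induction s using Finset.cons_induction with
    | empty => simp [coeffNorm_one]
    | cons a s ha ih =>
      rw [Finset.prod_cons, Finset.sum_cons, pow_add]
      refine (coeffNorm_mul_le _ _).trans (mul_le_mul ?_ ih (coeffNorm_nonneg _) (by positivity))
      exact (hpow _ _).trans (pow_le_pow_left₀ (coeffNorm_nonneg _) (hT a) _)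
  conv_lhs => rw [p.as_sum]
  rw [map_sum, show coeffNorm p = ∑ α ∈ p.support, ‖p.coeff α‖ from rfl, Finset.mul_sum]
  refine (coeffNorm_sum_le _ _).trans (Finset.sum_le_sum fun α hα => ?_)
  rw [aeval_monomial, algebraMap_eq]
  refine (coeffNorm_C_mul_le _ _).trans ?_
  rw [mul_comm (T ^ n)]
  refine mul_le_mul_of_nonneg_left ((hprod _ _).trans_eq ?_) (norm_nonneg _)
  congr 1
  have := hp (mem_support_iff.mp hα)
  rw [← this]
  simp [Finsupp.weight_apply, Finsupp.sum]

end CoeffNorm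

/-- The exponents of degree `n`. -/
abbrev DegIdx (m n : ℕ) : Type := {α : Fin m →₀ ℕ // α ∈ Finset.finsuppAntidiag Finset.univ n}

lemma mem_degIdx_iff {n : ℕ} (α : Fin m →₀ ℕ) :
    α ∈ Finset.finsuppAntidiag Finset.univ n ↔ ∑ i, α i = n := by
  simp [Finset.mem_finsuppAntidiag]

lemma support_subset_of_isHomogeneous {n : ℕ} {p : MvPolynomial (Fin m) K}
    (hp : p.IsHomogeneous n) : p.support ⊆ Finset.finsuppAntidiag Finset.univ n := by
  intro α hα
  rw [mem_degIdx_iff, ← hp (mem_support_iff.mp hα)]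
  simp [Finsupp.weight_apply, Finsupp.sum_fintype]

lemma sum_inv_expFactorial (n : ℕ) :
    ∑ α ∈ Finset.finsuppAntidiag (Finset.univ : Finset (Fin m)) n, (1 / expFactorial α : ℝ) =
      (m : ℝ) ^ n / n.factorial := by
  have h := Finset.sum_pow_eq_sum_piAntidiag (R := ℝ) (Finset.univ : Finset (Fin m))
    (fun _ => 1) n
  simp only [Finset.sum_const, Finset.card_univ, Fintype.card_fin, nsmul_eq_mul, mul_one, one_pow,
    Finset.prod_const_one] at h
  rw [h, Finset.sum_div]
  refine Finset.sum_bij (fun α _ => ⇑α) ?_ ?_ ?_ ?_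
  · intro α hα
    rw [mem_degIdx_iff] at hα
    simp [hα]
  · intro α _ β _ hαβ
    exact DFunLike.coe_injective hαβ
  · intro f hf
    refine ⟨Finsupp.equivFunOnFinite.symm f, ?_, by simp⟩
    rw [mem_degIdx_iff]
    simpa using hf
  · intro α hα
    rw [mem_degIdx_iff] at hα
    have h1 := Nat.multinomial_spec Finset.univ (fun i => α i)
    rw [hα] at h1
    have h2 : (expFactorial α : ℝ) * Nat.multinomial Finset.univ α = n.factorial := by
      exact_mod_cast h1
    have h3 : (expFactorial α : ℝ) ≠ 0 := by exact_mod_cast (expFactorial_pos α).ne'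
    have h4 : (n.factorial : ℝ) ≠ 0 := by exact_mod_cast n.factorial_ne_zero
    field_simp
    linarith

lemma expFactorial_le {n : ℕ} {α : Fin m →₀ ℕ} (hα : ∑ i, α i = n) :
    expFactorial α ≤ n.factorial :=
  Nat.le_of_dvd n.factorial_pos (hα ▸ Nat.prod_factorial_dvd_factorial_sum _ _)

/-- Coordinates of homogeneous polynomials in an orthonormal basis for the Fischer product. -/
noncomputable def fischerVec (n : ℕ) : MvPolynomial (Fin m) K →ₗ[K] EuclideanSpace K (DegIdx m n) where
  toFun p := WithLp.toLp 2 fun α => (Real.sqrt (expFactorial α.1) : K) * p.coeff α.1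
  map_add' p q := by
    ext α
    simp [mul_add]
  map_smul' c p := by
    ext α
    simp [mul_left_comm]

/-- The homogeneous polynomial with given Fischer coordinates. -/
noncomputable def ofFischerVec (n : ℕ) : EuclideanSpace K (DegIdx m n) →ₗ[K] MvPolynomial (Fin m) K where
  toFun v := ∑ α, monomial α.1 ((Real.sqrt (expFactorial α.1) : K)⁻¹ * v α)
  map_add' v w := by
    simp [mul_add, Finset.sum_add_distrib]
  map_smul' c v := by
    simp only [Finset.smul_sum, smul_monomial, PiLp.smul_apply, smul_eq_mul, RingHom.id_apply,
      mul_left_comm]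

lemma sqrt_expFactorial_ne_zero (α : Fin m →₀ ℕ) : (Real.sqrt (expFactorial α) : K) ≠ 0 := by
  rw [RCLike.ofReal_ne_zero]
  exact (Real.sqrt_pos.mpr (by exact_mod_cast expFactorial_pos α)).ne'

lemma ofFischerVec_isHomogeneous {n : ℕ} (v : EuclideanSpace K (DegIdx m n)) :
    (ofFischerVec n v).IsHomogeneous n := by
  refine IsHomogeneous.sum _ _ _ fun α _ => isHomogeneous_monomial _ ?_
  have := (mem_degIdx_iff α.1).mp α.2
  rw [Finsupp.degree_eq_sum]
  exact this

lemma fischerVec_ofFischerVec {n : ℕ} (v : EuclideanSpace K (DegIdx m n)) :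
    fischerVec n (ofFischerVec n v) = v := by
  ext α
  simp only [fischerVec, ofFischerVec, LinearMap.coe_mk, AddHom.coe_mk, coeff_sum, coeff_monomial]
  rw [Finset.sum_eq_single α]
  · rw [if_pos rfl, ← mul_assoc, mul_inv_cancel₀ (sqrt_expFactorial_ne_zero _), one_mul]
  · intro β _ hβ
    rw [if_neg fun h => hβ (Subtype.ext h)]
  · simp

lemma ofFischerVec_fischerVec {n : ℕ} {p : MvPolynomial (Fin m) K} (hp : p.IsHomogeneous n) :
    ofFischerVec n (fischerVec n p) = p := by
  conv_rhs => rw [p.as_sum, Finset.sum_subset (support_subset_of_isHomogeneous hp)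
    (fun α _ hα => by rw [MvPolynomial.notMem_support_iff.mp hα, monomial_zero])]
  rw [← Finset.sum_coe_sort]
  simp only [fischerVec, ofFischerVec, LinearMap.coe_mk, AddHom.coe_mk]
  refine Finset.sum_congr rfl fun α _ => ?_
  rw [← mul_assoc, inv_mul_cancel₀ (sqrt_expFactorial_ne_zero _), one_mul]

lemma inner_fischerVec {n : ℕ} {p : MvPolynomial (Fin m) K} (hp : p.IsHomogeneous n)
    (q : MvPolynomial (Fin m) K) : inner K (fischerVec n p) (fischerVec n q) = fischer p q := by
  rw [fischer_eq_sum p q (support_subset_of_isHomogeneous hp), ← Finset.sum_coe_sort]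
  simp only [PiLp.inner_apply, fischerVec, LinearMap.coe_mk, AddHom.coe_mk, RCLike.inner_apply,
    map_mul, RCLike.conj_ofReal]
  refine Finset.sum_congr rfl fun α _ => ?_
  have : ((expFactorial α.1 : ℕ) : K) = (Real.sqrt (expFactorial α.1) : K) *
      (Real.sqrt (expFactorial α.1) : K) := by
    rw [← RCLike.ofReal_mul, Real.mul_self_sqrt (by positivity), RCLike.ofReal_natCast]
  rw [this]
  ring

lemma norm_fischerVec_sq (n : ℕ) (p : MvPolynomial (Fin m) K) :
    ‖fischerVec n p‖ ^ 2 = ∑ α ∈ Finset.finsuppAntidiag (Finset.univ : Finset (Fin m)) n,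
      ‖(Real.sqrt (expFactorial α) : K) * p.coeff α‖ ^ 2 := by
  rw [EuclideanSpace.norm_sq_eq]
  exact Finset.sum_coe_sort (Finset.finsuppAntidiag (Finset.univ : Finset (Fin m)) n)
    (fun α => ‖(Real.sqrt (expFactorial α) : K) * p.coeff α‖ ^ 2)

/-- Cauchy–Schwarz with the Fischer weights, whose inverses sum to `m ^ n / n!` by the multinomial
theorem. The `n!` cancels against the one in the reverse estimate `norm_fischerVec_sq_le`, so that
comparing the two norms loses only a geometric factor. -/
lemma coeffNorm_sq_le {n : ℕ} {p : MvPolynomial (Fin m) K} (hp : p.IsHomogeneous n) :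
    coeffNorm p ^ 2 ≤ (m : ℝ) ^ n / n.factorial * ‖fischerVec n p‖ ^ 2 := by
  rw [coeffNorm_eq_sum p (support_subset_of_isHomogeneous hp), ← sum_inv_expFactorial,
    norm_fischerVec_sq]
  have h := Finset.sum_mul_sq_le_sq_mul_sq
    (Finset.finsuppAntidiag (Finset.univ : Finset (Fin m)) n)
    (fun α => (Real.sqrt (expFactorial α))⁻¹)
    (fun α => ‖(Real.sqrt (expFactorial α) : K) * p.coeff α‖)
  have h1 : ∀ α : Fin m →₀ ℕ, (Real.sqrt (expFactorial α))⁻¹ *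
      ‖(Real.sqrt (expFactorial α) : K) * p.coeff α‖ = ‖p.coeff α‖ := by
    intro α
    have : 0 < Real.sqrt (expFactorial α) :=
      Real.sqrt_pos.mpr (by exact_mod_cast expFactorial_pos α)
    rw [norm_mul, RCLike.norm_ofReal, abs_of_pos this, ← mul_assoc, inv_mul_cancel₀ this.ne',
      one_mul]
  have h2 : ∀ α : Fin m →₀ ℕ, (Real.sqrt (expFactorial α))⁻¹ ^ 2 = 1 / (expFactorial α : ℝ) := by
    intro α
    rw [inv_pow, Real.sq_sqrt (by positivity), one_div]
  simp only [h1, h2] at h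
  exact h

lemma norm_fischerVec_sq_le {n : ℕ} {p : MvPolynomial (Fin m) K} (hp : p.IsHomogeneous n) :
    ‖fischerVec n p‖ ^ 2 ≤ n.factorial * coeffNorm p ^ 2 := by
  rw [norm_fischerVec_sq, coeffNorm_eq_sum p (support_subset_of_isHomogeneous hp)]
  have h1 : ∀ α ∈ Finset.finsuppAntidiag (Finset.univ : Finset (Fin m)) n,
      ‖(Real.sqrt (expFactorial α) : K) * p.coeff α‖ ^ 2 ≤ n.factorial * ‖p.coeff α‖ ^ 2 := by
    intro α hα
    rw [norm_mul, mul_pow, RCLike.norm_ofReal, sq_abs, Real.sq_sqrt (by positivity)]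
    gcongr
    exact expFactorial_le ((mem_degIdx_iff α).mp hα)
  refine (Finset.sum_le_sum h1).trans ?_
  rw [← Finset.mul_sum]
  gcongr
  exact Finset.sum_sq_le_sq_sum_of_nonneg fun _ _ => norm_nonneg _

end Fischer

/-! ### Polynomial cocycles of the coadjoint action -/

section Coadjoint

open MvPolynomial

variable {K g : Type*} [RCLike K] [LieRing g] [LieAlgebra K g] {m : ℕ}

/-- The linear form on the dual of `g` defined by an element of `g`. -/
noncomputable def linForm (b : Module.Basis (Fin m) K g) : g →ₗ[K] MvPolynomial (Fin m) K :=
  b.constr K X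

lemma linForm_basis (b : Module.Basis (Fin m) K g) (j : Fin m) : linForm b (b j) = X j := by
  simp [linForm]

lemma linForm_apply (b : Module.Basis (Fin m) K g) (x : g) :
    linForm b x = ∑ k, C (b.repr x k) * X k := by
  simp [linForm, Module.Basis.constr_apply_fintype, smul_eq_C_mul]

/-- The action of `g` on polynomial functions on its dual. -/
noncomputable def coadj (b : Module.Basis (Fin m) K g) (x : g) :
    Derivation K (MvPolynomial (Fin m) K) (MvPolynomial (Fin m) K) :=
  linearField (LinearMap.toMatrix b b (LieAlgebra.ad K g x))

lemma coadj_X (b : Module.Basis (Fin m) K g) (x : g) (j : Fin m) :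
    coadj b x (X j) = linForm b ⁅x, b j⁆ := by
  rw [coadj, linearField, mkDerivation_X, linForm_apply]
  simp [LinearMap.toMatrix_apply]

lemma coadj_linForm (b : Module.Basis (Fin m) K g) (x y : g) :
    coadj b x (linForm b y) = linForm b ⁅x, y⁆ := by
  have h : (coadj b x).toLinearMap ∘ₗ linForm b = linForm b ∘ₗ LieAlgebra.ad K g x := by
    refine b.ext fun j => ?_
    simp only [LinearMap.comp_apply, linForm_basis, LieAlgebra.ad_apply]
    exact coadj_X b x j
  exact LinearMap.congr_fun h y

lemma coadj_lie (b : Module.Basis (Fin m) K g) (x y : g) (p : MvPolynomial (Fin m) K) :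
    coadj b ⁅x, y⁆ p = coadj b x (coadj b y p) - coadj b y (coadj b x p) := by
  have h : coadj b ⁅x, y⁆ = ⁅coadj b x, coadj b y⁆ := by
    refine derivation_ext fun j => ?_
    rw [Derivation.commutator_apply, coadj_X, coadj_X, coadj_X, coadj_linForm, coadj_linForm,
      lie_lie, map_sub]
  rw [h, Derivation.commutator_apply]

/-- The coadjoint action as a linear map. -/
noncomputable def coadjₗ (b : Module.Basis (Fin m) K g) :
    g →ₗ[K] MvPolynomial (Fin m) K →ₗ[K] MvPolynomial (Fin m) K where
  toFun x := (coadj b x).toLinearMap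
  map_add' x y := by
    refine LinearMap.ext fun p => ?_
    simp [coadj, linearField_apply, map_add, add_mul, Finset.sum_add_distrib]
  map_smul' c x := by
    refine LinearMap.ext fun p => ?_
    simp [coadj, linearField_apply, map_smul, Finset.smul_sum, smul_eq_C_mul, mul_assoc]

/-- The coadjoint fields are linear with matrix `ad x`, so `hstar` makes `e i` and `e' i` adjoint
for the Fischer product in every degree. `exists_primitive_norm_le` then applies with a constant
independent of `n`. -/
lemma exists_homogeneous_primitive_of_conjTranspose [LieAlgebra.IsKilling K g]
    (b : Module.Basis (Fin m) K g) {ι : Type*} [Fintype ι] {e e' : ι → g}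
    (he : IsKillingDual K e e')
    (hstar : ∀ i, LinearMap.toMatrix b b (LieAlgebra.ad K g (e' i)) =
        (LinearMap.toMatrix b b (LieAlgebra.ad K g (e i))).conjTranspose) :
    ∃ c : ℝ, 0 ≤ c ∧ ∀ n (f : g →ₗ[K] MvPolynomial (Fin m) K), (∀ x, (f x).IsHomogeneous n) →
      (∀ x y, f ⁅x, y⁆ = coadj b x (f y) - coadj b y (f x)) →
      ∃ h : MvPolynomial (Fin m) K, h.IsHomogeneous n ∧ (∀ x, coadj b x h = f x) ∧
        coeffNorm h ≤ c ^ (n + 1) * ∑ j, coeffNorm (f (b j)) := by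
  have : FiniteDimensional K g := b.finiteDimensional_of_finite
  set F : ℝ := ∑ i, ∑ j, ‖b.repr (e i) j‖ with hF
  have hF0 : 0 ≤ F := by positivity
  set B : ℝ := gapConst K e e' * (Fintype.card ι * F ^ 2) with hB
  have hB0 : 0 ≤ B := mul_nonneg gapConst_nonneg (by positivity)
  -- The estimate obtained is `(coeffNorm h)² ≤ m ^ n * B * S²`; this base dominates both `m` and
  -- `B` and is at least 1, so the square root may be dropped.
  refine ⟨1 + m + B, by positivity, fun n f hf hcoc => ?_⟩
  let ρ : g →ₗ[K] EuclideanSpace K (DegIdx m n) →ₗ[K] EuclideanSpace K (DegIdx m n) :=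
    ((coadjₗ b).compr₂ (fischerVec n)).compl₂ (ofFischerVec n)
  have hρa : ∀ x v, ρ x v = fischerVec n (coadj b x (ofFischerVec n v)) := fun x v => rfl
  have hhom : ∀ x v, (coadj b x (ofFischerVec n v)).IsHomogeneous n := fun x v =>
    linearField_isHomogeneous _ (ofFischerVec_isHomogeneous v)
  obtain ⟨v, hv, hvn⟩ := exists_primitive_norm_le he ρ
    (fun x y v => by
      simp only [hρa, ofFischerVec_fischerVec (hhom _ _), coadj_lie, map_sub])
    (fun i v w => by
      have h1 := inner_fischerVec (hhom (e i) v) (ofFischerVec n w)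
      have h2 := inner_fischerVec (ofFischerVec_isHomogeneous v) (coadj b (e' i) (ofFischerVec n w))
      rw [fischerVec_ofFischerVec] at h1 h2
      rw [hρa, hρa, h1, h2, coadj, fischer_linearField, coadj, hstar])
    ((fischerVec n).comp f)
    (fun x y => by
      simp only [hρa, LinearMap.comp_apply, ofFischerVec_fischerVec (hf _), hcoc, map_sub])
  refine ⟨ofFischerVec n v, ofFischerVec_isHomogeneous v, fun x => ?_, ?_⟩
  · have h1 := congrArg (ofFischerVec n) (hv x)
    rwa [hρa, ofFischerVec_fischerVec (hhom x v), LinearMap.comp_apply,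
      ofFischerVec_fischerVec (hf x)] at h1
  · set S := ∑ j, coeffNorm (f (b j)) with hS
    have hS0 : 0 ≤ S := Finset.sum_nonneg fun _ _ => coeffNorm_nonneg _
    have h1 : ∀ i, coeffNorm (f (e i)) ≤ F * S := by
      intro i
      conv_lhs => rw [← b.sum_repr (e i)]
      simp only [map_sum, map_smul]
      refine (coeffNorm_sum_le _ _).trans ?_
      have h2 : ∀ j, ‖b.repr (e i) j‖ ≤ F := fun j =>
        (Finset.single_le_sum (f := fun j => ‖b.repr (e i) j‖) (fun _ _ => norm_nonneg _)
          (Finset.mem_univ j)).trans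
          (Finset.single_le_sum (f := fun i => ∑ j, ‖b.repr (e i) j‖) (fun _ _ => by positivity)
            (Finset.mem_univ i))
      rw [hS, Finset.mul_sum]
      refine Finset.sum_le_sum fun j _ => (coeffNorm_smul_le _ _).trans ?_
      exact mul_le_mul_of_nonneg_right (h2 j) (coeffNorm_nonneg _)
    have h2 : ∑ i, ‖(fischerVec n ∘ₗ f) (e i)‖ ^ 2 ≤
        Fintype.card ι * (n.factorial * (F * S) ^ 2) := by
      have : ∀ i, ‖(fischerVec n ∘ₗ f) (e i)‖ ^ 2 ≤ n.factorial * (F * S) ^ 2 := fun i => by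
        refine (norm_fischerVec_sq_le (hf (e i))).trans ?_
        gcongr
        · exact coeffNorm_nonneg _
        · exact h1 i
      refine (Finset.sum_le_sum fun i _ => this i).trans ?_
      simp
    have h3 : coeffNorm (ofFischerVec n v) ^ 2 ≤ (m : ℝ) ^ n * B * S ^ 2 := by
      refine (coeffNorm_sq_le (ofFischerVec_isHomogeneous v)).trans ?_
      rw [fischerVec_ofFischerVec]
      have h4 : ‖v‖ ^ 2 ≤ gapConst K e e' * (Fintype.card ι * (n.factorial * (F * S) ^ 2)) :=
        hvn.trans (mul_le_mul_of_nonneg_left h2 gapConst_nonneg)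
      refine (mul_le_mul_of_nonneg_left h4 (by positivity)).trans_eq ?_
      have : (n.factorial : ℝ) ≠ 0 := by exact_mod_cast n.factorial_ne_zero
      rw [hB]
      field_simp
    set c : ℝ := 1 + m + B with hc
    have hm0 : (0 : ℝ) ≤ m := Nat.cast_nonneg m
    have hc1 : 1 ≤ c := by rw [hc]; linarith
    have h5 : (m : ℝ) ^ n * B ≤ c ^ (n + 1) := by
      rw [pow_succ]
      refine mul_le_mul (pow_le_pow_left₀ hm0 ?_ n) ?_ hB0 (by positivity)
      · rw [hc]; linarith
      · rw [hc]; linarith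
    have h6 : (1 : ℝ) ≤ c ^ (n + 1) := one_le_pow₀ hc1
    refine le_of_sq_le_sq ?_ (by positivity)
    refine h3.trans ?_
    rw [mul_pow]
    refine mul_le_mul_of_nonneg_right ?_ (by positivity)
    nlinarith

/-- Bookkeeping for a change of basis: each factor is replaced by an `(n+1)`-st power, after adding
1 to its base where the exponent differs. -/
lemma le_geometric {T c T' F S N : ℝ} {n : ℕ} (hT : 0 ≤ T) (hc : 0 ≤ c) (hT' : 0 ≤ T') (hF : 0 ≤ F)
    (hS : 0 ≤ S) (h : N ≤ T ^ n * (c ^ (n + 1) * (T' ^ n * (F * S)))) :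
    N ≤ ((1 + T) * c * (1 + T') * (1 + F)) ^ (n + 1) * S := by
  have h3 : ∀ t : ℝ, 0 ≤ t → t ^ n ≤ (1 + t) ^ (n + 1) := fun t ht =>
    (pow_le_pow_left₀ ht (by linarith) n).trans
      (pow_le_pow_right₀ (by linarith) (Nat.le_succ n))
  have h4 : F ≤ (1 + F) ^ (n + 1) :=
    (by linarith : F ≤ 1 + F).trans (le_self_pow₀ (by linarith) (Nat.succ_ne_zero n))
  have h5 := h3 T hT
  have h6 := h3 T' hT'
  calc N ≤ (T ^ n * c ^ (n + 1) * T' ^ n * F) * S := h.trans_eq (by ring)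
    _ ≤ ((1 + T) ^ (n + 1) * c ^ (n + 1) * (1 + T') ^ (n + 1) * (1 + F) ^ (n + 1)) * S := by
      gcongr
    _ = _ := by rw [mul_pow, mul_pow, mul_pow]

/-- Homogeneous polynomial cocycles of a Killing Lie algebra have homogeneous primitives, with
geometric control of the coefficients. -/
theorem exists_homogeneous_primitive [LieAlgebra.IsKilling K g] (b : Module.Basis (Fin m) K g) :
    ∃ c : ℝ, 0 ≤ c ∧ ∀ n (f : g →ₗ[K] MvPolynomial (Fin m) K), (∀ x, (f x).IsHomogeneous n) →
      (∀ x y, f ⁅x, y⁆ = coadj b x (f y) - coadj b y (f x)) →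
      ∃ h : MvPolynomial (Fin m) K, h.IsHomogeneous n ∧ (∀ x, coadj b x h = f x) ∧
        coeffNorm h ≤ c ^ (n + 1) * ∑ j, coeffNorm (f (b j)) := by
  obtain ⟨b₀, d, e, e', he, hstar⟩ := exists_basis_isKillingDual b
  obtain ⟨c₀, hc₀, H⟩ := exists_homogeneous_primitive_of_conjTranspose b₀ he hstar
  have hhom : ∀ (b b' : Module.Basis (Fin m) K g) j, (linForm b (b' j)).IsHomogeneous 1 := by
    intro b b' j
    rw [linForm_apply]
    exact IsHomogeneous.sum _ _ _ fun k _ => (isHomogeneous_X K k).C_mul _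
  have hφl : ∀ (b b' : Module.Basis (Fin m) K g) x,
      aeval (fun j => linForm b (b' j)) (linForm b' x) = linForm b x := by
    intro b b' x
    have : (aeval (fun j => linForm b (b' j))).toLinearMap ∘ₗ linForm b' = linForm b :=
      b'.ext fun j => by simp [linForm_basis]
    exact LinearMap.congr_fun this x
  have hφφ : ∀ (b b' : Module.Basis (Fin m) K g) p,
      aeval (fun j => linForm b (b' j)) (aeval (fun j => linForm b' (b j)) p) = p := by
    intro b b' p
    have : (aeval (fun j => linForm b (b' j))).comp (aeval (fun j => linForm b' (b j))) =
        AlgHom.id K (MvPolynomial (Fin m) K) := by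
      refine algHom_ext fun j => ?_
      rw [AlgHom.comp_apply, aeval_X, hφl, linForm_basis, AlgHom.id_apply]
    exact DFunLike.congr_fun this p
  -- Substituting linear forms is the change of coordinates on the dual of g and intertwines the two
  -- coordinate forms of the action. The cocycle is carried to `b₀`, solved there, and the primitive
  -- is carried back.
  have hφc : ∀ (b b' : Module.Basis (Fin m) K g) x p,
      aeval (fun j => linForm b (b' j)) (coadj b' x p) =
        coadj b x (aeval (fun j => linForm b (b' j)) p) := by
    intro b b' x p
    induction p using MvPolynomial.induction_on with
    | C a => simp [← algebraMap_eq]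
    | add p q hp hq => simp only [map_add, hp, hq]
    | mul_X p j hp =>
      simp only [Derivation.leibniz, map_add, map_mul, smul_eq_mul, hp, aeval_X, coadj_X, hφl,
        coadj_linForm]
  set T : ℝ := ∑ j, coeffNorm (linForm b (b₀ j)) with hT
  set T' : ℝ := ∑ j, coeffNorm (linForm b₀ (b j)) with hT'
  have hT0 : 0 ≤ T := Finset.sum_nonneg fun _ _ => coeffNorm_nonneg _
  have hT0' : 0 ≤ T' := Finset.sum_nonneg fun _ _ => coeffNorm_nonneg _
  have hTj : ∀ j, coeffNorm (linForm b (b₀ j)) ≤ T := fun j =>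
    Finset.single_le_sum (f := fun j => coeffNorm (linForm b (b₀ j)))
      (fun _ _ => coeffNorm_nonneg _) (Finset.mem_univ j)
  have hTj' : ∀ j, coeffNorm (linForm b₀ (b j)) ≤ T' := fun j =>
    Finset.single_le_sum (f := fun j => coeffNorm (linForm b₀ (b j)))
      (fun _ _ => coeffNorm_nonneg _) (Finset.mem_univ j)
  set F : ℝ := ∑ j, ∑ i, ‖b.repr (b₀ j) i‖ with hF
  have hF0 : 0 ≤ F := by positivity
  refine ⟨(1 + T) * c₀ * (1 + T') * (1 + F), by positivity, fun n f hf hcoc => ?_⟩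
  set S := ∑ j, coeffNorm (f (b j)) with hS
  have hS0 : 0 ≤ S := Finset.sum_nonneg fun _ _ => coeffNorm_nonneg _
  obtain ⟨h, hh, hsol, hn⟩ := H n ((aeval (fun j => linForm b₀ (b j))).toLinearMap ∘ₗ f)
    (fun x => by
      have := IsHomogeneous.aeval (hf x) (fun j => linForm b₀ (b j)) (fun j => hhom b₀ b j)
      rwa [one_mul] at this)
    (fun x y => by
      simp only [LinearMap.comp_apply, AlgHom.toLinearMap_apply, hcoc, map_sub, hφc])
  refine ⟨aeval (fun j => linForm b (b₀ j)) h, ?_, fun x => ?_, ?_⟩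
  · have := IsHomogeneous.aeval hh (fun j => linForm b (b₀ j)) (fun j => hhom b b₀ j)
    rwa [one_mul] at this
  · rw [← hφc, hsol, LinearMap.comp_apply, AlgHom.toLinearMap_apply, hφφ]
  · have h1 : ∀ j, coeffNorm (((aeval (fun j => linForm b₀ (b j))).toLinearMap ∘ₗ f) (b₀ j)) ≤
        T' ^ n * ((∑ i, ‖b.repr (b₀ j) i‖) * S) := by
      intro j
      refine (coeffNorm_aeval_le _ hTj' hT0' (hf (b₀ j))).trans ?_
      refine mul_le_mul_of_nonneg_left ?_ (pow_nonneg hT0' n)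
      conv_lhs => rw [← b.sum_repr (b₀ j)]
      simp only [map_sum, map_smul]
      refine (coeffNorm_sum_le _ _).trans ?_
      rw [Finset.sum_mul]
      refine Finset.sum_le_sum fun i _ => (coeffNorm_smul_le _ _).trans ?_
      refine mul_le_mul_of_nonneg_left ?_ (norm_nonneg _)
      exact Finset.single_le_sum (f := fun j => coeffNorm (f (b j)))
        (fun _ _ => coeffNorm_nonneg _) (Finset.mem_univ i)
    have h2 : ∑ j, coeffNorm (((aeval (fun j => linForm b₀ (b j))).toLinearMap ∘ₗ f) (b₀ j)) ≤
        T' ^ n * (F * S) := by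
      refine (Finset.sum_le_sum fun j _ => h1 j).trans_eq ?_
      rw [← Finset.mul_sum, hF, Finset.sum_mul]
    refine le_geometric hT0 hc₀ hT0' hF0 hS0 ((coeffNorm_aeval_le _ hTj hT0 hh).trans ?_)
    refine mul_le_mul_of_nonneg_left (hn.trans ?_) (pow_nonneg hT0 n)
    exact mul_le_mul_of_nonneg_left h2 (pow_nonneg hc₀ _)

end Coadjoint

/-! ### Hamiltonian fields preserve a Poisson bivector -/

section Jacobi

variable {ι A R : Type*} [Fintype ι] [CommRing R] [CommRing A] [Algebra R A]

/-- Hamiltonian fields are infinitesimal automorphisms of a bivector that satisfies the Jacobi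
identity. -/
lemma lieBivector_hamiltonianField (D : ι → Derivation R A A)
    (hD : ∀ i j f, D i (D j f) = D j (D i f)) (P : ι → ι → A) (hP : ∀ i j, P i j = - P j i)
    (hJ : ∀ i j q, ∑ k, (P i k * D k (P j q) + P j k * D k (P q i) + P q k * D k (P i j)) = 0)
    (h : A) (i j : ι) :
    lieBivector (fun k => D k) P (hamiltonianField (fun k => D k) P h) i j = 0 := by
  have h1 : ∀ k, hamiltonianField (fun k => D k) P h k * D k (P i j)
      - P k j * D k (hamiltonianField (fun k => D k) P h i)
      - P i k * D k (hamiltonianField (fun k => D k) P h j) =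
      ∑ q, D q h * (P q k * D k (P i j) + P j k * D k (P q i) + P i k * D k (P j q))
      + ∑ q, (P j k * P q i * D k (D q h) - P i k * P q j * D k (D q h)) := by
    intro k
    simp only [hamiltonianField, map_sum, Derivation.leibniz, smul_eq_mul, Finset.sum_mul,
      Finset.mul_sum]
    rw [← Finset.sum_sub_distrib, ← Finset.sum_sub_distrib, ← Finset.sum_add_distrib]
    refine Finset.sum_congr rfl fun q _ => ?_
    rw [hP k j, hP q j, map_neg, hP j q]
    simp only [map_neg]
    ring
  simp only [lieBivector]
  rw [Finset.sum_congr rfl fun k _ => h1 k, Finset.sum_add_distrib]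
  -- Terms with first derivatives of `h` cancel by the Jacobi identity, those with second
  -- derivatives by symmetry.
  have h2 : ∑ k, ∑ q, D q h * (P q k * D k (P i j) + P j k * D k (P q i) + P i k * D k (P j q))
      = 0 := by
    rw [Finset.sum_comm]
    refine Finset.sum_eq_zero fun q _ => ?_
    rw [← Finset.mul_sum]
    have := hJ i j q
    rw [Finset.sum_congr rfl fun k _ => (by ring : P q k * D k (P i j) + P j k * D k (P q i)
      + P i k * D k (P j q) = P i k * D k (P j q) + P j k * D k (P q i) + P q k * D k (P i j)),
      this, mul_zero]
  have h3 : ∑ k, ∑ q, (P j k * P q i * D k (D q h) - P i k * P q j * D k (D q h)) = 0 := by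
    simp only [Finset.sum_sub_distrib]
    rw [sub_eq_zero, Finset.sum_comm]
    refine Finset.sum_congr rfl fun q _ => Finset.sum_congr rfl fun k _ => ?_
    rw [hD k q, hP q i, hP j k]
    ring
  rw [h2, h3, add_zero]

end Jacobi

/-! ### Power series with geometric growth and a partial Poincaré lemma -/

section Convergent

variable {K ι : Type*} [RCLike K]

/-- The coefficients grow at most geometrically. -/
def IsConv (F : MvPowerSeries ι K) : Prop :=
  ∃ C R : ℝ, 0 ≤ C ∧ 1 ≤ R ∧ ∀ α, ‖MvPowerSeries.coeff α F‖ ≤ C * R ^ α.degree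

lemma IsConv.zero : IsConv (0 : MvPowerSeries ι K) :=
  ⟨0, 1, le_rfl, le_rfl, fun α => by simp⟩

lemma IsConv.add {F G : MvPowerSeries ι K} (hF : IsConv F) (hG : IsConv G) : IsConv (F + G) := by
  obtain ⟨C, R, hC, hR, h⟩ := hF
  obtain ⟨C', R', hC', hR', h'⟩ := hG
  refine ⟨C + C', max R R', by positivity, hR.trans (le_max_left _ _), fun α => ?_⟩
  rw [map_add, add_mul]
  refine (norm_add_le _ _).trans (add_le_add ((h α).trans ?_) ((h' α).trans ?_))
  · gcongr
    exact le_max_left _ _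
  · gcongr
    exact le_max_right _ _

lemma IsConv.neg {F : MvPowerSeries ι K} (hF : IsConv F) : IsConv (-F) := by
  obtain ⟨C, R, hC, hR, h⟩ := hF
  exact ⟨C, R, hC, hR, fun α => by rw [map_neg, norm_neg]; exact h α⟩

lemma IsConv.sub {F G : MvPowerSeries ι K} (hF : IsConv F) (hG : IsConv G) : IsConv (F - G) := by
  rw [sub_eq_add_neg]
  exact hF.add hG.neg

lemma IsConv.sum {κ : Type*} (s : Finset κ) {F : κ → MvPowerSeries ι K}
    (hF : ∀ i ∈ s, IsConv (F i)) : IsConv (∑ i ∈ s, F i) := by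
  induction s using Finset.cons_induction with
  | empty => exact IsConv.zero
  | cons a s ha ih =>
    rw [Finset.sum_cons]
    exact (hF a (Finset.mem_cons_self a s)).add
      (ih fun i hi => hF i (Finset.mem_cons_of_mem hi))

lemma IsConv.C_mul (a : K) {F : MvPowerSeries ι K} (hF : IsConv F) :
    IsConv (MvPowerSeries.C a * F) := by
  obtain ⟨C, R, hC, hR, h⟩ := hF
  refine ⟨‖a‖ * C, R, by positivity, hR, fun α => ?_⟩
  rw [MvPowerSeries.coeff_C_mul, norm_mul, mul_assoc]
  exact mul_le_mul_of_nonneg_left (h α) (norm_nonneg _)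

lemma coeff_X_mul [DecidableEq ι] (α : ι →₀ ℕ) (s : ι) (F : MvPowerSeries ι K) :
    MvPowerSeries.coeff α (MvPowerSeries.X s * F) =
      if α s = 0 then 0 else MvPowerSeries.coeff (α - Finsupp.single s 1) F := by
  rw [MvPowerSeries.X, MvPowerSeries.coeff_monomial_mul, one_mul]
  have : Finsupp.single s 1 ≤ α ↔ ¬ α s = 0 := by
    rw [Finsupp.single_le_iff]
    omega
  simp only [this, ite_not]

lemma degree_sub_single {α : ι →₀ ℕ} {s : ι} (h : α s ≠ 0) :
    (α - Finsupp.single s 1).degree + 1 = α.degree := by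
  classical
  have h1 : α - Finsupp.single s 1 + Finsupp.single s 1 = α :=
    tsub_add_cancel_of_le (Finsupp.single_le_iff.mpr (Nat.one_le_iff_ne_zero.mpr h))
  conv_rhs => rw [← h1]
  rw [map_add, Finsupp.degree_single]

lemma IsConv.X_mul (s : ι) {F : MvPowerSeries ι K} (hF : IsConv F) :
    IsConv (MvPowerSeries.X s * F) := by
  classical
  obtain ⟨C, R, hC, hR, h⟩ := hF
  refine ⟨C, R, hC, hR, fun α => ?_⟩
  rw [coeff_X_mul]
  split_ifs with h0
  · rw [norm_zero]
    positivity
  · refine (h _).trans ?_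
    rw [← degree_sub_single h0]
    gcongr
    exact Nat.le_succ _

lemma IsConv.pderiv (s : ι) {F : MvPowerSeries ι K} (hF : IsConv F) :
    IsConv (MvPowerSeries.pderiv K s F) := by
  obtain ⟨C, R, hC, hR, h⟩ := hF
  -- Doubling `R` absorbs the factor `α s + 1 ≤ 2 ^ α.degree`; the extra `R` pays for the shift of
  -- degree.
  refine ⟨C * R, 2 * R, by positivity, by linarith, fun α => ?_⟩
  rw [MvPowerSeries.coeff_pderiv, norm_mul]
  have h1 : ‖(α s : K) + 1‖ ≤ 2 ^ α.degree := by
    have : (α s : K) + 1 = ((α s + 1 : ℕ) : K) := by push_cast; rfl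
    rw [this, RCLike.norm_natCast]
    have h2 : α s + 1 ≤ 2 ^ α.degree :=
      (Nat.succ_le_succ (Finsupp.le_degree s α)).trans (Nat.lt_two_pow_self)
    exact_mod_cast h2
  have h3 := h (α + Finsupp.single s 1)
  rw [map_add, Finsupp.degree_single] at h3
  refine (mul_le_mul h3 h1 (norm_nonneg _) (by positivity)).trans_eq ?_
  rw [mul_pow, pow_succ]
  ring

/-- The Poincaré lemma for formal power series, with respect to part of the variables. -/
lemma exists_potential [DecidableEq ι] (s : Finset ι) (ω : ι → MvPowerSeries ι K)
    (hω : ∀ i ∈ s, ∀ j ∈ s, MvPowerSeries.pderiv K i (ω j) = MvPowerSeries.pderiv K j (ω i)) :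
    ∃ h : MvPowerSeries ι K, (∀ i ∈ s, MvPowerSeries.pderiv K i h = ω i) ∧
      ((∀ i ∈ s, IsConv (ω i)) → IsConv h) := by
  -- Euler homotopy: divide each coefficient of `∑ X i * ω i` by its degree in the variables of `s`.
  -- In degree 0 the default `0⁻¹ = 0` is harmless, as that coefficient is zero anyway. Division by
  -- an integer does not worsen the growth.
  let h : MvPowerSeries ι K := fun α =>
    ((∑ i ∈ s, α i : ℕ) : K)⁻¹ * MvPowerSeries.coeff α (∑ i ∈ s, MvPowerSeries.X i * ω i)
  have hh : ∀ α, MvPowerSeries.coeff α h = ((∑ i ∈ s, α i : ℕ) : K)⁻¹ *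
      MvPowerSeries.coeff α (∑ i ∈ s, MvPowerSeries.X i * ω i) := fun α => rfl
  refine ⟨h, fun i hi => ?_, fun hc => ?_⟩
  · ext β
    rw [MvPowerSeries.coeff_pderiv, hh, map_sum]
    have hN : (∑ j ∈ s, (β + Finsupp.single i 1 : ι →₀ ℕ) j : ℕ) = (∑ j ∈ s, β j) + 1 := by
      simp [Finset.sum_add_distrib, hi, Finsupp.single_apply]
    have hterm : ∀ j ∈ s, MvPowerSeries.coeff (β + Finsupp.single i 1)
        (MvPowerSeries.X j * ω j) * ((β i : K) + 1) =
        ((β + Finsupp.single i 1 : ι →₀ ℕ) j : ℕ) * MvPowerSeries.coeff β (ω i) := by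
      intro j hj
      rw [coeff_X_mul]
      rcases eq_or_ne j i with rfl | hij
      · simp [mul_comm]
      · have h0 : (β + Finsupp.single i 1 : ι →₀ ℕ) j = β j := by simp [hij.symm]
        rw [h0]
        split_ifs with hβ
        · simp [hβ]
        · have h1 : β - Finsupp.single j 1 + Finsupp.single j 1 = β :=
            tsub_add_cancel_of_le (Finsupp.single_le_iff.mpr (Nat.one_le_iff_ne_zero.mpr hβ))
          have h2 : β + Finsupp.single i 1 - Finsupp.single j 1 =
              β - Finsupp.single j 1 + Finsupp.single i 1 := by
            conv_lhs => rw [← h1]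
            rw [add_right_comm, add_tsub_cancel_right]
          have h3 := congrArg (MvPowerSeries.coeff (β - Finsupp.single j 1)) (hω i hi j hj)
          rw [MvPowerSeries.coeff_pderiv, MvPowerSeries.coeff_pderiv, h1] at h3
          have h4 : (β - Finsupp.single j 1 : ι →₀ ℕ) i = β i := by
            simp [hij]
          have h5 : (((β - Finsupp.single j 1 : ι →₀ ℕ) j : ℕ) : K) + 1 = β j := by
            have : (β - Finsupp.single j 1 : ι →₀ ℕ) j + 1 = β j := by
              simp only [Finsupp.tsub_apply, Finsupp.single_eq_same]
              omega
            exact_mod_cast this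
          rw [h4, h5] at h3
          rw [h2, h3, mul_comm]
    rw [mul_assoc, Finset.sum_mul, Finset.sum_congr rfl hterm, ← Finset.sum_mul, ← Nat.cast_sum,
      hN, ← mul_assoc, inv_mul_cancel₀ (Nat.cast_ne_zero.mpr (Nat.succ_ne_zero _)), one_mul]
  · obtain ⟨C, R, hC, hR, hb⟩ := IsConv.sum s fun i hi => (hc i hi).X_mul i
    refine ⟨C, R, hC, hR, fun α => ?_⟩
    rw [hh, norm_mul]
    refine (mul_le_of_le_one_left (norm_nonneg _) ?_).trans (hb α)
    rw [norm_inv, RCLike.norm_natCast]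
    exact Nat.cast_inv_le_one _

end Convergent

/-! ### The product Poisson structure in coordinates -/

section Product

variable {K g A : Type*} [Field K] [LieRing g] [LieAlgebra K g] [CommRing A] [Algebra K A]
  {l m : ℕ}

/-- The linear function on the dual of `g` defined by an element of `g`, in the coordinates
`u`. -/
noncomputable def zForm (b : Module.Basis (Fin m) K g) (u : Coord l m → A) : g →ₗ[K] A :=
  b.constr K fun k => u (.inr (.inr k))

lemma zForm_apply (b : Module.Basis (Fin m) K g) (u : Coord l m → A) (x : g) :
    zForm b u x = ∑ k, algebraMap K A (b.repr x k) * u (.inr (.inr k)) := by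
  simp [zForm, Module.Basis.constr_apply_fintype, Algebra.smul_def]

lemma productPoisson_z (b : Module.Basis (Fin m) K g) (u : Coord l m → A) (i j : Fin m) :
    productPoisson b u (.inr (.inr i)) (.inr (.inr j)) = zForm b u ⁅b i, b j⁆ := by
  rw [zForm_apply, productPoisson]

lemma productPoisson_skew (b : Module.Basis (Fin m) K g) (u : Coord l m → A) (i j : Coord l m) :
    productPoisson b u i j = - productPoisson b u j i := by
  rcases i with i | i | i <;> rcases j with j | j | j
  all_goals first
    | rw [productPoisson_z, productPoisson_z, ← map_neg, lie_skew]
    | (simp only [productPoisson, eq_comm]; split_ifs <;> simp)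
    | simp [productPoisson]

lemma sum_productPoisson_x (b : Module.Basis (Fin m) K g) (u F : Coord l m → A) (i : Fin l) :
    ∑ k, productPoisson b u k (.inl i) * F k = - F (.inr (.inl i)) := by
  simp [Fintype.sum_sum_type, productPoisson]

lemma sum_productPoisson_y (b : Module.Basis (Fin m) K g) (u F : Coord l m → A) (i : Fin l) :
    ∑ k, productPoisson b u k (.inr (.inl i)) * F k = F (.inl i) := by
  simp [Fintype.sum_sum_type, productPoisson]

lemma sum_productPoisson_z (b : Module.Basis (Fin m) K g) (u F : Coord l m → A) (i : Fin m) :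
    ∑ k, productPoisson b u k (.inr (.inr i)) * F k =
      - ∑ k, zForm b u ⁅b i, b k⁆ * F (.inr (.inr k)) := by
  rw [Fintype.sum_sum_type, Fintype.sum_sum_type]
  simp only [productPoisson_z]
  rw [← Finset.sum_neg_distrib]
  simp only [productPoisson, zero_mul, Finset.sum_const_zero, zero_add]
  refine Finset.sum_congr rfl fun k _ => ?_
  rw [← lie_skew, map_neg, neg_mul]

lemma hamiltonianField_eq_sum (D : Coord l m → A → A) (b : Module.Basis (Fin m) K g)
    (u : Coord l m → A) (h : A) (i : Coord l m) :
    hamiltonianField D (productPoisson b u) h i = ∑ k, productPoisson b u k i * D k h :=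
  Finset.sum_congr rfl fun _ _ => mul_comm _ _

lemma lieBivector_eq_sum (D : Coord l m → A → A) (b : Module.Basis (Fin m) K g)
    (u : Coord l m → A) (X : Coord l m → A) (i j : Coord l m) :
    lieBivector D (productPoisson b u) X i j = ∑ k, X k * D k (productPoisson b u i j)
      - ∑ k, productPoisson b u k j * D k (X i) + ∑ k, productPoisson b u k i * D k (X j) := by
  rw [lieBivector, ← Finset.sum_sub_distrib, ← Finset.sum_add_distrib]
  refine Finset.sum_congr rfl fun k _ => ?_
  rw [productPoisson_skew b u i k]
  ring

lemma deriv_zForm (D : Coord l m → Derivation K A A) {u : Coord l m → A}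
    (hu : ∀ i j, D i (u j) = if i = j then 1 else 0) (b : Module.Basis (Fin m) K g)
    (k : Coord l m) (x : g) :
    D k (zForm b u x) = match k with
      | .inr (.inr k) => algebraMap K A (b.repr x k)
      | _ => 0 := by
  rw [zForm_apply]
  rcases k with k | k | k <;> simp [hu]

lemma deriv_productPoisson (D : Coord l m → Derivation K A A) {u : Coord l m → A}
    (hu : ∀ i j, D i (u j) = if i = j then 1 else 0) (b : Module.Basis (Fin m) K g)
    (k i j : Coord l m) :
    D k (productPoisson b u i j) = match i, j, k with
      | .inr (.inr i), .inr (.inr j), .inr (.inr k) => algebraMap K A (b.repr ⁅b i, b j⁆ k)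
      | _, _, _ => 0 := by
  rcases i with i | i | i <;> rcases j with j | j | j
  all_goals first
    | (rw [productPoisson_z, deriv_zForm D hu]; rcases k with k | k | k <;> rfl)
    | (simp only [productPoisson]; split_ifs <;> simp)
    | simp [productPoisson]

/-- The action of `g` on the functions of `u`. -/
noncomputable def zAction (D : Coord l m → Derivation K A A) (b : Module.Basis (Fin m) K g)
    (u : Coord l m → A) (x : g) (F : A) : A :=
  ∑ k, zForm b u ⁅x, b k⁆ * D (.inr (.inr k)) F

lemma zAction_zForm (D : Coord l m → Derivation K A A) {u : Coord l m → A}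
    (hu : ∀ i j, D i (u j) = if i = j then 1 else 0) (b : Module.Basis (Fin m) K g) (x y : g) :
    zAction D b u x (zForm b u y) = zForm b u ⁅x, y⁆ := by
  simp only [zAction, deriv_zForm D hu]
  conv_rhs => rw [← b.sum_repr y]
  simp only [lie_sum, lie_smul, map_sum, map_smul, Algebra.smul_def, mul_comm]

lemma zAction_comm {D : Coord l m → Derivation K A A} {u : Coord l m → A}
    (hu : ∀ i j, D i (u j) = if i = j then 1 else 0) (hD : ∀ i j f, D i (D j f) = D j (D i f))
    (b : Module.Basis (Fin m) K g) {s : Coord l m} (hs : ∀ k, s ≠ .inr (.inr k)) (x : g) {F : A}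
    (hF : D s F = 0) : D s (zAction D b u x F) = 0 := by
  rw [zAction, map_sum]
  refine Finset.sum_eq_zero fun k _ => ?_
  rw [Derivation.leibniz, hD, hF, map_zero, deriv_zForm D hu]
  rcases s with s | s | s
  · simp
  · simp
  · exact absurd rfl (hs s)

/-- Only brackets of two z-coordinates are nonconstant, and their differentials pair with z alone.
Hence only triples of z-coordinates contribute, and for them this is the Jacobi identity of g. -/
lemma productPoisson_jacobi {D : Coord l m → Derivation K A A} {u : Coord l m → A}
    (hu : ∀ i j, D i (u j) = if i = j then 1 else 0) (b : Module.Basis (Fin m) K g)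
    (i j q : Coord l m) :
    ∑ k, (productPoisson b u i k * D k (productPoisson b u j q)
      + productPoisson b u j k * D k (productPoisson b u q i)
      + productPoisson b u q k * D k (productPoisson b u i j)) = 0 := by
  have hz : ∀ i j q : Fin m, ∑ k, productPoisson b u (.inr (.inr i)) (.inr (.inr k)) *
      algebraMap K A (b.repr ⁅b j, b q⁆ k) = zForm b u ⁅b i, ⁅b j, b q⁆⁆ := by
    intro i j q
    rw [← zAction_zForm D hu, zAction]
    simp only [productPoisson_z, deriv_zForm D hu]
  have h0 : ∀ i j q : Coord l m, (∑ k, productPoisson b u i k * D k (productPoisson b u j q)) =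
      match i, j, q with
      | .inr (.inr i), .inr (.inr j), .inr (.inr q) => zForm b u ⁅b i, ⁅b j, b q⁆⁆
      | _, _, _ => 0 := by
    intro i j q
    rw [Fintype.sum_sum_type, Fintype.sum_sum_type]
    simp only [deriv_productPoisson D hu]
    rcases i with i | i | i <;> rcases j with j | j | j <;> rcases q with q | q | q
    all_goals first
      | exact (by simp : _ = (0 : A))
      | (simp only [mul_zero, Finset.sum_const_zero, zero_add]; exact hz _ _ _)
      | (simp [productPoisson])
  rw [Finset.sum_add_distrib, Finset.sum_add_distrib, h0, h0, h0]
  rcases i with i | i | i <;> rcases j with j | j | j <;> rcases q with q | q | q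
  all_goals first
    | (simp; done)
    | (simp only []; rw [← map_add, ← map_add, lie_jacobi, map_zero])

end Product

/-! ### Homogeneous parts in the z-variables -/

section Restriction

variable {K g : Type*} [RCLike K] [LieRing g] [LieAlgebra K g] {l m : ℕ}

/-- Multi-indices in the last variables. -/
noncomputable def embZ (l : ℕ) (α : Fin m →₀ ℕ) : Coord l m →₀ ℕ :=
  α.mapDomain fun k => .inr (.inr k)

lemma embZ_z (α : Fin m →₀ ℕ) (k : Fin m) : embZ l α (.inr (.inr k)) = α k :=
  Finsupp.mapDomain_apply (Sum.inr_injective.comp Sum.inr_injective) α k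

lemma embZ_of_ne (α : Fin m →₀ ℕ) {s : Coord l m} (hs : ∀ k, s ≠ .inr (.inr k)) :
    embZ l α s = 0 :=
  Finsupp.mapDomain_of_notMem_range α s fun ⟨k, hk⟩ => hs k hk.symm

lemma embZ_add_single (α : Fin m →₀ ℕ) (k : Fin m) :
    embZ l (α + Finsupp.single k 1) = embZ l α + Finsupp.single (.inr (.inr k)) 1 := by
  rw [embZ, Finsupp.mapDomain_add, Finsupp.mapDomain_single, embZ]

/-- The exponents of the last variables. -/
noncomputable def resZ (β : Coord l m →₀ ℕ) : Fin m →₀ ℕ :=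
  Finsupp.equivFunOnFinite.symm fun k => β (.inr (.inr k))

lemma resZ_embZ (α : Fin m →₀ ℕ) : resZ (embZ l α) = α := by
  ext k
  exact embZ_z α k

lemma embZ_resZ {β : Coord l m →₀ ℕ} (hβ : ∀ s, (∀ k, s ≠ .inr (.inr k)) → β s = 0) :
    embZ l (resZ β) = β := by
  ext s
  by_cases hs : ∀ k, s ≠ .inr (.inr k)
  · rw [embZ_of_ne _ hs, hβ s hs]
  · push Not at hs
    obtain ⟨k, rfl⟩ := hs
    rw [embZ_z]
    rfl

lemma degree_embZ (α : Fin m →₀ ℕ) : (embZ l α).degree = ∑ i, α i := by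
  rw [Finsupp.degree_eq_sum, Fintype.sum_sum_type, Fintype.sum_sum_type]
  simp only [embZ_z]
  simp [embZ_of_ne]

/-- The homogeneous part of degree `n` of the restriction of a power series to the last
variables. -/
noncomputable def homPart (n : ℕ) : MvPowerSeries (Coord l m) K →ₗ[K] MvPolynomial (Fin m) K where
  toFun F := ∑ α ∈ Finset.finsuppAntidiag Finset.univ n,
    MvPolynomial.monomial α (MvPowerSeries.coeff (embZ l α) F)
  map_add' F G := by simp [Finset.sum_add_distrib]
  map_smul' c F := by simp [Finset.smul_sum, MvPolynomial.smul_monomial]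

lemma coeff_homPart (n : ℕ) (F : MvPowerSeries (Coord l m) K) (α : Fin m →₀ ℕ) :
    (homPart n F).coeff α = if ∑ i, α i = n then MvPowerSeries.coeff (embZ l α) F else 0 := by
  simp only [homPart, LinearMap.coe_mk, AddHom.coe_mk, MvPolynomial.coeff_sum,
    MvPolynomial.coeff_monomial, Finset.sum_ite_eq', mem_degIdx_iff]

lemma homPart_isHomogeneous (n : ℕ) (F : MvPowerSeries (Coord l m) K) :
    (homPart n F).IsHomogeneous n := by
  refine MvPolynomial.IsHomogeneous.sum _ _ _ fun α hα => ?_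
  refine MvPolynomial.isHomogeneous_monomial _ ?_
  rw [Finsupp.degree_eq_sum]
  exact (mem_degIdx_iff α).mp hα

lemma sum_add_single (α : Fin m →₀ ℕ) (k : Fin m) :
    ∑ i, (α + Finsupp.single k 1 : Fin m →₀ ℕ) i = (∑ i, α i) + 1 := by
  simp [Finset.sum_add_distrib, Finsupp.single_apply]

lemma homPart_X_mul_pderiv (n : ℕ) (r k : Fin m) (F : MvPowerSeries (Coord l m) K) :
    homPart n (MvPowerSeries.X (.inr (.inr r)) * MvPowerSeries.pderiv K (.inr (.inr k)) F) =
      MvPolynomial.X r * MvPolynomial.pderiv k (homPart n F) := by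
  ext α
  rw [coeff_homPart, coeff_X_mul, embZ_z, MvPolynomial.coeff_X_mul']
  by_cases h0 : α r = 0
  · simp [h0]
  · obtain ⟨β, rfl⟩ : ∃ β, α = β + Finsupp.single r 1 :=
      ⟨α - Finsupp.single r 1, (tsub_add_cancel_of_le
        (Finsupp.single_le_iff.mpr (Nat.one_le_iff_ne_zero.mpr h0))).symm⟩
    rw [if_neg h0, if_pos (Finsupp.mem_support_iff.mpr h0), embZ_add_single, add_tsub_cancel_right,
      add_tsub_cancel_right, MvPolynomial.coeff_pderiv, coeff_homPart, MvPowerSeries.coeff_pderiv,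
      ← embZ_add_single, embZ_z, sum_add_single, sum_add_single, ite_mul, zero_mul]

lemma homPart_C_mul (n : ℕ) (c : K) (F : MvPowerSeries (Coord l m) K) :
    homPart n (algebraMap K _ c * F) = MvPolynomial.C c * homPart n F := by
  rw [← Algebra.smul_def, map_smul, MvPolynomial.smul_eq_C_mul]

/-- The fields of the action are linear in z, so they preserve the degree; this is what splits the
cocycle equation into finite-dimensional ones. -/
lemma homPart_zAction (n : ℕ) (b : Module.Basis (Fin m) K g) (x : g)
    (F : MvPowerSeries (Coord l m) K) :
    homPart n (zAction (MvPowerSeries.pderiv K) b (fun i => MvPowerSeries.X i) x F) =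
      coadj b x (homPart n F) := by
  rw [coadj, linearField_apply, zAction, map_sum]
  refine Finset.sum_congr rfl fun j _ => ?_
  rw [zForm_apply, Finset.sum_mul, map_sum]
  refine Finset.sum_congr rfl fun k _ => ?_
  rw [mul_assoc, homPart_C_mul, homPart_X_mul_pderiv, LinearMap.toMatrix_apply,
    LieAlgebra.ad_apply]

/-- A series that depends on the last variables only is determined by its homogeneous parts. -/
lemma eq_zero_of_homPart {F : MvPowerSeries (Coord l m) K}
    (hD : ∀ s, (∀ k, s ≠ .inr (.inr k)) → MvPowerSeries.pderiv K s F = 0)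
    (hF : ∀ n, homPart n F = 0) : F = 0 := by
  ext β
  by_cases hβ : ∀ s, (∀ k, s ≠ .inr (.inr k)) → β s = 0
  · have h := congrArg (MvPolynomial.coeff (resZ β)) (hF (∑ i, resZ β i))
    rwa [coeff_homPart, if_pos rfl, embZ_resZ hβ, MvPolynomial.coeff_zero] at h
  · push Not at hβ
    obtain ⟨s, hs, h0⟩ := hβ
    obtain ⟨γ, rfl⟩ : ∃ γ, β = γ + Finsupp.single s 1 :=
      ⟨β - Finsupp.single s 1, (tsub_add_cancel_of_le
        (Finsupp.single_le_iff.mpr (Nat.one_le_iff_ne_zero.mpr h0))).symm⟩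
    have h := congrArg (MvPowerSeries.coeff γ) (hD s hs)
    rw [MvPowerSeries.coeff_pderiv, map_zero, mul_eq_zero] at h
    rw [map_zero]
    exact h.resolve_right (Nat.cast_add_one_ne_zero _)

/-- Homogeneous polynomials in the last variables assemble to a power series. -/
lemma exists_homPart_eq (p : ℕ → MvPolynomial (Fin m) K) (hp : ∀ n, (p n).IsHomogeneous n) :
    ∃ F : MvPowerSeries (Coord l m) K,
      (∀ s, (∀ k, s ≠ .inr (.inr k)) → MvPowerSeries.pderiv K s F = 0) ∧
      (∀ n, homPart n F = p n) ∧
      ∀ β, ‖MvPowerSeries.coeff β F‖ ≤ coeffNorm (p β.degree) := by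
  classical
  let F : MvPowerSeries (Coord l m) K := fun β =>
    if ∀ s, (∀ k, s ≠ .inr (.inr k)) → β s = 0 then (p β.degree).coeff (resZ β) else 0
  have hc : ∀ β, MvPowerSeries.coeff β F =
      if ∀ s, (∀ k, s ≠ .inr (.inr k)) → β s = 0 then (p β.degree).coeff (resZ β) else 0 :=
    fun β => rfl
  refine ⟨F, fun s hs => ?_, fun n => ?_, fun β => ?_⟩
  · ext β
    rw [MvPowerSeries.coeff_pderiv, hc, if_neg, zero_mul, map_zero]
    intro h
    have := h s hs
    simp at this
  · ext α
    rw [coeff_homPart]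
    split_ifs with h
    · rw [hc, if_pos fun s hs => embZ_of_ne α hs, degree_embZ, resZ_embZ, h]
    · refine ((hp n).coeff_eq_zero ?_).symm
      rwa [Finsupp.degree_eq_sum]
  · rw [hc]
    split_ifs with h
    · exact norm_coeff_le_coeffNorm _ _
    · rw [norm_zero]
      exact coeffNorm_nonneg _

lemma card_degIdx_le (m n : ℕ) :
    ((Finset.finsuppAntidiag (Finset.univ : Finset (Fin m)) n).card : ℝ) ≤ (m : ℝ) ^ n := by
  have h := sum_inv_expFactorial (m := m) n
  have hn : (0 : ℝ) < n.factorial := by exact_mod_cast n.factorial_pos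
  rw [eq_div_iff hn.ne', Finset.sum_mul] at h
  rw [← h, Finset.card_eq_sum_ones, Nat.cast_sum]
  refine Finset.sum_le_sum fun α hα => ?_
  have h1 := expFactorial_le ((mem_degIdx_iff α).mp hα)
  have h2 : (0 : ℝ) < expFactorial α := by exact_mod_cast expFactorial_pos α
  rw [Nat.cast_one, one_div_mul_eq_div, le_div_iff₀ h2, one_mul]
  exact_mod_cast h1

lemma coeffNorm_homPart_le {F : MvPowerSeries (Coord l m) K} {C R : ℝ}
    (hF : ∀ α, ‖MvPowerSeries.coeff α F‖ ≤ C * R ^ α.degree) (hC : 0 ≤ C) (hR : 1 ≤ R) (n : ℕ) :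
    coeffNorm (homPart n F) ≤ (m : ℝ) ^ n * (C * R ^ n) := by
  refine (coeffNorm_sum_le _ _).trans ?_
  refine (Finset.sum_le_card_nsmul _ _ (C * R ^ n) fun α hα => ?_).trans ?_
  · rw [coeffNorm_monomial]
    refine (hF _).trans_eq ?_
    rw [degree_embZ, (mem_degIdx_iff α).mp hα]
  · rw [nsmul_eq_mul]
    exact mul_le_mul_of_nonneg_right (card_degIdx_le m n) (by positivity)

end Restriction

/-! ### Formal Poisson fields are Hamiltonian -/

section FormalCohomology

variable {K g : Type*} [RCLike K] [LieRing g] [LieAlgebra K g] {l m : ℕ}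

lemma pderiv_coordinate {ι : Type*} [DecidableEq ι] (i j : ι) :
    MvPowerSeries.pderiv K i (MvPowerSeries.X j : MvPowerSeries ι K) = if i = j then 1 else 0 := by
  rw [MvPowerSeries.pderiv_X, Pi.single_apply]
  simp only [eq_comm]

lemma pderiv_pderiv_comm {ι : Type*} (i j : ι) (F : MvPowerSeries ι K) :
    MvPowerSeries.pderiv K i (MvPowerSeries.pderiv K j F) =
      MvPowerSeries.pderiv K j (MvPowerSeries.pderiv K i F) := by
  classical
  ext α
  simp only [MvPowerSeries.coeff_pderiv, Finsupp.add_apply]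
  rcases eq_or_ne i j with rfl | h
  · rfl
  · rw [Finsupp.single_eq_of_ne h, Finsupp.single_eq_of_ne h.symm, add_right_comm]
    simp only [add_zero]
    ring

lemma hamiltonianField_mem (b : Module.Basis (Fin m) K g)
    (h : MvPowerSeries (Coord l m) K) :
    hamiltonianField (formalD K) (formalPoisson l b) h ∈ formalPoissonFields l b :=
  lieBivector_hamiltonianField (MvPowerSeries.pderiv K) pderiv_pderiv_comm _
    (productPoisson_skew b _) (productPoisson_jacobi pderiv_coordinate b) h

/-- The components of the equations of a Poisson field. -/
lemma lieBivector_components (b : Module.Basis (Fin m) K g)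
    {X : Coord l m → MvPowerSeries (Coord l m) K} (hX : X ∈ formalPoissonFields l b)
    (i j : Coord l m) :
    ∑ k, X k * MvPowerSeries.pderiv K k (formalPoisson l b i j)
      - ∑ k, formalPoisson l b k j * MvPowerSeries.pderiv K k (X i)
      + ∑ k, formalPoisson l b k i * MvPowerSeries.pderiv K k (X j) = 0 :=
  (lieBivector_eq_sum _ _ _ _ _ _).symm.trans (hX i j)

/-- A Poisson field can be made tangent to the last variables. -/
lemma exists_symplectic_primitive (b : Module.Basis (Fin m) K g)
    {X : Coord l m → MvPowerSeries (Coord l m) K} (hX : X ∈ formalPoissonFields l b) :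
    ∃ h : MvPowerSeries (Coord l m) K, (∀ s, (∀ k, s ≠ .inr (.inr k)) →
      X s = hamiltonianField (formalD K) (formalPoisson l b) h s) ∧
      ((∀ i, IsConv (X i)) → IsConv h) := by
  have hd := fun k i j => deriv_productPoisson (MvPowerSeries.pderiv K) pderiv_coordinate
    (l := l) b k i j
  -- The signs come from `X_x = -∂h/∂y` and `X_y = ∂h/∂x`. Closedness of `ω` in x, y is the xy-block
  -- of `[X, Π] = 0`, where the entries of Π are constant.
  let ω : Coord l m → MvPowerSeries (Coord l m) K := fun s => match s with
    | .inl i => X (.inr (.inl i))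
    | .inr (.inl i) => - X (.inl i)
    | .inr (.inr _) => 0
  obtain ⟨h, hω, hc⟩ := exists_potential
    (Finset.univ.filter fun s : Coord l m => ∀ k, s ≠ .inr (.inr k)) ω (by
      intro i hi j hj
      simp only [Finset.mem_filter, Finset.mem_univ, true_and] at hi hj
      rcases i with i | i | i <;> rcases j with j | j | j
      case inl.inl =>
        have h1 := lieBivector_components b hX (.inr (.inl i)) (.inr (.inl j))
        rw [sum_productPoisson_y, sum_productPoisson_y] at h1
        simp only [hd, mul_zero, Finset.sum_const_zero] at h1
        simp only [ω]
        linear_combination h1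
      case inl.inr.inl =>
        have h1 := lieBivector_components b hX (.inl j) (.inr (.inl i))
        rw [sum_productPoisson_x, sum_productPoisson_y] at h1
        simp only [hd, mul_zero, Finset.sum_const_zero] at h1
        simp only [ω, map_neg]
        linear_combination h1
      case inr.inl.inl =>
        have h1 := lieBivector_components b hX (.inl i) (.inr (.inl j))
        rw [sum_productPoisson_x, sum_productPoisson_y] at h1
        simp only [hd, mul_zero, Finset.sum_const_zero] at h1
        simp only [ω, map_neg]
        linear_combination -h1
      case inr.inl.inr.inl =>
        have h1 := lieBivector_components b hX (.inl i) (.inl j)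
        rw [sum_productPoisson_x, sum_productPoisson_x] at h1
        simp only [hd, mul_zero, Finset.sum_const_zero] at h1
        simp only [ω, map_neg]
        linear_combination h1
      all_goals first
        | exact absurd rfl (hi _)
        | exact absurd rfl (hj _))
  refine ⟨h, fun s hs => ?_, fun hXc => hc fun s _ => ?_⟩
  · rw [hamiltonianField_eq_sum]
    rcases s with s | s | s
    · rw [sum_productPoisson_x, formalD, hω _ (by simp), neg_neg]
    · rw [sum_productPoisson_y, formalD, hω _ (by simp)]
    · exact absurd rfl (hs _)
  · rcases s with s | s | s
    · exact hXc _
    · exact (hXc _).neg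
    · exact IsConv.zero

lemma IsConv.zAction (b : Module.Basis (Fin m) K g) (x : g) {F : MvPowerSeries (Coord l m) K}
    (hF : IsConv F) :
    IsConv (zAction (MvPowerSeries.pderiv K) b (fun i => MvPowerSeries.X i) x F) := by
  refine IsConv.sum _ fun k _ => ?_
  rw [zForm_apply, Finset.sum_mul]
  refine IsConv.sum _ fun r _ => ?_
  rw [mul_assoc]
  exact ((hF.pderiv _).X_mul _).C_mul _

lemma hamiltonianField_z (b : Module.Basis (Fin m) K g) (h : MvPowerSeries (Coord l m) K)
    (j : Fin m) : hamiltonianField (formalD K) (formalPoisson l b) h (.inr (.inr j)) =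
      - zAction (MvPowerSeries.pderiv K) b (fun i => MvPowerSeries.X i) (b j) h := by
  rw [hamiltonianField_eq_sum, sum_productPoisson_z]
  rfl

lemma IsConv.hamiltonianField (b : Module.Basis (Fin m) K g) {h : MvPowerSeries (Coord l m) K}
    (hh : IsConv h) (i : Coord l m) :
    IsConv (LocalPoisson.hamiltonianField (formalD K) (formalPoisson l b) h i) := by
  rcases i with i | i | i
  · rw [hamiltonianField_eq_sum, sum_productPoisson_x]
    exact (hh.pderiv _).neg
  · rw [hamiltonianField_eq_sum, sum_productPoisson_y]
    exact hh.pderiv _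
  · rw [hamiltonianField_z]
    exact (IsConv.zAction b _ hh).neg

/-- Convergence is uniform in a finite family. -/
lemma IsConv.uniform {ι κ : Type*} [Fintype κ] {F : κ → MvPowerSeries ι K}
    (hF : ∀ j, IsConv (F j)) :
    ∃ C R : ℝ, 0 ≤ C ∧ 1 ≤ R ∧ ∀ j α, ‖MvPowerSeries.coeff α (F j)‖ ≤ C * R ^ α.degree := by
  choose C R hC hR h using hF
  have hR0 : ∀ j, 0 ≤ R j := fun j => zero_le_one.trans (hR j)
  refine ⟨∑ j, C j, 1 + ∑ j, R j, Finset.sum_nonneg fun j _ => hC j, ?_, fun j α => ?_⟩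
  · exact le_add_of_nonneg_right (Finset.sum_nonneg fun j _ => hR0 j)
  · refine (h j α).trans (mul_le_mul ?_ (pow_le_pow_left₀ (hR0 j) ?_ _) (by have := hR0 j; positivity)
      (Finset.sum_nonneg fun j _ => hC j))
    · exact Finset.single_le_sum (fun j _ => hC j) (Finset.mem_univ j)
    · refine (Finset.single_le_sum (fun j _ => hR0 j) (Finset.mem_univ j)).trans ?_
      exact le_add_of_nonneg_left zero_le_one

lemma cocycle_of_basis (b : Module.Basis (Fin m) K g) (f : g →ₗ[K] MvPolynomial (Fin m) K)
    (hf : ∀ i j, f ⁅b i, b j⁆ = coadj b (b i) (f (b j)) - coadj b (b j) (f (b i))) (x y : g) :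
    f ⁅x, y⁆ = coadj b x (f y) - coadj b y (f x) := by
  have h : (LieAlgebra.ad K g : g →ₗ[K] Module.End K g).compr₂ f =
      (coadjₗ b).compl₂ f - ((coadjₗ b).compl₂ f).flip := b.ext fun i => b.ext fun j => hf i j
  exact LinearMap.congr_fun (LinearMap.congr_fun h x) y

/-- A Poisson field tangent to the last variables is Hamiltonian. -/
lemma exists_primitive_of_tangent [LieAlgebra.IsKilling K g] (b : Module.Basis (Fin m) K g)
    {X : Coord l m → MvPowerSeries (Coord l m) K} (hX : X ∈ formalPoissonFields l b)
    (hX0 : ∀ s, (∀ k, s ≠ .inr (.inr k)) → X s = 0) :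
    ∃ h : MvPowerSeries (Coord l m) K, X = hamiltonianField (formalD K) (formalPoisson l b) h ∧
      ((∀ i, IsConv (X i)) → IsConv h) := by
  have hd := fun k i j => deriv_productPoisson (MvPowerSeries.pderiv K) pderiv_coordinate
    (l := l) b k i j
  -- The mixed components of `[X, Π] = 0`: with no symplectic part left, they reduce to the
  -- derivatives of the z-components along x and y.
  have hDX : ∀ s, (∀ k, s ≠ .inr (.inr k)) → ∀ j,
      MvPowerSeries.pderiv K s (X (.inr (.inr j))) = 0 := by
    intro s hs j
    rcases s with s | s | s
    · have h1 := lieBivector_components b hX (.inr (.inl s)) (.inr (.inr j))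
      rw [sum_productPoisson_y, hX0 (.inr (.inl s)) (by simp)] at h1
      simpa only [hd, mul_zero, Finset.sum_const_zero, map_zero, sub_zero, zero_add] using h1
    · have h1 := lieBivector_components b hX (.inl s) (.inr (.inr j))
      rw [sum_productPoisson_x, hX0 (.inl s) (by simp)] at h1
      simpa only [hd, mul_zero, Finset.sum_const_zero, map_zero, sub_zero, zero_add,
        neg_eq_zero] using h1
    · exact absurd rfl (hs s)
  -- The zz-components of `[X, Π] = 0` are the cocycle identity for `b j ↦ X_{z_j}`.
  have hcoc : ∀ i j, ∑ k, X (.inr (.inr k)) * algebraMap K _ (b.repr ⁅b i, b j⁆ k) =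
      zAction (MvPowerSeries.pderiv K) b (fun i => MvPowerSeries.X i) (b i) (X (.inr (.inr j)))
      - zAction (MvPowerSeries.pderiv K) b (fun i => MvPowerSeries.X i) (b j)
        (X (.inr (.inr i))) := by
    intro i j
    have h1 := lieBivector_components b hX (.inr (.inr i)) (.inr (.inr j))
    rw [sum_productPoisson_z, sum_productPoisson_z, Fintype.sum_sum_type,
      Fintype.sum_sum_type] at h1
    simp only [hd, mul_zero, Finset.sum_const_zero, zero_add] at h1
    simp only [zAction]
    linear_combination h1
  obtain ⟨c, hc, H⟩ := exists_homogeneous_primitive b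
  have hex : ∀ n, ∃ p : MvPolynomial (Fin m) K, p.IsHomogeneous n ∧
      (∀ j, coadj b (b j) p = - homPart n (X (.inr (.inr j)))) ∧
      coeffNorm p ≤ c ^ (n + 1) * ∑ j, coeffNorm (- homPart n (X (.inr (.inr j)))) := by
    intro n
    -- The sign is that of `hamiltonianField_z`, where the z-part of a Hamiltonian field is minus
    -- the action.
    let f : g →ₗ[K] MvPolynomial (Fin m) K := b.constr K fun j => - homPart n (X (.inr (.inr j)))
    have hfb : ∀ j, f (b j) = - homPart n (X (.inr (.inr j))) := fun j => by simp [f]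
    have hfx : ∀ x, f x = ∑ j, b.repr x j • (- homPart n (X (.inr (.inr j)))) := fun x => by
      simp [f, Module.Basis.constr_apply_fintype]
    obtain ⟨p, hp, hsol, hpn⟩ := H n f (fun x => by
        rw [hfx]
        refine MvPolynomial.IsHomogeneous.sum _ _ _ fun j _ => ?_
        rw [MvPolynomial.smul_eq_C_mul]
        exact (homPart_isHomogeneous n _).neg.C_mul _)
      (cocycle_of_basis b f fun i j => by
        have h1 := congrArg (homPart n) (hcoc i j)
        rw [map_sub, homPart_zAction, homPart_zAction, map_sum] at h1
        rw [hfb, hfb, hfx, map_neg, map_neg, sub_neg_eq_add, neg_add_eq_sub, ← neg_sub, ← h1,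
          ← Finset.sum_neg_distrib]
        refine Finset.sum_congr rfl fun k _ => ?_
        rw [mul_comm, homPart_C_mul, MvPolynomial.smul_eq_C_mul, mul_neg])
    exact ⟨p, hp, fun j => by rw [hsol, hfb], by simpa only [hfb] using hpn⟩
  choose p hp hsol hpn using hex
  obtain ⟨h, hDh, hh, hhn⟩ := exists_homPart_eq (l := l) p hp
  refine ⟨h, ?_, fun hXc => ?_⟩
  · funext s
    rcases s with s | s | j
    · rw [hamiltonianField_eq_sum, sum_productPoisson_x, hX0 _ (by simp), formalD, hDh _ (by simp),
        neg_zero]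
    · rw [hamiltonianField_eq_sum, sum_productPoisson_y, hX0 _ (by simp), formalD, hDh _ (by simp)]
    · rw [hamiltonianField_z, ← add_eq_zero_iff_eq_neg]
      refine eq_zero_of_homPart (fun s hs => ?_) fun n => ?_
      · rw [map_add, hDX s hs,
          zAction_comm pderiv_coordinate pderiv_pderiv_comm b hs _ (hDh s hs), add_zero]
      · rw [map_add, homPart_zAction, hh, hsol, add_neg_cancel]
  · obtain ⟨C, R, hC, hR, hCR⟩ := IsConv.uniform fun j : Fin m => hXc (.inr (.inr j))
    refine ⟨c * m * C, 1 + c * m * R, by positivity, ?_, fun β => ?_⟩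
    · have : 0 ≤ c * m * R := by positivity
      linarith
    · have h1 : ∀ j, coeffNorm (- homPart β.degree (X (.inr (.inr j)))) ≤
          (m : ℝ) ^ β.degree * (C * R ^ β.degree) := fun j => by
        rw [← map_neg]
        refine coeffNorm_homPart_le (fun α => ?_) hC hR _
        rw [map_neg, norm_neg]
        exact hCR j α
      have h2 := Finset.sum_le_card_nsmul Finset.univ _ _ fun j _ => h1 j
      rw [Finset.card_univ, Fintype.card_fin, nsmul_eq_mul] at h2
      refine (hhn β).trans ((hpn _).trans
        ((mul_le_mul_of_nonneg_left h2 (by positivity)).trans ?_))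
      calc c ^ (β.degree + 1) * (m * ((m : ℝ) ^ β.degree * (C * R ^ β.degree)))
          = c * m * C * (c * m * R) ^ β.degree := by rw [mul_pow, mul_pow]; ring
        _ ≤ c * m * C * (1 + c * m * R) ^ β.degree := by
          gcongr
          linarith

/-- Formal Poisson fields are Hamiltonian, with convergent Hamiltonians for convergent fields. -/
theorem exists_hamiltonian [LieAlgebra.IsKilling K g] (b : Module.Basis (Fin m) K g)
    {X : Coord l m → MvPowerSeries (Coord l m) K} (hX : X ∈ formalPoissonFields l b) :
    ∃ h : MvPowerSeries (Coord l m) K, X = hamiltonianField (formalD K) (formalPoisson l b) h ∧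
      ((∀ i, IsConv (X i)) → IsConv h) := by
  obtain ⟨h₀, hs, hc⟩ := exists_symplectic_primitive b hX
  obtain ⟨h₁, h1, hc1⟩ := exists_primitive_of_tangent b
    (Submodule.sub_mem _ hX (hamiltonianField_mem b h₀)) fun s hs' => sub_eq_zero.mpr (hs s hs')
  refine ⟨h₁ + h₀, ?_, fun hXc => ?_⟩
  · rw [sub_eq_iff_eq_add] at h1
    rw [h1]
    funext i
    simp [hamiltonianField, add_mul, Finset.sum_add_distrib]
  · exact (hc1 fun i => (hXc i).sub (IsConv.hamiltonianField b (hc hXc) i)).add (hc hXc)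

end FormalCohomology

/-! ### Summability of power series in several variables -/

section Summation

variable {ι : Type*} [Fintype ι]

lemma summable_pow_degree {r : ℝ} (hr0 : 0 ≤ r) (hr : r < 1) :
    Summable fun α : ι →₀ ℕ => r ^ α.degree := by
  classical
  have h : Summable fun α : ι → ℕ => ∏ i, r ^ α i := by
    refine summable_of_sum_le (c := ∏ _i : ι, (1 - r)⁻¹) (fun α => by positivity) fun s => ?_
    obtain ⟨N, hN⟩ : ∃ N, ∀ α ∈ s, ∀ i, α i < N :=
      ⟨(∑ α ∈ s, ∑ i, α i) + 1, fun α hα i => Nat.lt_succ_of_le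
        ((Finset.single_le_sum (fun _ _ => Nat.zero_le _) (Finset.mem_univ i)).trans
          (Finset.single_le_sum (f := fun α : ι → ℕ => ∑ i, α i) (fun _ _ => Nat.zero_le _) hα))⟩
    calc ∑ α ∈ s, ∏ i, r ^ α i
        ≤ ∑ α ∈ Fintype.piFinset fun _ => Finset.range N, ∏ i, r ^ α i :=
          Finset.sum_le_sum_of_subset_of_nonneg
            (fun α hα => Fintype.mem_piFinset.mpr fun i => Finset.mem_range.mpr (hN α hα i))
            fun α _ _ => by positivity
      _ = ∏ _i : ι, ∑ e ∈ Finset.range N, r ^ e :=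
          (Finset.prod_univ_sum (fun _ => Finset.range N) fun _ e => r ^ e).symm
      _ ≤ _ := Finset.prod_le_prod (fun _ _ => by positivity) fun _ _ => by
          rw [← tsum_geometric_of_lt_one hr0 hr]
          exact (summable_geometric_of_lt_one hr0 hr).sum_le_tsum _ fun _ _ => by positivity
  refine ((Equiv.summable_iff (Finsupp.equivFunOnFinite : (ι →₀ ℕ) ≃ (ι → ℕ))).mpr h).congr fun α => ?_
  rw [Finsupp.degree_eq_sum, ← Finset.prod_pow_eq_pow_sum]
  rfl

end Summation

section Radius

variable {K ι : Type*} [RCLike K]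

lemma isConv_of_summable {F : MvPowerSeries ι K} {ρ : ℝ} (hρ : 0 < ρ)
    (h : Summable fun α => ‖MvPowerSeries.coeff α F‖ * ρ ^ α.degree) : IsConv F := by
  refine ⟨∑' α, ‖MvPowerSeries.coeff α F‖ * ρ ^ α.degree, max 1 ρ⁻¹,
    tsum_nonneg fun α => by positivity, le_max_left _ _, fun α => ?_⟩
  have h1 := h.le_tsum α fun _ _ => by positivity
  rw [← le_div_iff₀ (by positivity), div_eq_mul_inv, ← inv_pow] at h1
  refine h1.trans (mul_le_mul_of_nonneg_left ?_ (tsum_nonneg fun α => by positivity))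
  exact pow_le_pow_left₀ (by positivity) (le_max_right _ _) _

lemma summable_mono_radius {F : MvPowerSeries ι K} {ρ r : ℝ} (hr : 0 ≤ r) (hrρ : r ≤ ρ)
    (h : Summable fun α => ‖MvPowerSeries.coeff α F‖ * ρ ^ α.degree) :
    Summable fun α => ‖MvPowerSeries.coeff α F‖ * r ^ α.degree :=
  Summable.of_nonneg_of_le (fun α => by positivity) (fun α => by gcongr) h

end Radius

section CauchyProduct

open Finset.HasAntidiagonal

variable {A E : Type*} [NormedCommRing E] [CompleteSpace E] [AddCommMonoid A]
  [Finset.HasAntidiagonal A]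

lemma hasSum_sum_mul_antidiagonal {f g : A → E} (hf : Summable fun a => ‖f a‖)
    (hg : Summable fun a => ‖g a‖) :
    HasSum (fun n => ∑ x ∈ antidiagonal n, f x.1 * g x.2) ((∑' a, f a) * ∑' a, g a) := by
  have hfg := summable_mul_of_summable_norm hf hg
  rw [hf.of_norm.tsum_mul_tsum_eq_tsum_sum_antidiagonal hg.of_norm hfg]
  exact (summable_sum_mul_antidiagonal_of_summable_mul hfg).hasSum

end CauchyProduct

/-! ### Power series representing analytic germs -/

section Representation

variable {K ι : Type*} [RCLike K] [Fintype ι]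

lemma IsConv.exists_summable {F : MvPowerSeries ι K} (hF : IsConv F) :
    ∃ ρ : ℝ, 0 < ρ ∧ Summable fun α => ‖MvPowerSeries.coeff α F‖ * ρ ^ α.degree := by
  obtain ⟨C, R, hC, hR, h⟩ := hF
  have hR0 : 0 < R := by linarith
  refine ⟨(2 * R)⁻¹, by positivity, ?_⟩
  refine Summable.of_nonneg_of_le (fun α => by positivity) (fun α => ?_)
    ((summable_pow_degree (ι := ι) (r := 2⁻¹) (by norm_num) (by norm_num)).mul_left C)
  refine (mul_le_mul_of_nonneg_right (h α) (by positivity)).trans_eq ?_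
  rw [mul_assoc, ← mul_pow]
  congr 2
  field_simp

lemma norm_monomial_le {z : ι → K} {ρ : ℝ} (hz : ∀ i, ‖z i‖ ≤ ρ) (α : ι →₀ ℕ) :
    ‖∏ i, z i ^ α i‖ ≤ ρ ^ α.degree := by
  rw [norm_prod, Finsupp.degree_eq_sum, ← Finset.prod_pow_eq_pow_sum]
  refine Finset.prod_le_prod (fun _ _ => norm_nonneg _) fun i _ => ?_
  rw [norm_pow]
  exact pow_le_pow_left₀ (norm_nonneg _) (hz i) _

lemma summable_norm_eval {F : MvPowerSeries ι K} {ρ : ℝ}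
    (h : Summable fun α => ‖MvPowerSeries.coeff α F‖ * ρ ^ α.degree) {z : ι → K}
    (hz : ∀ i, ‖z i‖ ≤ ρ) : Summable fun α => ‖MvPowerSeries.coeff α F * ∏ i, z i ^ α i‖ :=
  Summable.of_nonneg_of_le (fun _ => norm_nonneg _) (fun α => by
    rw [norm_mul]
    exact mul_le_mul_of_nonneg_left (norm_monomial_le hz α) (norm_nonneg _)) h

lemma eventually_norm_le {ρ : ℝ} (hρ : 0 < ρ) : ∀ᶠ z : ι → K in 𝓝 0, ∀ i, ‖z i‖ ≤ ρ := by
  filter_upwards [Metric.ball_mem_nhds 0 hρ] with z hz i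
  exact (norm_le_pi_norm z i).trans (mem_ball_zero_iff.mp hz).le

lemma IsConv.eventually_summable {F : MvPowerSeries ι K} (hF : IsConv F) :
    ∀ᶠ z : ι → K in 𝓝 0, Summable fun α => ‖MvPowerSeries.coeff α F * ∏ i, z i ^ α i‖ := by
  obtain ⟨ρ, hρ, h⟩ := hF.exists_summable
  filter_upwards [eventually_norm_le hρ] with z hz
  exact summable_norm_eval h hz

/-- The function `f` is, near the origin, the sum of the convergent power series `F`. -/
structure Represents (F : MvPowerSeries ι K) (f : (ι → K) → K) : Prop where
  analytic : AnalyticAt K f 0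
  conv : IsConv F
  hasSum : ∀ᶠ z in 𝓝 0, HasSum (fun α => MvPowerSeries.coeff α F * ∏ i, z i ^ α i) (f z)

lemma Represents.zero : Represents (0 : MvPowerSeries ι K) 0 :=
  ⟨analyticAt_const, IsConv.zero, Eventually.of_forall fun z => by simp⟩

lemma Represents.add {F G : MvPowerSeries ι K} {f f' : (ι → K) → K} (hF : Represents F f)
    (hG : Represents G f') : Represents (F + G) (f + f') := by
  refine ⟨hF.analytic.add hG.analytic, hF.conv.add hG.conv, ?_⟩
  filter_upwards [hF.hasSum, hG.hasSum] with z h1 h2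
  have h := h1.add h2
  simp only [← add_mul, ← map_add] at h
  exact h

lemma Represents.neg {F : MvPowerSeries ι K} {f : (ι → K) → K} (hF : Represents F f) :
    Represents (-F) (-f) := by
  refine ⟨hF.analytic.neg, hF.conv.neg, ?_⟩
  filter_upwards [hF.hasSum] with z h1
  have h := h1.neg
  simp only [← neg_mul, ← map_neg] at h
  exact h

lemma Represents.sub {F G : MvPowerSeries ι K} {f f' : (ι → K) → K} (hF : Represents F f)
    (hG : Represents G f') : Represents (F - G) (f - f') := by
  rw [sub_eq_add_neg, sub_eq_add_neg]
  exact hF.add hG.neg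

lemma Represents.sum {κ : Type*} (s : Finset κ) {F : κ → MvPowerSeries ι K}
    {f : κ → (ι → K) → K} (hF : ∀ i ∈ s, Represents (F i) (f i)) :
    Represents (∑ i ∈ s, F i) (∑ i ∈ s, f i) := by
  induction s using Finset.cons_induction with
  | empty => exact Represents.zero
  | cons a s ha ih =>
    rw [Finset.sum_cons, Finset.sum_cons]
    exact (hF a (Finset.mem_cons_self a s)).add
      (ih fun i hi => hF i (Finset.mem_cons_of_mem hi))

lemma Represents.mul {F G : MvPowerSeries ι K} {f f' : (ι → K) → K} (hF : Represents F f)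
    (hG : Represents G f') : Represents (F * G) (f * f') := by
  classical
  refine ⟨hF.analytic.mul hG.analytic, ?_, ?_⟩
  · obtain ⟨ρ, hρ, h⟩ := hF.conv.exists_summable
    obtain ⟨ρ', hρ', h'⟩ := hG.conv.exists_summable
    set r := min ρ ρ' with hr
    have hr0 : 0 < r := lt_min hρ hρ'
    have h1 := summable_mono_radius hr0.le (min_le_left _ _) h
    have h2 := summable_mono_radius hr0.le (min_le_right _ _) h'
    have h3 := (hasSum_sum_mul_antidiagonal h1.norm h2.norm).summable
    refine isConv_of_summable hr0 (Summable.of_nonneg_of_le (fun α => by positivity) (fun α => ?_)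
      h3)
    rw [MvPowerSeries.coeff_mul]
    refine (mul_le_mul_of_nonneg_right (norm_sum_le _ _) (by positivity)).trans ?_
    rw [Finset.sum_mul]
    refine Finset.sum_le_sum fun x hx => le_of_eq ?_
    rw [← Finset.HasAntidiagonal.mem_antidiagonal.mp hx, norm_mul, map_add, pow_add]
    ring
  · filter_upwards [hF.hasSum, hG.hasSum, hF.conv.eventually_summable,
      hG.conv.eventually_summable] with z h1 h2 h3 h4
    have h6 := hasSum_sum_mul_antidiagonal h3 h4
    rw [h1.tsum_eq, h2.tsum_eq] at h6
    refine h6.congr_fun fun α => ?_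
    rw [MvPowerSeries.coeff_mul, Finset.sum_mul]
    refine Finset.sum_congr rfl fun x hx => ?_
    simp only [← Finset.HasAntidiagonal.mem_antidiagonal.mp hx, Finsupp.add_apply, pow_add, Finset.prod_mul_distrib]
    ring

lemma Represents.const [DecidableEq ι] (a : K) :
    Represents (MvPowerSeries.C a : MvPowerSeries ι K) fun _ => a := by
  refine ⟨analyticAt_const, ⟨‖a‖, 1, norm_nonneg _, le_rfl, fun α => ?_⟩,
    Eventually.of_forall fun z => ?_⟩
  · rw [MvPowerSeries.coeff_C]
    split_ifs <;> simp
  · have h := hasSum_ite_eq (0 : ι →₀ ℕ) a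
    refine h.congr_fun fun α => ?_
    rw [MvPowerSeries.coeff_C]
    split_ifs with h0
    · simp [h0]
    · simp

lemma Represents.coordinate [DecidableEq ι] (s : ι) :
    Represents (MvPowerSeries.X s : MvPowerSeries ι K) fun z => z s := by
  refine ⟨(ContinuousLinearMap.proj (R := K) (φ := fun _ : ι => K) s).analyticAt 0,
    ⟨1, 1, zero_le_one, le_rfl, fun α => ?_⟩, Eventually.of_forall fun z => ?_⟩
  · rw [MvPowerSeries.coeff_X]
    split_ifs <;> simp
  · have h := hasSum_ite_eq (Finsupp.single s 1 : ι →₀ ℕ) (z s)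
    refine h.congr_fun fun α => ?_
    rw [MvPowerSeries.coeff_X]
    split_ifs with h0
    · simp [h0, Finsupp.single_apply, pow_ite]
    · simp

/-- Termwise differentiation of a convergent power series. -/
lemma Represents.pderiv [DecidableEq ι] (k : ι) {F : MvPowerSeries ι K} {f : (ι → K) → K}
    (hF : Represents F f) : Represents (MvPowerSeries.pderiv K k F) (analyticD K k f) := by
  refine ⟨?_, hF.conv.pderiv k, ?_⟩
  · exact ((ContinuousLinearMap.apply K K (Pi.single k 1 : ι → K)).analyticAt _).comp
      hF.analytic.fderiv
  obtain ⟨ρ₁, hρ₁, h₁⟩ := hF.conv.exists_summable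
  obtain ⟨ρ₂, hρ₂, h₂⟩ := (hF.conv.pderiv k).exists_summable
  obtain ⟨ρ₃, hρ₃, h₃⟩ := Metric.eventually_nhds_iff_ball.mp
    (hF.hasSum.and hF.analytic.eventually_analyticAt)
  set ρ := min ρ₁ (min ρ₂ ρ₃) with hρ
  have hρ0 : 0 < ρ := lt_min hρ₁ (lt_min hρ₂ hρ₃)
  have h₁' := summable_mono_radius hρ0.le (min_le_left _ _) h₁
  have h₂' := summable_mono_radius hρ0.le ((min_le_right _ _).trans (min_le_left _ _)) h₂
  have hball : ∀ z ∈ Metric.ball (0 : ι → K) ρ, z ∈ Metric.ball (0 : ι → K) ρ₃ := fun z hz =>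
    Metric.ball_subset_ball ((min_le_right _ _).trans (min_le_right _ _)) hz
  filter_upwards [Metric.ball_mem_nhds 0 hρ0] with z hz
  have hzi : ∀ i, ‖z i‖ < ρ := fun i => (norm_le_pi_norm z i).trans_lt (mem_ball_zero_iff.mp hz)
  have hupd : ∀ s ∈ Metric.ball (0 : K) ρ, Function.update z k s ∈ Metric.ball (0 : ι → K) ρ := by
    intro s hs
    rw [mem_ball_zero_iff, pi_norm_lt_iff hρ0]
    intro i
    rcases eq_or_ne i k with rfl | hik
    · rw [Function.update_self]
      exact mem_ball_zero_iff.mp hs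
    · rw [Function.update_of_ne hik]
      exact hzi i
  -- the terms of the series along the line through `z`
  let w : (ι →₀ ℕ) → K := fun α => ∏ i ∈ Finset.univ.erase k, z i ^ α i
  let t : (ι →₀ ℕ) → K → K := fun α s => MvPowerSeries.coeff α F * (s ^ α k * w α)
  let t' : (ι →₀ ℕ) → K → K := fun α s =>
    MvPowerSeries.coeff α F * ((α k * s ^ (α k - 1)) * w α)
  have ht : ∀ s α, t α s = MvPowerSeries.coeff α F * ∏ i, Function.update z k s i ^ α i := by
    intro s α
    simp only [t, w]
    rw [← Finset.mul_prod_erase Finset.univ _ (Finset.mem_univ k), Function.update_self]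
    congr 2
    refine Finset.prod_congr rfl fun i hi => ?_
    rw [Function.update_of_ne (Finset.ne_of_mem_erase hi)]
  have hinj : Function.Injective fun β : ι →₀ ℕ => β + Finsupp.single k 1 :=
    add_left_injective _
  have hrange : ∀ α, α ∉ Set.range (fun β : ι →₀ ℕ => β + Finsupp.single k 1) → α k = 0 := by
    intro α hα
    by_contra h0
    exact hα ⟨α - Finsupp.single k 1, tsub_add_cancel_of_le
      (Finsupp.single_le_iff.mpr (Nat.one_le_iff_ne_zero.mpr h0))⟩
  have ht'comp : ∀ s ∈ Metric.ball (0 : K) ρ, ∀ β, t' (β + Finsupp.single k 1) s =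
      MvPowerSeries.coeff β (MvPowerSeries.pderiv K k F) *
        ∏ i, Function.update z k s i ^ β i := by
    intro s _ β
    have hw : w (β + Finsupp.single k 1) = ∏ i ∈ Finset.univ.erase k, z i ^ β i := by
      refine Finset.prod_congr rfl fun i hi => ?_
      rw [Finsupp.add_apply, Finsupp.single_eq_of_ne (Finset.ne_of_mem_erase hi), add_zero]
    have hw' : ∏ i ∈ Finset.univ.erase k, Function.update z k s i ^ β i =
        ∏ i ∈ Finset.univ.erase k, z i ^ β i := by
      refine Finset.prod_congr rfl fun i hi => ?_
      rw [Function.update_of_ne (Finset.ne_of_mem_erase hi)]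
    simp only [t']
    rw [hw, MvPowerSeries.coeff_pderiv, ← Finset.mul_prod_erase Finset.univ _ (Finset.mem_univ k),
      Function.update_self, hw', Finsupp.add_apply, Finsupp.single_eq_same, Nat.add_sub_cancel]
    push_cast
    ring
  -- The majorant is the absolute series of the formal derivative, shifted by one in direction `k`.
  -- Where the truncated subtraction could matter, `α k = 0` kills the term.
  let U : (ι →₀ ℕ) → ℝ := fun α => ‖MvPowerSeries.coeff α F‖ * (α k * ρ ^ (α.degree - 1))
  have hU : Summable U := by
    refine (hinj.summable_iff fun α hα => ?_).mp (h₂'.congr fun β => ?_)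
    · simp [U, hrange α hα]
    · simp only [U, Function.comp_apply, MvPowerSeries.coeff_pderiv, norm_mul, map_add,
        Finsupp.degree_single, Nat.add_sub_cancel, Finsupp.add_apply, Finsupp.single_eq_same]
      rw [← Nat.cast_succ, RCLike.norm_natCast]
      ring
  have ht'U : ∀ α s, s ∈ Metric.ball (0 : K) ρ → ‖t' α s‖ ≤ U α := by
    intro α s hs
    by_cases hα : α ∈ Set.range fun β : ι →₀ ℕ => β + Finsupp.single k 1
    · obtain ⟨β, rfl⟩ := hα
      rw [ht'comp s hs]
      have h4 := norm_monomial_le (z := Function.update z k s) (ρ := ρ) (fun i =>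
        (norm_le_pi_norm _ i).trans (mem_ball_zero_iff.mp (hupd s hs)).le) β
      rw [norm_mul]
      refine (mul_le_mul_of_nonneg_left h4 (norm_nonneg _)).trans_eq ?_
      simp only [U, MvPowerSeries.coeff_pderiv, norm_mul, map_add,
        Finsupp.degree_single, Nat.add_sub_cancel, Finsupp.add_apply, Finsupp.single_eq_same]
      rw [← Nat.cast_succ, RCLike.norm_natCast]
      ring
    · simp [t', U, hrange α hα]
  have hzk : z k ∈ Metric.ball (0 : K) ρ := mem_ball_zero_iff.mpr (hzi k)
  have hderiv : HasDerivAt (fun s => ∑' α, t α s) (∑' α, t' α (z k)) (z k) := by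
    refine hasDerivAt_tsum_of_isPreconnected hU Metric.isOpen_ball
      (convex_ball (0 : K) ρ).isPreconnected (fun α s _ => ?_) ht'U hzk ?_ hzk
    · exact ((hasDerivAt_pow (α k) s).mul_const (w α)).const_mul _
    · simp only [ht]
      exact (summable_norm_eval h₁' fun i =>
        (norm_le_pi_norm _ i).trans (mem_ball_zero_iff.mp (hupd _ hzk)).le).of_norm
  have hf : HasDerivAt (fun s => f (Function.update z k s)) (analyticD K k f z) (z k) := by
    have h5 : HasFDerivAt f (fderiv K f z) (Function.update z k (z k)) := by
      rw [Function.update_eq_self]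
      exact (h₃ z (hball z hz)).2.differentiableAt.hasFDerivAt
    exact h5.comp_hasDerivAt (z k) (hasDerivAt_update z k (z k))
  have heq : (fun s => f (Function.update z k s)) =ᶠ[𝓝 (z k)] fun s => ∑' α, t α s := by
    filter_upwards [Metric.isOpen_ball.mem_nhds hzk] with s hs
    simp only [ht]
    exact ((h₃ _ (hball _ (hupd s hs))).1.tsum_eq).symm
  rw [hf.unique (hderiv.congr_of_eventuallyEq heq)]
  have hs : HasSum (fun α => t' α (z k)) (∑' α, t' α (z k)) :=
    (Summable.of_norm_bounded hU fun α => ht'U α _ hzk).hasSum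
  refine ((hinj.hasSum_iff fun α hα => ?_).mpr hs).congr_fun fun β => ?_
  · simp [t', hrange α hα]
  · rw [Function.comp_apply, ht'comp _ hzk, Function.update_eq_self]

lemma Represents.coeff_zero {F : MvPowerSeries ι K} {f : (ι → K) → K} (hF : Represents F f) :
    MvPowerSeries.coeff 0 F = f 0 := by
  refine HasSum.unique ?_ hF.hasSum.self_of_nhds
  have h := hasSum_single (f := fun α : ι →₀ ℕ => MvPowerSeries.coeff α F *
    ∏ i, (0 : ι → K) i ^ α i) 0 fun α hα => by
      obtain ⟨i, hi⟩ := Finsupp.ne_iff.mp hα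
      exact mul_eq_zero_of_right _ (Finset.prod_eq_zero (Finset.mem_univ i) (by simpa using hi))
  simpa using h

/-- The power series of a germ is unique. -/
lemma Represents.eq_zero [DecidableEq ι] {F : MvPowerSeries ι K} {f : (ι → K) → K}
    (hF : Represents F f) (hf : f =ᶠ[𝓝 0] 0) : F = 0 := by
  -- The induction on the degree needs all pairs at once: a coefficient of positive degree is, up to
  -- a nonzero integer, one of lower degree of a partial derivative, which again represents the zero
  -- germ.
  have key : ∀ n (F : MvPowerSeries ι K) (f : (ι → K) → K), Represents F f → f =ᶠ[𝓝 0] 0 →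
      ∀ α : ι →₀ ℕ, α.degree = n → MvPowerSeries.coeff α F = 0 := by
    intro n
    induction n with
    | zero =>
      intro F f hF hf α hα
      rw [(Finsupp.degree_eq_zero_iff α).mp hα, hF.coeff_zero]
      exact hf.self_of_nhds
    | succ n ih =>
      intro F f hF hf α hα
      obtain ⟨k, hk⟩ : ∃ k, α k ≠ 0 := by
        by_contra! h0
        rw [show α = 0 from Finsupp.ext h0] at hα
        simp at hα
      obtain ⟨β, rfl⟩ : ∃ β, α = β + Finsupp.single k 1 :=
        ⟨α - Finsupp.single k 1, (tsub_add_cancel_of_le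
          (Finsupp.single_le_iff.mpr (Nat.one_le_iff_ne_zero.mpr hk))).symm⟩
      rw [map_add, Finsupp.degree_single, Nat.add_right_cancel_iff] at hα
      have hD : analyticD K k f =ᶠ[𝓝 0] 0 := by
        filter_upwards [hf.eventuallyEq_nhds] with z hz
        rw [analyticD, hz.fderiv_eq]
        simp
      have h := ih _ _ (hF.pderiv k) hD β hα
      rw [MvPowerSeries.coeff_pderiv, mul_eq_zero] at h
      exact h.resolve_right (Nat.cast_add_one_ne_zero _)
  ext α
  rw [key _ F f hF hf α rfl, map_zero]

lemma Represents.eventuallyEq {F : MvPowerSeries ι K} {f f' : (ι → K) → K} (hF : Represents F f)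
    (hF' : Represents F f') : f =ᶠ[𝓝 0] f' := by
  filter_upwards [hF.hasSum, hF'.hasSum] with z h1 h2
  exact h1.unique h2

end Representation

/-! ### Monomials as multilinear maps -/

section Words

variable {K ι : Type*} [RCLike K]

/-- The number of occurrences of each letter in a word. -/
noncomputable def letterCount {n : ℕ} (w : Fin n → ι) : ι →₀ ℕ := ∑ j, Finsupp.single (w j) 1

lemma degree_letterCount {n : ℕ} (w : Fin n → ι) : (letterCount w).degree = n := by
  simp [letterCount, map_sum]

lemma exists_letterCount_eq {n : ℕ} {α : ι →₀ ℕ} (h : α.degree = n) :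
    ∃ w : Fin n → ι, letterCount w = α := by
  induction n generalizing α with
  | zero =>
    rw [Finsupp.degree_eq_zero_iff] at h
    exact ⟨Fin.elim0, by simp [letterCount, h]⟩
  | succ n ih =>
    obtain ⟨k, hk⟩ : ∃ k, α k ≠ 0 := by
      by_contra! h0
      rw [show α = 0 from Finsupp.ext h0] at h
      simp at h
    obtain ⟨β, rfl⟩ : ∃ β, α = β + Finsupp.single k 1 :=
      ⟨α - Finsupp.single k 1, (tsub_add_cancel_of_le
        (Finsupp.single_le_iff.mpr (Nat.one_le_iff_ne_zero.mpr hk))).symm⟩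
    rw [map_add, Finsupp.degree_single, Nat.add_right_cancel_iff] at h
    obtain ⟨w, rfl⟩ := ih h
    refine ⟨Fin.cons k w, ?_⟩
    simp [letterCount, Fin.sum_univ_succ, add_comm]

/-- The product of the coordinates along a word, as a multilinear map. -/
noncomputable def wordMap (K : Type*) [RCLike K] {n : ℕ} (w : Fin n → ι) :
    ContinuousMultilinearMap K (fun _ : Fin n => ι → K) K :=
  (ContinuousMultilinearMap.mkPiAlgebra K (Fin n) K).compContinuousLinearMap fun j =>
    ContinuousLinearMap.proj (w j)

lemma wordMap_apply {n : ℕ} (w : Fin n → ι) (v : Fin n → ι → K) :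
    wordMap K w v = ∏ j, v j (w j) := by
  simp [wordMap]

lemma norm_wordMap_le [Fintype ι] {n : ℕ} (w : Fin n → ι) : ‖wordMap K w‖ ≤ 1 := by
  refine ContinuousMultilinearMap.opNorm_le_bound zero_le_one fun v => ?_
  rw [wordMap_apply, norm_prod, one_mul]
  exact Finset.prod_le_prod (fun _ _ => norm_nonneg _) fun j _ => norm_le_pi_norm _ _

end Words

/-! ### Multi-index series versus Mathlib's analytic functions -/

section Regrouping

variable {K ι : Type*} [RCLike K] [Fintype ι] [DecidableEq ι]

lemma mem_finsuppAntidiag_univ {n : ℕ} {α : ι →₀ ℕ} :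
    α ∈ Finset.finsuppAntidiag (Finset.univ : Finset ι) n ↔ α.degree = n := by
  rw [Finset.mem_finsuppAntidiag, Finsupp.degree_eq_sum]
  simp

/-- Summation by degrees. -/
lemma hasSum_by_degree {t : (ι →₀ ℕ) → K} {s : K} (h : HasSum t s) :
    HasSum (fun n => ∑ α ∈ Finset.finsuppAntidiag (Finset.univ : Finset ι) n, t α) s := by
  refine (h.tsum_fiberwise fun α : ι →₀ ℕ => α.degree).congr_fun fun n => ?_
  have : (fun α : ι →₀ ℕ => α.degree) ⁻¹' {n} =
      ↑(Finset.finsuppAntidiag (Finset.univ : Finset ι) n) := by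
    ext α
    rw [Finset.mem_coe, mem_finsuppAntidiag_univ]
    rfl
  rw [this, Finset.tsum_subtype']

lemma prod_letterCount {n : ℕ} (w : Fin n → ι) (z : ι → K) :
    ∏ i, z i ^ letterCount w i = ∏ j, z (w j) := by
  simp only [letterCount, Finsupp.coe_finsetSum, Finset.sum_apply, ← Finset.prod_pow_eq_pow_sum]
  rw [Finset.prod_comm]
  refine Finset.prod_congr rfl fun j _ => ?_
  simp [Finsupp.single_apply, pow_ite]

/-- Convergent power series represent analytic germs. -/
theorem IsConv.exists_represents {F : MvPowerSeries ι K} (hF : IsConv F) :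
    ∃ f, Represents F f := by
  choose w hw using fun n (α : {α : ι →₀ ℕ // α ∈ Finset.finsuppAntidiag Finset.univ n}) =>
    exists_letterCount_eq (mem_finsuppAntidiag_univ.mp α.2)
  -- One word per monomial suffices: the multilinear maps need not be symmetric, as only their
  -- diagonal values enter the sum.
  let p : FormalMultilinearSeries K (ι → K) K := fun n =>
    ∑ α : {α : ι →₀ ℕ // α ∈ Finset.finsuppAntidiag Finset.univ n},
      MvPowerSeries.coeff α.1 F • wordMap K (w n α)
  have hp : ∀ n (z : ι → K), p n (fun _ => z) = ∑ α ∈ Finset.finsuppAntidiag Finset.univ n,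
      MvPowerSeries.coeff α F * ∏ i, z i ^ α i := by
    intro n z
    rw [← Finset.sum_coe_sort]
    simp only [p, sum_apply, smul_apply,
      wordMap_apply, smul_eq_mul]
    refine Finset.sum_congr rfl fun α _ => ?_
    rw [← prod_letterCount, hw]
  obtain ⟨ρ, hρ, h⟩ := hF.exists_summable
  have hrad : (ρ.toNNReal : ENNReal) ≤ p.radius := by
    refine p.le_radius_of_bound (∑' α, ‖MvPowerSeries.coeff α F‖ * ρ ^ α.degree) fun n => ?_
    have h1 : ‖p n‖ ≤ ∑ α ∈ Finset.finsuppAntidiag (Finset.univ : Finset ι) n,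
        ‖MvPowerSeries.coeff α F‖ := by
      rw [← Finset.sum_coe_sort]
      refine (norm_sum_le _ _).trans (Finset.sum_le_sum fun α _ => ?_)
      rw [norm_smul]
      exact mul_le_of_le_one_right (norm_nonneg _) (norm_wordMap_le _)
    rw [Real.coe_toNNReal ρ hρ.le]
    refine (mul_le_mul_of_nonneg_right h1 (by positivity)).trans ?_
    rw [Finset.sum_mul]
    refine le_trans (le_of_eq ?_) (h.sum_le_tsum (Finset.finsuppAntidiag Finset.univ n)
      fun α _ => by positivity)
    refine Finset.sum_congr rfl fun α hα => ?_
    rw [mem_finsuppAntidiag_univ.mp hα]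
  have hpos : 0 < p.radius := lt_of_lt_of_le (by
    rw [ENNReal.coe_pos]
    exact Real.toNNReal_pos.mpr hρ) hrad
  refine ⟨p.sum, (p.hasFPowerSeriesOnBall hpos).analyticAt, hF, ?_⟩
  filter_upwards [hF.eventually_summable] with z hz
  have h1 := hz.of_norm.hasSum
  have h2 := hasSum_by_degree h1
  rw [← h2.tsum_eq] at h1
  simpa only [FormalMultilinearSeries.sum, hp] using h1

/-- Expand `z` in the standard basis in every slot and collect the words that give the same
monomial. -/
lemma map_eq_sum_words {n : ℕ} (q : ContinuousMultilinearMap K (fun _ : Fin n => ι → K) K)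
    (z : ι → K) : q (fun _ => z) = ∑ α ∈ Finset.finsuppAntidiag (Finset.univ : Finset ι) n,
      (∑ w : Fin n → ι with letterCount w = α, q fun j => Pi.single (w j) 1) *
        ∏ i, z i ^ α i := by
  have hz : (fun _ : Fin n => z) = fun _ => ∑ i, z i • (Pi.single i 1 : ι → K) := by
    funext j i
    simp [Finset.sum_apply, Pi.single_apply]
  rw [hz, ContinuousMultilinearMap.map_sum,
    ← Finset.sum_fiberwise_of_maps_to (g := letterCount)
      (t := Finset.finsuppAntidiag (Finset.univ : Finset ι) n)
      fun w _ => mem_finsuppAntidiag_univ.mpr (degree_letterCount w)]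
  refine Finset.sum_congr rfl fun α _ => ?_
  rw [Finset.sum_mul]
  refine Finset.sum_congr rfl fun w hw => ?_
  rw [ContinuousMultilinearMap.map_smul_univ q (fun j => z (w j)) fun j => Pi.single (w j) 1,
    smul_eq_mul, mul_comm, ← prod_letterCount, (Finset.mem_filter.mp hw).2]

/-- Analytic germs are represented by convergent power series. -/
theorem exists_represents_of_analyticAt {f : (ι → K) → K} (hf : AnalyticAt K f 0) :
    ∃ F : MvPowerSeries ι K, Represents F f := by
  obtain ⟨p, r, hp⟩ := hf
  let F : MvPowerSeries ι K := fun α =>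
    ∑ w : Fin α.degree → ι with letterCount w = α, p α.degree fun j => Pi.single (w j) 1
  have hFc : ∀ n, ∀ α ∈ Finset.finsuppAntidiag (Finset.univ : Finset ι) n,
      MvPowerSeries.coeff α F =
        ∑ w : Fin n → ι with letterCount w = α, p n fun j => Pi.single (w j) 1 := by
    intro n α hα
    obtain rfl := mem_finsuppAntidiag_univ.mp hα
    rfl
  obtain ⟨ρ, hρ0, hρr⟩ := ENNReal.lt_iff_exists_nnreal_btwn.mp hp.r_pos
  have hρ : 0 < ρ := ENNReal.coe_pos.mp hρ0
  obtain ⟨C, hC, hb⟩ := p.norm_le_div_pow_of_pos_of_lt_radius hρ (hρr.trans_le hp.r_le)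
  have hρ' : (0 : ℝ) < ρ := hρ
  have hconv : IsConv F := by
    -- A coefficient of degree `n` sums at most `(card ι) ^ n` words, each at most `C / ρ ^ n`; the
    -- added 1 keeps the base at least 1.
    refine ⟨C, 1 + Fintype.card ι / ρ, hC.le, le_add_of_nonneg_right (by positivity), fun α => ?_⟩
    set n := α.degree with hn
    rw [hFc n α (mem_finsuppAntidiag_univ.mpr rfl)]
    have h1 : ∀ w : Fin n → ι, ‖p n fun j => (Pi.single (w j) 1 : ι → K)‖ ≤ C / (ρ : ℝ) ^ n := by
      intro w
      refine ((p n).le_opNorm _).trans ((mul_le_of_le_one_right (norm_nonneg _) ?_).trans (hb n))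
      refine Finset.prod_le_one (fun _ _ => norm_nonneg _) fun j _ => ?_
      rw [Pi.norm_single, norm_one]
    refine (norm_sum_le _ _).trans ((Finset.sum_le_sum_of_subset_of_nonneg
      (Finset.filter_subset _ _) fun _ _ _ => norm_nonneg _).trans ?_)
    refine (Finset.sum_le_card_nsmul _ _ _ fun w _ => h1 w).trans ?_
    rw [nsmul_eq_mul, Finset.card_univ, Fintype.card_fun, Fintype.card_fin, Nat.cast_pow,
      mul_div_left_comm, ← div_pow]
    refine mul_le_mul_of_nonneg_left (pow_le_pow_left₀ (by positivity) ?_ n) hC.le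
    exact le_add_of_nonneg_left zero_le_one
  refine ⟨F, ⟨p, r, hp⟩, hconv, ?_⟩
  filter_upwards [hconv.eventually_summable, Metric.eball_mem_nhds 0 hp.r_pos] with z hz hzr
  have h1 := hp.hasSum hzr
  rw [zero_add] at h1
  have h2 := hz.of_norm.hasSum
  have h3 := (hasSum_by_degree h2).congr_fun fun n => (map_eq_sum_words (p n) z).trans
    (Finset.sum_congr rfl fun α hα => by rw [hFc n α hα])
  rwa [h3.unique h1] at h2

end Regrouping

/-! ### Transfer to analytic germs -/

section AnalyticCohomology

variable {K g : Type*} [RCLike K] [LieRing g] [LieAlgebra K g] {l m : ℕ}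

lemma represents_poisson (b : Module.Basis (Fin m) K g) (i j : Coord l m) :
    Represents (formalPoisson l b i j) (analyticPoisson l b i j) := by
  have h1 : Represents (1 : MvPowerSeries (Coord l m) K) 1 := by
    have h := Represents.const (ι := Coord l m) (1 : K)
    rwa [map_one] at h
  rcases i with i | i | i <;> rcases j with j | j | j
  case inl.inr.inl =>
    simp only [productPoisson]
    split_ifs
    exacts [h1, Represents.zero]
  case inr.inl.inl =>
    simp only [productPoisson]
    split_ifs
    exacts [h1.neg, Represents.zero]
  case inr.inr.inr.inr =>
    simp only [productPoisson]
    exact Represents.sum _ fun k _ => (Represents.const _).mul (Represents.coordinate _)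
  all_goals exact Represents.zero

lemma represents_lieBivector (b : Module.Basis (Fin m) K g)
    {X' : Coord l m → MvPowerSeries (Coord l m) K} {X : Coord l m → (Coord l m → K) → K}
    (hX : ∀ i, Represents (X' i) (X i)) (i j : Coord l m) :
    Represents (lieBivector (formalD K) (formalPoisson l b) X' i j)
      (lieBivector (analyticD K) (analyticPoisson l b) X i j) :=
  Represents.sum _ fun k _ => (((hX k).mul ((represents_poisson b i j).pderiv k)).sub
    ((represents_poisson b k j).mul ((hX i).pderiv k))).sub
    ((represents_poisson b i k).mul ((hX j).pderiv k))

lemma represents_hamiltonianField (b : Module.Basis (Fin m) K g)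
    {h' : MvPowerSeries (Coord l m) K} {h : (Coord l m → K) → K} (hh : Represents h' h)
    (i : Coord l m) :
    Represents (hamiltonianField (formalD K) (formalPoisson l b) h' i)
      (hamiltonianField (analyticD K) (analyticPoisson l b) h i) :=
  Represents.sum _ fun j _ => (hh.pderiv j).mul (represents_poisson b j i)

/-- Analytic Poisson fields are Hamiltonian. -/
theorem mem_analyticHamiltonianFields [LieAlgebra.IsKilling K g] (b : Module.Basis (Fin m) K g)
    {X : Coord l m → (Coord l m → K) → K} (hX : X ∈ analyticPoissonFields l b) :
    X ∈ analyticHamiltonianFields l b := by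
  choose X' hX' using fun i => exists_represents_of_analyticAt (hX.1 i)
  -- Uniqueness of the series of a germ turns the local equation `[X, Π] = 0` into the formal one;
  -- the convergent formal Hamiltonian is then summed to a germ.
  obtain ⟨h', hh', hc⟩ := exists_hamiltonian b (X := X') fun i j =>
    (represents_lieBivector b hX' i j).eq_zero (hX.2 i j)
  obtain ⟨h, hh⟩ := (hc fun i => (hX' i).conv).exists_represents
  refine ⟨h, hh.analytic, fun i => (hX' i).eventuallyEq ?_⟩
  rw [hh']
  exact represents_hamiltonianField b hh i

end AnalyticCohomology

end LocalPoisson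

theorem proposition4p1 {K : Type*} [RCLike K] {g : Type*} [LieRing g] [LieAlgebra K g]
    [LieAlgebra.IsSemisimple K g] (l m : ℕ) (b : Module.Basis (Fin m) K g) :
    Subsingleton (LocalPoisson.FormalH1 l b) ∧ Subsingleton (LocalPoisson.AnalyticH1 l b) := by
  have : FiniteDimensional K g := b.finiteDimensional_of_finite
  -- Cartan's criterion in characteristic zero: semisimplicity makes the Killing form nondegenerate.
  have : LieAlgebra.IsKilling K g := inferInstance
  constructor
  · rw [Submodule.Quotient.subsingleton_iff, Submodule.submoduleOf_eq_top]
    intro X hX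
    obtain ⟨h, hh, -⟩ := LocalPoisson.exists_hamiltonian b hX
    exact ⟨h, hh⟩
  · rw [Submodule.Quotient.subsingleton_iff, Submodule.submoduleOf_eq_top]
    exact fun X hX => LocalPoisson.mem_analyticHamiltonianFields b hX
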